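/- Let $F$ be a non-archimedean local field of characteristic different from $2$, with ring of integers $\mathfrak o$, maximal ideal $\mathfrak p=\varpi\mathfrak o$, residue field of cardinality $q$ and normalized absolute value $|\cdot|$ ($|\varpi|=q^{-1}$); let $dx$ be the Haar measure of $F$ with $\mathrm{vol}(\mathfrak o)=1$, and let $\psi$ be an additive character of $F$ that is trivial on $\mathfrak o$ and not on $\mathfrak p^{-1}$. Put $\mathfrak u(x,y,z)=\begin{pmatrix}1&x&z\\&1&y\\&&1\end{pmatrix}$, $h(a,b)=\mathrm{diag}(a,b,a^{-1}b^{-1})$, $w=\begin{pmatrix}&&1\\&1&\\1&&\end{pmatrix}$, $N_2=\{\mathfrak u(r,r,t):r,t\in F\}\subset \mathrm{SL}_3(F)$, and for $n\ge 1$ let $$K_n=\{g\in \mathrm{GL}_3(F): g,g^{-1}\in \begin{pmatrix}\mathfrak o&\mathfrak o&\mathfrak p^{-n}\\ \mathfrak p^n&1+\mathfrak p^n&\mathfrak o\\ \mathfrak p^n&\mathfrak p^n&\mathfrak o\end{pmatrix}\}.$$ **The Whittaker function.** Let $\mu_1,\mu_2,\mu_3,\chi$ be quasi-characters of $F^\times$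 with $\mu_1,\mu_3,\chi$ unramified, $\mu_1\mu_3=1$, and $\mu_2$ ramified of conductor $c\ge1$; put $t_1=\mu_1(\varpi)$. Let $f$ be the function on $\mathrm{GL}_3(F)$ supported on $B_3K_c$ ($B_3$ the upper triangular subgroup) with $f(\mathrm{diag}(a_1,a_2,a_3)uk)=\mu_1(a_1)\mu_2(a_2)\mu_3(a_3)|a_1/a_3|$ for $u$ unipotent upper triangular and $k\in K_c$; it is the new form of $\mathrm{Ind}_{B_3}^{\mathrm{GL}_3(F)}(\mu_1\otimes\mu_2\otimes\mu_3)$. Let $$W_c(g)=\lim_{k\to\infty}\int_{x,y\in\mathfrak p^{-k},\,z\in\mathfrak p^{-2k}} f(w\,\mathfrak u(x,y,z)\,g)\,\psi^{-1}(x-y)\,dx\,dy\,dz$$ be the associated Whittaker function, for the generic character $\mathfrak u(x,y,z)\mapsto\psi(x-y)$, which is trivial on $N_2$. **The section.** Realize $G_2(F)$ as the group of $8\times8$ matrices generated by the root subgroups $\mathbf x_{\pm\alpha}(r)=\exp(rX_{\pm\alpha})$, $\mathbf x_{\pm\beta}(r)=\exp(rX_{\pm\beta})$, where $X_\alpha=E_{12}+E_{34}+E_{35}-E_{46}-E_{56}-E_{78}$,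 $X_\beta=E_{23}-E_{67}$, $X_{-\alpha}={}^tX_\alpha$, $X_{-\beta}={}^tX_\beta$. Let $w_\beta(t)=\mathbf x_\beta(t)\mathbf x_{-\beta}(-t^{-1})\mathbf x_\beta(t)$, $w_\beta=w_\beta(1)$, $h_\beta(t)=w_\beta(t)w_\beta^{-1}$. Let $P=MU^\alpha$ be the parabolic subgroup of $G_2$ stabilizing the plane $\langle e_1,e_2\rangle$ (its Levi subgroup $M\cong \mathrm{GL}_2$ contains $\mathbf x_{\pm\alpha}$), and for $p\in P$ let $\det p$ be the determinant of its upper left $2\times2$ block and $\chi_s(p)=\chi(\det p)|\det p|^{3s}$. Fix $\tau\in F^\times$ and $\rho=\tau^2$. The stabilizer $H_\rho\subset G_2(F)$ of ${}^t(0,0,1,0,0,\rho,0,0)$ is identified with $\mathrm{SL}_3(F)$ by $g\mapsto\gamma^{-1}\,i(dgd^{-1})\,\gamma$, where $d=\mathrm{diag}(1,1,-1)$, $\gamma=h_\beta(\frac1{2\tau})\mathbf x_\alpha(\frac1{2\tau})\mathbf x_{-\alpha}(-\tau)$, and $i(A)$ acts by $A$ on $\langle e_2,e_3,e_8\rangle$,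 by ${}^tA^{-1}$ on $\langle e_7,e_6,e_1\rangle$ and trivially on $e_4,e_5$. Let $f_s^c$ be the function on $\mathrm{SL}_3(F)$ which vanishes off $B_3K_c\cap \mathrm{SL}_3(F)$ and satisfies $$f_s^c\big(n\,h(a,1)\,\mathfrak u(x,0,0)\,h(1,b)\,k\big)=\chi(a)|a|^{3s}\,1_{1+\mathfrak p^c}(b)\,1_{\mathfrak o}(x)\qquad(n\in N_2,\ k\in K_c\cap \mathrm{SL}_3(F)),$$ and let $\tilde f_s^c$ be the function on $G_2(F)$ supported on $Pw_\beta H_\rho$ with $\tilde f_s^c(pw_\beta g)=\chi_s(p)f_s^c(g)$ for $p\in P$, $g\in H_\rho=\mathrm{SL}_3(F)$. **Claim.** Let $dg$ be a Haar measure of $\mathrm{SL}_3(F)$, and give $N_2\backslash \mathrm{SL}_3(F)$ the quotient of $dg$ by the measure $dr\,dt$ of $N_2$. Then Ginzburg's local zeta integral $$Z(W_c,\tilde f_s^c)=\int_{N_2\backslash \mathrm{SL}_3(F)}W_c(g)\,\tilde f_s^c(w_\beta g)\,dg$$ converges absolutely for all $s\in\mathbb C$ with $|t_1^{2}\chi(\varpi)q^{-(3s-1)}|<1$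 and $|t_1^{-2}\chi(\varpi)q^{-(3s-1)}|<1$, and for these $s$ $$Z(W_c,\tilde f_s^c)=D_c\,\frac{1+\chi(\varpi)q^{-(3s-1)}}{(1-t_1^2\chi(\varpi)q^{-(3s-1)})(1-t_1^{-2}\chi(\varpi)q^{-(3s-1)})},\qquad D_c=\mathrm{vol}(K_c\cap \mathrm{SL}_3(F),dg)\,\mathrm{vol}(1+\mathfrak p^c,dx)\,W_c(1).$$ The right-hand side is meromorphic in $s\in\mathbb C$, and every meromorphic function on $\mathbb C$ that equals the integral for $\mathrm{Re}(s)$ large equals the right-hand side off a closed discrete set. -/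

import Mathlib

open MeasureTheory Filter Topology
open scoped ENNReal NNReal

namespace GinzburgZeta

/-! ### The local field

`F` is a nontrivially normed, ultrametric, locally compact field, i.e. a non-archimedean local
field; the theorem requires its norm to be the normalized absolute value. -/

section Field

variable (F : Type*) [NontriviallyNormedField F] [IsUltrametricDist F]

/-- The number `q` of elements of the residue field of `F`. -/
noncomputable def resCard : ℕ :=
  Nat.card (IsLocalRing.ResidueField (NormedField.valuation (K := F)).valuationSubring)

/-- The fractional ideal `𝔭ⁿ = {x : |x| ≤ q⁻ⁿ}`, for `n ∈ ℤ`; in particular `𝔭⁰ = 𝔬`. -/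
def fracIdeal (n : ℤ) : Set F := {x | ‖x‖ ≤ (resCard F : ℝ) ^ (-n)}

variable {F}

/-- `ϖ` is a uniformizer (it generates the maximal ideal of the ring of integers) and the norm of
`F` is the normalized absolute value, `|ϖ| = q⁻¹`. -/
def IsNormalizedUniformizer (ϖ : Fˣ) : Prop :=
  (∀ x : F, ‖x‖ < 1 ↔ ∃ y : F, ‖y‖ ≤ 1 ∧ x = ϖ * y) ∧ ‖(ϖ : F)‖ = (resCard F : ℝ)⁻¹

/-- The subset `U⁰ = 𝔬ˣ`, `Uⁿ = 1 + 𝔭ⁿ` (`n ≥ 1`) of `Fˣ`. -/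
def unitFiltration (n : ℕ) : Set Fˣ :=
  if n = 0 then {a | ‖(a : F)‖ = 1} else {a | (a : F) - 1 ∈ fracIdeal F n}

/-- A quasi-character of `Fˣ` has conductor `c`: `c` is the least `n ≥ 0` such that it is trivial
on `Uⁿ`. It is unramified if `c = 0` and ramified if `c ≥ 1`. -/
def HasConductor (μ : Fˣ →ₜ* ℂˣ) (c : ℕ) : Prop :=
  IsLeast {n : ℕ | ∀ a ∈ unitFiltration (F := F) n, μ a = 1} c

/-- A nontrivial additive character of `F` which is unramified: trivial on `𝔬`, not on `𝔭⁻¹`. -/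
def IsUnramifiedAddChar (ψ : AddChar F Circle) : Prop :=
  Continuous ψ ∧ (∀ x ∈ fracIdeal F 0, ψ x = 1) ∧ ∃ x ∈ fracIdeal F (-1), ψ x ≠ 1

end Field

/-! ### Subgroups and elements of `GL₃(F)` and `SL₃(F)` -/

section GL3

variable {F : Type*} [Field F]

/-- The upper triangular unipotent matrix `𝔲(x, y, z)`. -/
def unip (x y z : F) : Matrix.SpecialLinearGroup (Fin 3) F :=
  ⟨!![1, x, z; 0, 1, y; 0, 0, 1], by simp [Matrix.det_fin_three]⟩

/-- The long Weyl element `w` of `GL₃`. -/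
def longWeyl : GL (Fin 3) F where
  val := !![0, 0, 1; 0, 1, 0; 1, 0, 0]
  inv := !![0, 0, 1; 0, 1, 0; 1, 0, 0]
  val_inv := by ext i j; fin_cases i <;> fin_cases j <;> simp [Matrix.mul_apply, Fin.sum_univ_three]
  inv_val := by ext i j; fin_cases i <;> fin_cases j <;> simp [Matrix.mul_apply, Fin.sum_univ_three]

/-- The element `h(a, b)`, identified with `diag(a, b, a⁻¹b⁻¹)` in `SL₃(F)`. -/
def torusSL (a b : Fˣ) : Matrix.SpecialLinearGroup (Fin 3) F :=
  ⟨!![(a : F), 0, 0; 0, (b : F), 0; 0, 0, ((a⁻¹ * b⁻¹ : Fˣ) : F)], by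
    simp [Matrix.det_fin_three]; field_simp⟩

/-- The subgroup `N₂` of `SL₃(F)` of all matrices with rows `(1, r, t)`, `(0, 1, r)`, `(0, 0, 1)`. -/
def N₂ (F : Type*) [Field F] : Subgroup (Matrix.SpecialLinearGroup (Fin 3) F) where
  carrier := {g | ∃ r t : F, g = unip r r t}
  one_mem' := ⟨0, 0, by
    ext i j; fin_cases i <;> fin_cases j <;> simp [unip]⟩
  mul_mem' := by
    rintro _ _ ⟨r, t, rfl⟩ ⟨r', t', rfl⟩
    refine ⟨r + r', t + t' + r * r', ?_⟩
    ext i j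
    rw [Matrix.SpecialLinearGroup.coe_mul]
    fin_cases i <;> fin_cases j <;>
      simp [unip, Matrix.mul_apply, Fin.sum_univ_three] <;> ring
  inv_mem' := by
    rintro _ ⟨r, t, rfl⟩
    refine ⟨-r, r * r - t, ?_⟩
    rw [inv_eq_iff_mul_eq_one]
    ext i j
    rw [Matrix.SpecialLinearGroup.coe_mul]
    fin_cases i <;> fin_cases j <;>
      simp [unip, Matrix.mul_apply, Fin.sum_univ_three] <;> ring

end GL3

section Whittaker

variable {F : Type*} [NontriviallyNormedField F] [IsUltrametricDist F]

/-- The shape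
`(𝔬, 𝔬, 𝔭⁻ⁿ ; 𝔭ⁿ, 1 + 𝔭ⁿ, 𝔬 ; 𝔭ⁿ, 𝔭ⁿ, 𝔬)` of the matrices in `Kₙ`. -/
def KShape (n : ℕ) (A : Matrix (Fin 3) (Fin 3) F) : Prop :=
  A 0 0 ∈ fracIdeal F 0 ∧ A 0 1 ∈ fracIdeal F 0 ∧ A 0 2 ∈ fracIdeal F (-n) ∧
  A 1 0 ∈ fracIdeal F n ∧ A 1 1 - 1 ∈ fracIdeal F n ∧ A 1 2 ∈ fracIdeal F 0 ∧
  A 2 0 ∈ fracIdeal F n ∧ A 2 1 ∈ fracIdeal F n ∧ A 2 2 ∈ fracIdeal F 0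

/-- The group `Kₙ` of `g ∈ GL₃(F)` such that `g` and `g⁻¹` both have the above shape. -/
def K (F : Type*) [NontriviallyNormedField F] [IsUltrametricDist F] (n : ℕ) : Set (GL (Fin 3) F) :=
  {g | KShape n (g : Matrix (Fin 3) (Fin 3) F) ∧
    KShape n ((g⁻¹ : GL (Fin 3) F) : Matrix (Fin 3) (Fin 3) F)}

/-- `Kₙ ∩ SL₃(F)`. -/
def KSL (F : Type*) [NontriviallyNormedField F] [IsUltrametricDist F] (n : ℕ) :
    Set (Matrix.SpecialLinearGroup (Fin 3) F) :=
  {g | (g : GL (Fin 3) F) ∈ K F n}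

open Classical in
/-- The new form `f ∈ Ind(μ₁ ⊗ μ₂ ⊗ μ₃)` (normalized induction from the upper triangular Borel
subgroup `B₃`): it is supported on `B₃ K_c`, and
`f(diag(a₁, a₂, a₃) u k) = μ₁(a₁) μ₂(a₂) μ₃(a₃) |a₁ / a₃|` for `u` unipotent, `k ∈ K_c`.
The value does not depend on the decomposition when `μ₁`, `μ₃` are unramified and `μ₂` is trivial
on `1 + 𝔭ᶜ`. -/
noncomputable def newForm (μ₁ μ₂ μ₃ : Fˣ →ₜ* ℂˣ) (c : ℕ) (g : GL (Fin 3) F) : ℂ :=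
  if h : ∃ a : Fin 3 → Fˣ, ∃ x y z : F, ∃ k ∈ K F c,
      (g : Matrix (Fin 3) (Fin 3) F) =
        Matrix.diagonal (fun i => (a i : F)) *
          (unip x y z : Matrix (Fin 3) (Fin 3) F) * (k : Matrix (Fin 3) (Fin 3) F) then
    (μ₁ (h.choose 0) : ℂ) * (μ₂ (h.choose 1) : ℂ) * (μ₃ (h.choose 2) : ℂ) *
      ((‖(h.choose 0 : F)‖ / ‖(h.choose 2 : F)‖ : ℝ) : ℂ)
  else 0

variable [MeasurableSpace F]

/-- The integral of `f(w u g) ψ_U(u)⁻¹` over the compact open subgroup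
`U^k = {𝔲(x, y, z) : x, y ∈ 𝔭⁻ᵏ, z ∈ 𝔭⁻²ᵏ}` of the unipotent group, where
`ψ_U(𝔲(x, y, z)) = ψ(x - y)`. This generic character is trivial on `N₂`. -/
noncomputable def truncatedJacquet (dx : Measure F) (ψ : AddChar F Circle)
    (f : GL (Fin 3) F → ℂ) (g : GL (Fin 3) F) (k : ℕ) : ℂ :=
  ∫ p in {p : F × F × F | p.1 ∈ fracIdeal F (-k) ∧ p.2.1 ∈ fracIdeal F (-k) ∧
      p.2.2 ∈ fracIdeal F (-(2 * k))},
    f (longWeyl * (unip p.1 p.2.1 p.2.2 : GL (Fin 3) F) * g) *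
      (((ψ (p.1 - p.2.1))⁻¹ : Circle) : ℂ) ∂(dx.prod (dx.prod dx))

/-- The Whittaker function `W_f(g) = ∫^{st} f(w u g) ψ_U(u)⁻¹ du`: the stable integral is the limit
of the integrals over the exhausting sequence `U^k`. -/
noncomputable def whittaker (dx : Measure F) (ψ : AddChar F Circle)
    (f : GL (Fin 3) F → ℂ) (g : GL (Fin 3) F) : ℂ :=
  limUnder atTop (truncatedJacquet dx ψ f g)

end Whittaker

/-! ### The group `G₂` as a group of `8 × 8` matrices -/

section G2

variable {F : Type*} [Field F]

/-- `x_α(r) = exp(r X_α)`, `X_α = E₁₂ + E₃₄ + E₃₅ - E₄₆ - E₅₆ - E₇₈` (`α` is the short root). -/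
def xAlpha (r : F) : Matrix (Fin 8) (Fin 8) F :=
  !![1, r, 0, 0, 0, 0, 0, 0;
     0, 1, 0, 0, 0, 0, 0, 0;
     0, 0, 1, r, r, -r ^ 2, 0, 0;
     0, 0, 0, 1, 0, -r, 0, 0;
     0, 0, 0, 0, 1, -r, 0, 0;
     0, 0, 0, 0, 0, 1, 0, 0;
     0, 0, 0, 0, 0, 0, 1, -r;
     0, 0, 0, 0, 0, 0, 0, 1]

/-- `x_β(r) = exp(r X_β)`, `X_β = E₂₃ - E₆₇` (`β` is the long root). -/
def xBeta (r : F) : Matrix (Fin 8) (Fin 8) F :=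
  !![1, 0, 0, 0, 0, 0, 0, 0;
     0, 1, r, 0, 0, 0, 0, 0;
     0, 0, 1, 0, 0, 0, 0, 0;
     0, 0, 0, 1, 0, 0, 0, 0;
     0, 0, 0, 0, 1, 0, 0, 0;
     0, 0, 0, 0, 0, 1, -r, 0;
     0, 0, 0, 0, 0, 0, 1, 0;
     0, 0, 0, 0, 0, 0, 0, 1]

/-- `x_{-α}(r)`; the root vector `X_{-α}` is the transpose of `X_α`. -/
def xNegAlpha (r : F) : Matrix (Fin 8) (Fin 8) F := (xAlpha r).transpose

/-- `x_{-β}(r)`; the root vector `X_{-β}` is the transpose of `X_β`. -/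
def xNegBeta (r : F) : Matrix (Fin 8) (Fin 8) F := (xBeta r).transpose

/-- The group `G₂(F)`. As `G₂` is split and simply connected, `G₂(F)` is generated by the root
subgroups of `±α`, `±β`. (The generating set is stable under inversion, so the monoid it generates
is a group.) -/
def G₂ (F : Type*) [Field F] : Submonoid (Matrix (Fin 8) (Fin 8) F) :=
  Submonoid.closure (Set.range xAlpha ∪ Set.range xNegAlpha ∪ Set.range xBeta ∪ Set.range xNegBeta)

/-- `w_β(t) = x_β(t) x_{-β}(-t⁻¹) x_β(t)`; its inverse is `w_β(-t)`. -/
def wBetaAt (t : F) : Matrix (Fin 8) (Fin 8) F := xBeta t * xNegBeta (-t⁻¹) * xBeta t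

/-- `w_β = w_β(1)`. -/
def wBeta : Matrix (Fin 8) (Fin 8) F := wBetaAt 1

/-- `h_β(t) = w_β(t) w_β⁻¹`. -/
def hBeta (t : F) : Matrix (Fin 8) (Fin 8) F := wBetaAt t * wBetaAt (-1)

/-- The parabolic subgroup `P = M U^α` of `G₂(F)`, the standard parabolic subgroup whose Levi
subgroup `M` contains the root subgroups of `±α`: it consists of the elements of `G₂(F)` that
preserve the plane spanned by the first two basis vectors. -/
def P (F : Type*) [Field F] : Set (Matrix (Fin 8) (Fin 8) F) :=
  {p | p ∈ G₂ F ∧ ∀ i j : Fin 8, 2 ≤ i → j < 2 → p i j = 0}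

/-- `det(m)` for `p = m u ∈ P`, `m ∈ M`, `u ∈ U^α`, with respect to the isomorphism `M ≅ GL₂(F)`
sending `x_α(r)` to the upper triangular unipotent matrix with entry `r` and `h(a, b)` to
`diag(ab, a)`: this isomorphism is `p ↦` the upper left `2 × 2` block, which is trivial
on `U^α`. -/
def detP (p : Matrix (Fin 8) (Fin 8) F) : F := p 0 0 * p 1 1 - p 0 1 * p 1 0

/-- The embedding `i : SL₃ → G₂` with image the stabilizer of `e₄ + e₅`: `g` acts by `g` on the span
of `e₂, e₃, e₈`, by its inverse transpose on the span of `e₇, e₆, e₁`, and fixes `e₄, e₅`. -/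
noncomputable def iEmb (A : Matrix (Fin 3) (Fin 3) F) : Matrix (Fin 8) (Fin 8) F :=
  let B := (A⁻¹).transpose
  !![B 2 2, 0, 0, 0, 0, B 2 1, B 2 0, 0;
     0, A 0 0, A 0 1, 0, 0, 0, 0, A 0 2;
     0, A 1 0, A 1 1, 0, 0, 0, 0, A 1 2;
     0, 0, 0, 1, 0, 0, 0, 0;
     0, 0, 0, 0, 1, 0, 0, 0;
     B 1 2, 0, 0, 0, 0, B 1 1, B 1 0, 0;
     B 0 2, 0, 0, 0, 0, B 0 1, B 0 0, 0;
     0, A 2 0, A 2 1, 0, 0, 0, 0, A 2 2]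

/-- The identification of `SL₃(F)` with the stabilizer `H_ρ` in `G₂(F)` of the vector
`v_ρ = (0, 0, 1, 0, 0, ρ, 0, 0)`, where `ρ = τ²`: conjugation by `diag(1, 1, -1)`, followed by `i`,
followed by conjugation by the inverse of `γ = h_β(1/(2τ)) x_α(1/(2τ)) x_{-α}(-τ)`. -/
noncomputable def jEmb (τ : F) (g : Matrix.SpecialLinearGroup (Fin 3) F) :
    Matrix (Fin 8) (Fin 8) F :=
  (xNegAlpha τ * xAlpha (-(2 * τ)⁻¹) * (wBeta * wBetaAt (-(2 * τ)⁻¹))) *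
    iEmb (Matrix.diagonal ![1, 1, -1] * (g : Matrix (Fin 3) (Fin 3) F) *
      Matrix.diagonal ![1, 1, -1]) *
    (hBeta (2 * τ)⁻¹ * xAlpha (2 * τ)⁻¹ * xNegAlpha (-τ))

end G2

/-! ### Sections and the local zeta integral -/

section Zeta

variable {F : Type*} [NontriviallyNormedField F] [IsUltrametricDist F]

open Classical in
/-- `χ(a) |a|^{3s}` for `a ∈ Fˣ`, extended by `0`. The character `χ_s = χ(det) δ_P^s` of `P` is
`p ↦ χ(det p) |det p|^{3s}`, and the character `χ'_s` of `N₂ T₀` is `n h(a, 1) ↦ χ(a) |a|^{3s}`. -/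
noncomputable def twist (χ : Fˣ →ₜ* ℂˣ) (s : ℂ) (a : F) : ℂ :=
  if h : a = 0 then 0 else (χ (Units.mk0 a h) : ℂ) * ((‖a‖ : ℝ) : ℂ) ^ (3 * s)

open Classical in
/-- The section `f_s^c` on `SL₃(F)`: for `g = n h(a, 1) n(x) h(1, b) k` with `n ∈ N₂`,
`n(x) = 𝔲(x, 0, 0)` and `k ∈ K_c ∩ SL₃(F)`, its value is
`χ'_s(n h(a, 1)) · 1_{1 + 𝔭ᶜ}(b) · 1_𝔬(x)`, and it vanishes at the `g` that are not of this form,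
i.e. off `B₃ K_c ∩ SL₃(F)`. The value does not depend on the decomposition when `χ` is
unramified and `c ≥ 1`. -/
noncomputable def sectionSL (χ : Fˣ →ₜ* ℂˣ) (c : ℕ) (s : ℂ)
    (g : Matrix.SpecialLinearGroup (Fin 3) F) : ℂ :=
  if h : ∃ q : Fˣ × Fˣ × F, ∃ n ∈ N₂ F, ∃ k ∈ KSL F c,
      g = n * torusSL q.1 1 * unip q.2.2 0 0 * torusSL 1 q.2.1 * k then
    twist χ s (h.choose.1 : F) *
      Set.indicator {b : F | b - 1 ∈ fracIdeal F c} (fun _ => (1 : ℂ)) (h.choose.2.1 : F) *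
      Set.indicator (fracIdeal F 0) (fun _ => (1 : ℂ)) h.choose.2.2
  else 0

open Classical in
/-- The function `f̃ ∈ I(s, χ)` on `G₂(F)` attached to a function `f` on `H_ρ = SL₃(F)` that
transforms on the left under `N₂ T₀` by `χ'_s`: it is supported on `P w_β H_ρ` and
`f̃(p w_β h) = χ_s(p) f(h)`. -/
noncomputable def extendToG₂ (τ : F) (χ : Fˣ →ₜ* ℂˣ) (s : ℂ)
    (f : Matrix.SpecialLinearGroup (Fin 3) F → ℂ) (x : Matrix (Fin 8) (Fin 8) F) : ℂ :=
  if h : ∃ q : Matrix (Fin 8) (Fin 8) F × Matrix.SpecialLinearGroup (Fin 3) F,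
      q.1 ∈ P F ∧ x = q.1 * wBeta * jEmb τ q.2 then
    twist χ s (detP h.choose.1) * f h.choose.2
  else 0

/-- The quotient `N₂ \ SL₃(F)`, with the quotient `σ`-algebra. -/
abbrev QuotN₂ (F : Type*) [Field F] : Type _ := Quotient (QuotientGroup.rightRel (N₂ F))

variable [MeasurableSpace F] [MeasurableSpace (Matrix.SpecialLinearGroup (Fin 3) F)]

/-- `ν` is the quotient on `N₂ \ SL₃(F)` of the Haar measure `dg` of `SL₃(F)` by the Haar measure
`dn = dr dt` of `N₂`:
`∫_{SL₃} Φ(g) dg = ∫_{N₂ \ SL₃} ∫_{N₂} Φ(n g) dn dν(g)` for every measurable `Φ ≥ 0`. -/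
def IsQuotientMeasure (dx : Measure F) (dg : Measure (Matrix.SpecialLinearGroup (Fin 3) F))
    (ν : Measure (QuotN₂ F)) : Prop :=
  ∀ Φ : Matrix.SpecialLinearGroup (Fin 3) F → ℝ≥0∞, Measurable Φ →
    ∫⁻ g, Φ g ∂dg = ∫⁻ x, ∫⁻ p : F × F, Φ (unip p.1 p.1 p.2 * x.out) ∂(dx.prod dx) ∂ν

/-- The integrand `W(g) φ(w_β g)` of the local zeta integral, which is left `N₂`-invariant, as a
function on `N₂ \ H_ρ`, `H_ρ = SL₃(F)`. -/
noncomputable def zetaIntegrand (τ : F) (W : GL (Fin 3) F → ℂ)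
    (φ : Matrix (Fin 8) (Fin 8) F → ℂ) (x : QuotN₂ F) : ℂ :=
  W (x.out : GL (Fin 3) F) * φ (wBeta * jEmb τ x.out)

/-- The local zeta integral `Z(W, φ) = ∫_{N₂ \ H_ρ} W(g) φ(w_β g) dg`. -/
noncomputable def zeta (ν : Measure (QuotN₂ F)) (τ : F) (W : GL (Fin 3) F → ℂ)
    (φ : Matrix (Fin 8) (Fin 8) F → ℂ) : ℂ :=
  ∫ x, zetaIntegrand τ W φ x ∂ν

end Zeta

end GinzburgZeta

set_option linter.unusedSectionVars false

namespace GinzburgZeta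

section FieldBasics

variable {F : Type*} [NontriviallyNormedField F] [IsUltrametricDist F] {ϖ : Fˣ}

theorem one_lt_resCard (hϖ : IsNormalizedUniformizer ϖ) : (1 : ℝ) < resCard F := by
  obtain ⟨h1, h2⟩ := hϖ
  have h3 : ‖(ϖ : F)‖ < 1 := (h1 _).2 ⟨1, by simp, by simp⟩
  have h4 : 0 < ‖(ϖ : F)‖ := norm_pos_iff.2 ϖ.ne_zero
  rw [h2] at h3 h4
  have h5 := inv_pos.1 h4
  exact (inv_lt_one₀ h5).1 h3

theorem resCard_pos (hϖ : IsNormalizedUniformizer ϖ) : (0 : ℝ) < resCard F :=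
  zero_lt_one.trans (one_lt_resCard hϖ)

theorem norm_uniformizer_zpow (hϖ : IsNormalizedUniformizer ϖ) (n : ℤ) :
    ‖((ϖ ^ n : Fˣ) : F)‖ = (resCard F : ℝ) ^ (-n) := by
  rw [Units.val_zpow_eq_zpow_val, norm_zpow, hϖ.2, inv_zpow, zpow_neg]

theorem exists_norm_eq_zpow (hϖ : IsNormalizedUniformizer ϖ) {x : F} (hx : x ≠ 0) :
    ∃ n : ℤ, ‖x‖ = (resCard F : ℝ) ^ n := by
  have hq := one_lt_resCard hϖ
  have hq0 := resCard_pos hϖ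
  obtain ⟨n, hn1, hn2⟩ := exists_mem_Ico_zpow (norm_pos_iff.2 hx) hq
  refine ⟨n, le_antisymm ?_ hn1⟩
  by_contra! hlt
  set y : F := ((ϖ ^ (n + 1) : Fˣ) : F) * x with hy
  have hyn : ‖y‖ = (resCard F : ℝ) ^ (-(n + 1)) * ‖x‖ := by
    rw [hy, norm_mul, norm_uniformizer_zpow hϖ]
  have hp : (0 : ℝ) < (resCard F : ℝ) ^ (n + 1) := zpow_pos hq0 _
  have hy1 : ‖y‖ < 1 := by
    rw [hyn, zpow_neg, inv_mul_lt_iff₀ hp, mul_one]; exact hn2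
  obtain ⟨z, hz, hyz⟩ := (hϖ.1 y).1 hy1
  have : ‖y‖ ≤ (resCard F : ℝ)⁻¹ := by
    rw [hyz, norm_mul, hϖ.2]
    exact mul_le_of_le_one_right (inv_nonneg.2 hq0.le) hz
  rw [hyn, zpow_neg, inv_mul_le_iff₀ hp, zpow_add_one₀ hq0.ne', mul_assoc,
    mul_inv_cancel₀ hq0.ne', mul_one] at this
  exact absurd this (not_le.2 hlt)

theorem exists_unit_mul_zpow (hϖ : IsNormalizedUniformizer ϖ) (a : Fˣ) :
    ∃ n : ℤ, ∃ u : Fˣ, ‖(u : F)‖ = 1 ∧ a = u * ϖ ^ n := by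
  obtain ⟨n, hn⟩ := exists_norm_eq_zpow hϖ a.ne_zero
  refine ⟨-n, a * (ϖ ^ (-n))⁻¹, ?_, by simp⟩
  rw [← zpow_neg, neg_neg, Units.val_mul, norm_mul, norm_uniformizer_zpow hϖ, hn, zpow_neg]
  exact mul_inv_cancel₀ (zpow_pos (resCard_pos hϖ) _).ne'

theorem mem_fracIdeal {n : ℤ} {x : F} : x ∈ fracIdeal F n ↔ ‖x‖ ≤ (resCard F : ℝ) ^ (-n) := Iff.rfl

theorem mem_fracIdeal_zero {x : F} : x ∈ fracIdeal F 0 ↔ ‖x‖ ≤ 1 := by simp [mem_fracIdeal]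

theorem norm_add_le_of_le {x y : F} {r : ℝ} (hx : ‖x‖ ≤ r) (hy : ‖y‖ ≤ r) : ‖x + y‖ ≤ r :=
  (IsUltrametricDist.norm_add_le_max x y).trans (max_le hx hy)

theorem norm_sub_le_of_le {x y : F} {r : ℝ} (hx : ‖x‖ ≤ r) (hy : ‖y‖ ≤ r) : ‖x - y‖ ≤ r := by
  rw [sub_eq_add_neg]; exact norm_add_le_of_le hx (by rwa [norm_neg])

theorem norm_add_eq_left {x y : F} (h : ‖y‖ < ‖x‖) : ‖x + y‖ = ‖x‖ := by
  rw [IsUltrametricDist.norm_add_eq_max_of_norm_ne_norm h.ne', max_eq_left h.le]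

theorem norm_sub_eq_left {x y : F} (h : ‖y‖ < ‖x‖) : ‖x - y‖ = ‖x‖ := by
  rw [sub_eq_add_neg]; exact norm_add_eq_left (by rwa [norm_neg])

theorem mul_mem_fracIdeal (hϖ : IsNormalizedUniformizer ϖ) {m n : ℤ} {x y : F}
    (hx : x ∈ fracIdeal F m) (hy : y ∈ fracIdeal F n) : x * y ∈ fracIdeal F (m + n) := by
  rw [mem_fracIdeal, norm_mul, neg_add, zpow_add₀ (resCard_pos hϖ).ne']
  exact mul_le_mul hx hy (norm_nonneg _) (zpow_pos (resCard_pos hϖ) _).le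

theorem fracIdeal_anti (hϖ : IsNormalizedUniformizer ϖ) {m n : ℤ} (h : m ≤ n) :
    fracIdeal F n ⊆ fracIdeal F m := fun _ hx =>
  le_trans hx (zpow_le_zpow_right₀ (one_lt_resCard hϖ).le (neg_le_neg h))

theorem fracIdeal_eq_closedBall (n : ℤ) :
    fracIdeal F n = Metric.closedBall (0 : F) ((resCard F : ℝ) ^ (-n)) := by
  ext x; simp [mem_fracIdeal]

theorem isOpen_fracIdeal (hϖ : IsNormalizedUniformizer ϖ) (n : ℤ) : IsOpen (fracIdeal F n) := by
  rw [fracIdeal_eq_closedBall]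
  exact IsUltrametricDist.isOpen_closedBall _ (zpow_pos (resCard_pos hϖ) _).ne'

theorem isClosed_fracIdeal (n : ℤ) : IsClosed (fracIdeal F n) := by
  rw [fracIdeal_eq_closedBall]; exact Metric.isClosed_closedBall

theorem isCompact_fracIdeal [LocallyCompactSpace F] (n : ℤ) : IsCompact (fracIdeal F n) := by
  have : ProperSpace F := ProperSpace.of_locallyCompactSpace F
  rw [fracIdeal_eq_closedBall]; exact isCompact_closedBall _ _

theorem secondCountableTopology_of_locallyCompactSpace (F : Type*) [NontriviallyNormedField F]
    [LocallyCompactSpace F] : SecondCountableTopology F := by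
  have : ProperSpace F := ProperSpace.of_locallyCompactSpace F
  infer_instance

/-- An unramified quasi-character depends only on the norm. -/
theorem HasConductor.eq_one_of_norm_eq_one {μ : Fˣ →ₜ* ℂˣ} (hμ : HasConductor μ 0) {a : Fˣ}
    (ha : ‖(a : F)‖ = 1) : μ a = 1 := hμ.1 a (by simpa [unitFiltration] using ha)

theorem HasConductor.eq_of_norm_eq {μ : Fˣ →ₜ* ℂˣ} (hμ : HasConductor μ 0) {a b : Fˣ}
    (h : ‖(a : F)‖ = ‖(b : F)‖) : μ a = μ b := by
  have h1 : μ (a * b⁻¹) = 1 := hμ.eq_one_of_norm_eq_one (by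
    rw [Units.val_mul, norm_mul, Units.val_inv_eq_inv_val, norm_inv, h]
    exact mul_inv_cancel₀ (norm_pos_iff.2 b.ne_zero).ne')
  rw [map_mul, map_inv] at h1
  exact mul_inv_eq_one.1 h1

theorem HasConductor.eq_zpow_of_norm_eq (hϖ : IsNormalizedUniformizer ϖ) {μ : Fˣ →ₜ* ℂˣ}
    (hμ : HasConductor μ 0) {a : Fˣ} {n : ℤ} (h : ‖(a : F)‖ = (resCard F : ℝ) ^ (-n)) :
    μ a = μ ϖ ^ n := by
  rw [hμ.eq_of_norm_eq (h.trans (norm_uniformizer_zpow hϖ n).symm), map_zpow]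

/-- The sphere of radius `qⁿ`. -/
def sphereZ (F : Type*) [NontriviallyNormedField F] [IsUltrametricDist F] (n : ℤ) : Set F :=
  {x | ‖x‖ = (resCard F : ℝ) ^ n}

theorem lt_zpow_iff (hϖ : IsNormalizedUniformizer ϖ) {x : F} {n : ℤ} :
    ‖x‖ < (resCard F : ℝ) ^ n ↔ ‖x‖ ≤ (resCard F : ℝ) ^ (n - 1) := by
  have hq := one_lt_resCard hϖ
  rcases eq_or_ne x 0 with rfl | hx
  · simp [zpow_pos (resCard_pos hϖ), (zpow_pos (resCard_pos hϖ) _).le]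
  · obtain ⟨k, hk⟩ := exists_norm_eq_zpow hϖ hx
    rw [hk, zpow_lt_zpow_iff_right₀ hq, zpow_le_zpow_iff_right₀ hq]
    omega

theorem sphereZ_eq_diff (hϖ : IsNormalizedUniformizer ϖ) (n : ℤ) :
    sphereZ F n = fracIdeal F (-n) \ fracIdeal F (-n + 1) := by
  ext x
  simp only [sphereZ, Set.mem_ofPred_eq, Set.mem_sdiff, mem_fracIdeal, neg_neg]
  rw [show -(-n + 1) = n - 1 by ring, ← lt_zpow_iff hϖ, not_lt]
  exact ⟨fun h => ⟨h.le, h.ge⟩, fun h => le_antisymm h.1 h.2⟩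

theorem fracIdeal_eq_union_sphereZ (hϖ : IsNormalizedUniformizer ϖ) (n : ℤ) :
    fracIdeal F (-n) = fracIdeal F (-n + 1) ∪ sphereZ F n := by
  rw [sphereZ_eq_diff hϖ, Set.union_sdiff_cancel (fracIdeal_anti hϖ (by omega))]

end FieldBasics

section HaarMeasure

variable {F : Type*} [NontriviallyNormedField F] [IsUltrametricDist F] [LocallyCompactSpace F]
  [MeasurableSpace F] [BorelSpace F] {ϖ : Fˣ} (dx : Measure F) [dx.IsAddHaarMeasure]

theorem measurableSet_fracIdeal (n : ℤ) : MeasurableSet (fracIdeal F n) :=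
  (isClosed_fracIdeal n).measurableSet

theorem measurableSet_sphereZ (n : ℤ) : MeasurableSet (sphereZ F n) :=
  (isClosed_singleton.preimage continuous_norm).measurableSet

theorem measure_fracIdeal_one (hϖ : IsNormalizedUniformizer ϖ) :
    dx (fracIdeal F 0) = resCard F * dx (fracIdeal F 1) := by
  set O := (NormedField.valuation (K := F)).valuationSubring with hO
  have hmem : ∀ x : F, x ∈ O ↔ ‖x‖ ≤ 1 := fun x => by
    rw [hO, Valuation.mem_valuationSubring_iff, NormedField.valuation_apply,
      ← NNReal.coe_le_coe, coe_nnnorm, NNReal.coe_one]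
  have hq0 : Nat.card (IsLocalRing.ResidueField O) ≠ 0 := by
    have h := resCard_pos hϖ
    have : (0 : ℝ) < (Nat.card (IsLocalRing.ResidueField O) : ℝ) := h
    exact_mod_cast this.ne'
  have : Finite (IsLocalRing.ResidueField O) := Nat.finite_of_card_ne_zero hq0
  have hres : ∀ x y : O, IsLocalRing.residue O x = IsLocalRing.residue O y ↔
      (x : F) - y ∈ fracIdeal F 1 := by
    intro x y
    rw [← sub_eq_zero, ← map_sub, IsLocalRing.residue_eq_zero_iff, IsLocalRing.mem_maximalIdeal,
      mem_nonunits_iff]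
    have h1 : ((x - y : O) : F) = (x : F) - y := rfl
    have h2 : ‖((x - y : O) : F)‖ ≤ 1 := (hmem _).1 (x - y).2
    rw [← h1, mem_fracIdeal, show (-1 : ℤ) = 0 - 1 by norm_num, ← lt_zpow_iff hϖ, zpow_zero]
    constructor
    · intro h
      refine lt_of_le_of_ne h2 fun h3 => h ?_
      have hne : ((x - y : O) : F) ≠ 0 := norm_ne_zero_iff.1 (by rw [h3]; exact one_ne_zero)
      refine IsUnit.of_mul_eq_one ⟨((x - y : O) : F)⁻¹, (hmem _).2 (by rw [norm_inv, h3, inv_one])⟩ ?_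
      exact Subtype.ext (mul_inv_cancel₀ hne)
    · rintro h ⟨u, hu⟩
      have h3 : ((u : O) : F) * ((u⁻¹ : Oˣ) : O) = 1 := by
        exact congrArg (fun z : O => (z : F)) u.mul_inv
      have h4 := congrArg norm h3
      rw [norm_mul, hu, norm_one] at h4
      have h5 : ‖(((u⁻¹ : Oˣ) : O) : F)‖ ≤ 1 := (hmem _).1 ((u⁻¹ : Oˣ) : O).2
      nlinarith [norm_nonneg (((u⁻¹ : Oˣ) : O) : F), norm_nonneg ((x - y : O) : F)]
  choose r hr using IsLocalRing.residue_surjective (R := O)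
  have hunion : fracIdeal F 0 =
      ⋃ i : IsLocalRing.ResidueField O, (fun x : F => x + -(r i : F)) ⁻¹' fracIdeal F 1 := by
    ext x
    simp only [Set.mem_iUnion, Set.mem_preimage, ← sub_eq_add_neg]
    constructor
    · intro hx
      have hx' := (hmem x).2 (mem_fracIdeal_zero.1 hx)
      refine ⟨IsLocalRing.residue O ⟨x, hx'⟩, ?_⟩
      exact (hres ⟨x, hx'⟩ _).1 (hr _).symm
    · rintro ⟨i, hi⟩
      rw [mem_fracIdeal_zero, ← sub_add_cancel x (r i : F)]
      exact norm_add_le_of_le (mem_fracIdeal_zero.1 (fracIdeal_anti hϖ zero_le_one hi))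
        ((hmem _).1 (r i).2)
  have hm : ∀ i, MeasurableSet ((fun x : F => x + -(r i : F)) ⁻¹' fracIdeal F 1) := fun i =>
    (measurable_add_const _) (measurableSet_fracIdeal 1)
  rw [hunion, measure_iUnion _ hm]
  · simp only [measure_preimage_add_right]
    rw [ENNReal.tsum_const, resCard, ENat.card_eq_coe_natCard]
    rfl
  · intro i j hij
    refine Set.disjoint_left.2 fun x hi hj => hij ?_
    simp only [Set.mem_preimage, ← sub_eq_add_neg] at hi hj
    rw [← hr i, ← hr j, hres]
    have : (r i : F) - r j = (x - r j) - (x - r i) := by ring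
    rw [this]
    exact norm_sub_le_of_le hj hi

section Scaling

variable [SecondCountableTopology F]

theorem exists_map_mul_left_eq_smul {a : F} (ha : a ≠ 0) :
    ∃ κ : ℝ≥0, dx.map (fun x => a * x) = κ • dx := by
  have h1 : (dx.map (DistribMulAction.toAddEquiv F (Units.mk0 a ha))).IsAddHaarMeasure :=
    AddEquiv.isAddHaarMeasure_map dx (DistribMulAction.toAddEquiv F (Units.mk0 a ha))
      (continuous_const_smul (Units.mk0 a ha)) (continuous_const_smul (Units.mk0 a ha)⁻¹)
  exact ⟨_, Measure.isAddLeftInvariant_eq_smul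
    (dx.map (DistribMulAction.toAddEquiv F (Units.mk0 a ha))) dx⟩

theorem preimage_mul_left_fracIdeal (hϖ : IsNormalizedUniformizer ϖ) {a : F} {k : ℤ}
    (ha : ‖a‖ = (resCard F : ℝ) ^ k) (n : ℤ) :
    (fun x => a * x) ⁻¹' fracIdeal F n = fracIdeal F (n + k) := by
  ext x
  have hq := resCard_pos hϖ
  rw [Set.mem_preimage, mem_fracIdeal, mem_fracIdeal, norm_mul, ha, neg_add, zpow_add₀ hq.ne',
    zpow_neg _ k, ← div_eq_mul_inv, le_div_iff₀ (zpow_pos hq k), mul_comm]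

variable (hdx : dx (fracIdeal F 0) = 1)

include hdx

theorem measure_fracIdeal (hϖ : IsNormalizedUniformizer ϖ) (n : ℤ) :
    dx (fracIdeal F n) = ENNReal.ofReal ((resCard F : ℝ) ^ (-n)) := by
  have hq := resCard_pos hϖ
  obtain ⟨κ, hκ⟩ := exists_map_mul_left_eq_smul dx ϖ.ne_zero
  have hϖn : ‖(ϖ : F)‖ = (resCard F : ℝ) ^ (-1 : ℤ) := by rw [hϖ.2, zpow_neg_one]
  have hstep : ∀ n : ℤ, dx (fracIdeal F (n - 1)) = κ * dx (fracIdeal F n) := fun n => by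
    have h := congrArg (fun μ : Measure F => μ (fracIdeal F n)) hκ
    simp only [Measure.smul_apply] at h
    rw [Measure.map_apply (measurable_const_mul _) (measurableSet_fracIdeal n),
      preimage_mul_left_fracIdeal hϖ hϖn] at h
    simpa [sub_eq_add_neg] using h
  have h1 := measure_fracIdeal_one dx hϖ
  rw [hdx] at h1
  have hκq : (κ : ℝ≥0∞) = resCard F := by
    have h2 := hstep 1
    rw [sub_self, hdx] at h2
    have h3 : dx (fracIdeal F 1) ≠ 0 := fun h => by simp [h] at h1
    have h4 : dx (fracIdeal F 1) ≠ ⊤ := (isCompact_fracIdeal 1).measure_lt_top.ne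
    exact (ENNReal.mul_left_inj h3 h4).1 (h2.symm.trans h1)
  have hκ' : (κ : ℝ≥0∞) = ENNReal.ofReal (resCard F) := by simp [hκq]
  have hstep' : ∀ n : ℤ, dx (fracIdeal F n) = ENNReal.ofReal ((resCard F : ℝ) ^ (-n)) ↔
      dx (fracIdeal F (n - 1)) = ENNReal.ofReal ((resCard F : ℝ) ^ (-(n - 1))) := fun n => by
    have h5 : (resCard F : ℝ) ^ (-(n - 1)) = resCard F * (resCard F : ℝ) ^ (-n) := by
      rw [show -(n - 1) = 1 + -n by ring, zpow_add₀ hq.ne', zpow_one]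
    rw [hstep, h5, ENNReal.ofReal_mul hq.le, hκ', ENNReal.mul_right_inj]
    · simpa using hq.ne'
    · exact ENNReal.ofReal_ne_top
  induction n using Int.induction_on with
  | zero => simp [hdx]
  | succ i ih => rw [hstep']; simpa using ih
  | pred i ih => exact (hstep' _).1 ih

theorem measureReal_fracIdeal (hϖ : IsNormalizedUniformizer ϖ) (n : ℤ) :
    dx.real (fracIdeal F n) = (resCard F : ℝ) ^ (-n) := by
  rw [Measure.real, measure_fracIdeal dx hdx hϖ,
    ENNReal.toReal_ofReal (zpow_pos (resCard_pos hϖ) _).le]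

theorem map_mul_left_eq (hϖ : IsNormalizedUniformizer ϖ) {a : F} (ha : a ≠ 0) :
    dx.map (fun x => a * x) = ENNReal.ofReal (‖a‖⁻¹) • dx := by
  obtain ⟨κ, hκ⟩ := exists_map_mul_left_eq_smul dx ha
  obtain ⟨k, hk⟩ := exists_norm_eq_zpow hϖ ha
  have h := congrArg (fun μ : Measure F => μ (fracIdeal F 0)) hκ
  simp only [Measure.smul_apply] at h
  rw [Measure.map_apply (measurable_const_mul _) (measurableSet_fracIdeal 0),
    preimage_mul_left_fracIdeal hϖ hk, measure_fracIdeal dx hdx hϖ, hdx, zero_add, zpow_neg,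
    ← hk] at h
  rw [hκ, h]
  ext s _
  simp

theorem integral_comp_mul_left (hϖ : IsNormalizedUniformizer ϖ) {a : F} (ha : a ≠ 0)
    (f : F → ℂ) : ∫ x, f (a * x) ∂dx = ((‖a‖⁻¹ : ℝ) : ℂ) * ∫ x, f x ∂dx := by
  have h := integral_map_equiv (μ := dx) (MeasurableEquiv.mulLeft₀ a ha) f
  have h2 : dx.map (MeasurableEquiv.mulLeft₀ a ha) = ENNReal.ofReal (‖a‖⁻¹) • dx :=
    map_mul_left_eq dx hdx hϖ ha
  rw [h2, integral_smul_measure, ENNReal.toReal_ofReal (inv_nonneg.2 (norm_nonneg _))] at h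
  rw [← Complex.real_smul, h]
  rfl

end Scaling

end HaarMeasure

section AddChar

variable {F : Type*} [NontriviallyNormedField F] [IsUltrametricDist F] [LocallyCompactSpace F]
  [MeasurableSpace F] [BorelSpace F] [SecondCountableTopology F] {ϖ : Fˣ} (dx : Measure F)
  [dx.IsAddHaarMeasure] (hdx : dx (fracIdeal F 0) = 1) {ψ : AddChar F Circle}

theorem continuous_addChar_mul (hψ : IsUnramifiedAddChar ψ) (b : F) :
    Continuous fun x => (ψ (b * x) : ℂ) :=
  continuous_subtype_val.comp (hψ.1.comp (continuous_const_mul b))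

theorem norm_addChar (x : F) : ‖(ψ x : ℂ)‖ = 1 := Circle.norm_coe _

theorem integrableOn_addChar (hψ : IsUnramifiedAddChar ψ) (b : F) {s : Set F}
    (hs : ∃ n, s ⊆ fracIdeal F n) : IntegrableOn (fun x => (ψ (b * x) : ℂ)) s dx := by
  obtain ⟨n, hn⟩ := hs
  exact ((continuous_addChar_mul hψ b).continuousOn.integrableOn_compact
    (isCompact_fracIdeal n)).mono_set hn

include hdx

theorem setIntegral_addChar_fracIdeal (hϖ : IsNormalizedUniformizer ϖ) (hψ : IsUnramifiedAddChar ψ)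
    (b : F) (n : ℤ) : ∫ x in fracIdeal F n, (ψ (b * x) : ℂ) ∂dx =
      if ‖b‖ ≤ (resCard F : ℝ) ^ n then (((resCard F : ℝ) ^ (-n) : ℝ) : ℂ) else 0 := by
  have hq := resCard_pos hϖ
  split_ifs with h
  · have h1 : ∀ x ∈ fracIdeal F n, (ψ (b * x) : ℂ) = 1 := fun x hx => by
      have h2 : b * x ∈ fracIdeal F 0 := by
        have h3 : b ∈ fracIdeal F (-n) := by rwa [mem_fracIdeal, neg_neg]
        simpa using mul_mem_fracIdeal hϖ h3 hx
      rw [hψ.2.1 _ h2]; rfl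
    rw [setIntegral_congr_fun (measurableSet_fracIdeal n) h1]
    simp [measureReal_fracIdeal dx hdx hϖ]
  · obtain ⟨y, hy, hψy⟩ := hψ.2.2
    have hb : b ≠ 0 := by
      rintro rfl
      exact h (by simpa using (zpow_pos hq _).le)
    set x₀ := b⁻¹ * y with hx₀
    have hbx : b * x₀ = y := by rw [hx₀, mul_inv_cancel_left₀ hb]
    have hx₀n : x₀ ∈ fracIdeal F n := by
      have h5 : ‖b⁻¹‖ ≤ (resCard F : ℝ) ^ (-(n + 1)) := by
        rw [norm_inv, zpow_neg]
        refine inv_anti₀ (zpow_pos hq _) ?_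
        by_contra! h6
        rw [lt_zpow_iff hϖ, add_sub_cancel_right] at h6
        exact h h6
      have := mul_mem_fracIdeal hϖ (mem_fracIdeal.2 h5) hy
      simpa using this
    rw [← integral_indicator (measurableSet_fracIdeal n)]
    have h7 : ∫ x, (fracIdeal F n).indicator (fun x => (ψ (b * x) : ℂ)) x ∂dx =
        (ψ y : ℂ) * ∫ x, (fracIdeal F n).indicator (fun x => (ψ (b * x) : ℂ)) x ∂dx := by
      rw [← integral_const_mul, ← integral_add_right_eq_self _ x₀]
      refine integral_congr_ae (Eventually.of_forall fun x => ?_)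
      have h8 : x + x₀ ∈ fracIdeal F n ↔ x ∈ fracIdeal F n :=
        ⟨fun h => by have := norm_sub_le_of_le h hx₀n; rwa [add_sub_cancel_right] at this, fun h => norm_add_le_of_le h hx₀n⟩
      by_cases hx : x ∈ fracIdeal F n
      · simp [Set.indicator, h8, hx, mul_add, hbx, AddChar.map_add_eq_mul, mul_comm]
      · simp [Set.indicator, h8, hx]
    have h9 : (1 - (ψ y : ℂ)) ≠ 0 := by
      rw [sub_ne_zero]
      exact fun h => hψy (Subtype.ext h.symm)
    refine (mul_eq_zero.1 ?_).resolve_left h9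
    rw [sub_mul, one_mul, sub_eq_zero]
    exact h7

theorem setIntegral_addChar_sphereZ (hϖ : IsNormalizedUniformizer ϖ) (hψ : IsUnramifiedAddChar ψ)
    (b : F) (n : ℤ) : ∫ x in sphereZ F n, (ψ (b * x) : ℂ) ∂dx =
      (if ‖b‖ ≤ (resCard F : ℝ) ^ (-n) then (((resCard F : ℝ) ^ n : ℝ) : ℂ) else 0) -
      (if ‖b‖ ≤ (resCard F : ℝ) ^ (-n + 1) then (((resCard F : ℝ) ^ (n - 1) : ℝ) : ℂ) else 0) := by
  rw [eq_sub_iff_add_eq]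
  have h1 := setIntegral_addChar_fracIdeal dx hdx hϖ hψ b (-n)
  have h2 := setIntegral_addChar_fracIdeal dx hdx hϖ hψ b (-n + 1)
  rw [neg_neg] at h1
  rw [show -(-n + 1) = n - 1 by ring] at h2
  rw [← h1, ← h2, fracIdeal_eq_union_sphereZ hϖ n, add_comm, setIntegral_union]
  · rw [sphereZ_eq_diff hϖ]; exact Set.disjoint_sdiff_right
  · exact measurableSet_sphereZ n
  · exact integrableOn_addChar dx hψ b ⟨_, subset_rfl⟩
  · refine integrableOn_addChar dx hψ b ⟨-n, ?_⟩
    rw [sphereZ_eq_diff hϖ]; exact Set.sdiff_subset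

end AddChar

section CongruenceGroup

variable {F : Type*} [NontriviallyNormedField F] [IsUltrametricDist F] {ϖ : Fˣ}

theorem mul_mem_fracIdeal_of_le (hϖ : IsNormalizedUniformizer ϖ) {k m n : ℤ} {x y : F}
    (hx : x ∈ fracIdeal F m) (hy : y ∈ fracIdeal F n) (h : k ≤ m + n) : x * y ∈ fracIdeal F k :=
  fracIdeal_anti hϖ h (mul_mem_fracIdeal hϖ hx hy)

theorem add_mem_fracIdeal {n : ℤ} {x y : F} (hx : x ∈ fracIdeal F n) (hy : y ∈ fracIdeal F n) :
    x + y ∈ fracIdeal F n := norm_add_le_of_le hx hy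

theorem zero_mem_fracIdeal (n : ℤ) : (0 : F) ∈ fracIdeal F n := by
  simp only [mem_fracIdeal, norm_zero]; positivity

theorem one_mem_fracIdeal_zero : (1 : F) ∈ fracIdeal F 0 := by simp [mem_fracIdeal]

theorem neg_mem_fracIdeal {n : ℤ} {x : F} : -x ∈ fracIdeal F n ↔ x ∈ fracIdeal F n := by
  simp [mem_fracIdeal]

theorem sub_mem_fracIdeal {n : ℤ} {x y : F} (hx : x ∈ fracIdeal F n) (hy : y ∈ fracIdeal F n) :
    x - y ∈ fracIdeal F n := norm_sub_le_of_le hx hy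

theorem mem_fracIdeal_zero_of_sub_one_mem (hϖ : IsNormalizedUniformizer ϖ) {n : ℕ} {x : F}
    (hx : x - 1 ∈ fracIdeal F n) : x ∈ fracIdeal F 0 := by
  rw [← sub_add_cancel x 1]
  exact add_mem_fracIdeal (fracIdeal_anti hϖ (by omega) hx) one_mem_fracIdeal_zero

theorem norm_eq_one_of_sub_one_mem (hϖ : IsNormalizedUniformizer ϖ) {n : ℤ} (hn : 1 ≤ n) {x : F}
    (hx : x - 1 ∈ fracIdeal F n) : ‖x‖ = 1 := by
  have h : ‖x - 1‖ < ‖(1 : F)‖ := by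
    rw [norm_one, ← zpow_zero (resCard F : ℝ), lt_zpow_iff hϖ]
    exact fracIdeal_anti hϖ hn hx
  have := norm_add_eq_left h
  rwa [add_sub_cancel, norm_one] at this

theorem KShape.mul (hϖ : IsNormalizedUniformizer ϖ) {n : ℕ} {A B : Matrix (Fin 3) (Fin 3) F}
    (hA : KShape n A) (hB : KShape n B) : KShape n (A * B) := by
  obtain ⟨a00, a01, a02, a10, a11, a12, a20, a21, a22⟩ := hA
  obtain ⟨b00, b01, b02, b10, b11, b12, b20, b21, b22⟩ := hB
  have a11' := mem_fracIdeal_zero_of_sub_one_mem hϖ a11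
  have b11' := mem_fracIdeal_zero_of_sub_one_mem hϖ b11
  have key : ∀ {k m₁ n₁ m₂ n₂ m₃ n₃ : ℤ} {x₁ y₁ x₂ y₂ x₃ y₃ : F},
      x₁ ∈ fracIdeal F m₁ → y₁ ∈ fracIdeal F n₁ → x₂ ∈ fracIdeal F m₂ → y₂ ∈ fracIdeal F n₂ →
      x₃ ∈ fracIdeal F m₃ → y₃ ∈ fracIdeal F n₃ → k ≤ m₁ + n₁ → k ≤ m₂ + n₂ → k ≤ m₃ + n₃ →
      x₁ * y₁ + x₂ * y₂ + x₃ * y₃ ∈ fracIdeal F k := fun h₁ h₁' h₂ h₂' h₃ h₃' l₁ l₂ l₃ =>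
    add_mem_fracIdeal (add_mem_fracIdeal (mul_mem_fracIdeal_of_le hϖ h₁ h₁' l₁)
      (mul_mem_fracIdeal_of_le hϖ h₂ h₂' l₂)) (mul_mem_fracIdeal_of_le hϖ h₃ h₃' l₃)
  simp only [KShape, Matrix.mul_apply, Fin.sum_univ_three]
  refine ⟨key a00 b00 a01 b10 a02 b20 ?_ ?_ ?_, key a00 b01 a01 b11' a02 b21 ?_ ?_ ?_,
    key a00 b02 a01 b12 a02 b22 ?_ ?_ ?_, key a10 b00 a11' b10 a12 b20 ?_ ?_ ?_, ?_,
    key a10 b02 a11' b12 a12 b22 ?_ ?_ ?_, key a20 b00 a21 b10 a22 b20 ?_ ?_ ?_,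
    key a20 b01 a21 b11' a22 b21 ?_ ?_ ?_, key a20 b02 a21 b12 a22 b22 ?_ ?_ ?_⟩
  case refine_13 =>
    have : A 1 0 * B 0 1 + A 1 1 * B 1 1 + A 1 2 * B 2 1 - 1 =
      (A 1 0 * B 0 1 + (A 1 1 - 1) * B 1 1 + A 1 2 * B 2 1) + (B 1 1 - 1) := by ring
    rw [this]
    exact add_mem_fracIdeal (key a10 b01 a11 b11' a12 b21 (by omega) (by omega) (by omega)) b11
  all_goals omega

theorem K_mul_mem (hϖ : IsNormalizedUniformizer ϖ) {n : ℕ} {g h : GL (Fin 3) F} (hg : g ∈ K F n)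
    (hh : h ∈ K F n) : g * h ∈ K F n := by
  refine ⟨?_, ?_⟩
  · rw [Units.val_mul]; exact hg.1.mul hϖ hh.1
  · rw [mul_inv_rev, Units.val_mul]; exact hh.2.mul hϖ hg.2

theorem K_inv_mem {n : ℕ} {g : GL (Fin 3) F} (hg : g ∈ K F n) : g⁻¹ ∈ K F n :=
  ⟨hg.2, by rw [inv_inv]; exact hg.1⟩

theorem K_one_mem {n : ℕ} : (1 : GL (Fin 3) F) ∈ K F n := by
  have : KShape n (1 : Matrix (Fin 3) (Fin 3) F) := by
    simp [KShape, one_mem_fracIdeal_zero, zero_mem_fracIdeal]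
  exact ⟨this, by rw [inv_one]; exact this⟩

theorem KSL_mul_mem (hϖ : IsNormalizedUniformizer ϖ) {n : ℕ}
    {g h : Matrix.SpecialLinearGroup (Fin 3) F} (hg : g ∈ KSL F n)
    (hh : h ∈ KSL F n) : g * h ∈ KSL F n := by
  have := K_mul_mem hϖ hg hh
  rw [← map_mul] at this
  exact this

theorem KSL_inv_mem {n : ℕ} {g : Matrix.SpecialLinearGroup (Fin 3) F} (hg : g ∈ KSL F n) :
    g⁻¹ ∈ KSL F n := by
  have := K_inv_mem hg
  rw [← map_inv] at this
  exact this

theorem KSL_one_mem {n : ℕ} : (1 : Matrix.SpecialLinearGroup (Fin 3) F) ∈ KSL F n := by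
  have := K_one_mem (F := F) (n := n)
  rw [← map_one (Matrix.SpecialLinearGroup.toGL)] at this
  exact this

/-- If `k` has the shape of `K_n`, its last row is primitive in the appropriate sense. -/
theorem K_last_row_primitive (hϖ : IsNormalizedUniformizer ϖ) {n : ℕ} (hn : 1 ≤ n)
    {k : GL (Fin 3) F} (hk : k ∈ K F n) :
    (k : Matrix (Fin 3) (Fin 3) F) 2 0 ∉ fracIdeal F (n + 1) ∨
      (k : Matrix (Fin 3) (Fin 3) F) 2 2 ∉ fracIdeal F 1 := by
  by_contra! h
  obtain ⟨⟨a00, a01, a02, a10, a11, a12, a20, a21, a22⟩,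
    ⟨b00, b01, b02, b10, b11, b12, b20, b21, b22⟩⟩ := hk
  have h1 : (k : Matrix (Fin 3) (Fin 3) F) * (k⁻¹ : GL (Fin 3) F) = 1 := k.mul_inv
  have h2 := congrFun (congrFun h1 2) 2
  rw [Matrix.mul_apply, Fin.sum_univ_three, Matrix.one_apply_eq] at h2
  have h3 : (1 : F) ∈ fracIdeal F 1 := by
    rw [← h2]
    exact add_mem_fracIdeal (add_mem_fracIdeal (mul_mem_fracIdeal_of_le hϖ h.1 b02 (by omega))
      (mul_mem_fracIdeal_of_le hϖ a21 b12 (by omega)))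
      (mul_mem_fracIdeal_of_le hϖ h.2 b22 (by omega))
  have h4 : ‖(1 : F)‖ ≤ (resCard F : ℝ) ^ (0 - 1 : ℤ) := h3
  rw [← lt_zpow_iff hϖ] at h4
  simp at h4

/-- If `k` has the shape of `K_n`, its first column is primitive in the appropriate sense. -/
theorem K_first_col_primitive (hϖ : IsNormalizedUniformizer ϖ) {n : ℕ} (hn : 1 ≤ n)
    {k : GL (Fin 3) F} (hk : k ∈ K F n) :
    (k : Matrix (Fin 3) (Fin 3) F) 2 0 ∉ fracIdeal F (n + 1) ∨
      (k : Matrix (Fin 3) (Fin 3) F) 0 0 ∉ fracIdeal F 1 := by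
  by_contra! h
  obtain ⟨⟨a00, a01, a02, a10, a11, a12, a20, a21, a22⟩,
    ⟨b00, b01, b02, b10, b11, b12, b20, b21, b22⟩⟩ := hk
  have h1 : ((k⁻¹ : GL (Fin 3) F) : Matrix (Fin 3) (Fin 3) F) * k = 1 := k.inv_mul
  have h2 := congrFun (congrFun h1 0) 0
  rw [Matrix.mul_apply, Fin.sum_univ_three, Matrix.one_apply_eq] at h2
  have h3 : (1 : F) ∈ fracIdeal F 1 := by
    rw [← h2]
    exact add_mem_fracIdeal (add_mem_fracIdeal (mul_mem_fracIdeal_of_le hϖ b00 h.2 (by omega))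
      (mul_mem_fracIdeal_of_le hϖ b01 a10 (by omega)))
      (mul_mem_fracIdeal_of_le hϖ b02 h.1 (by omega))
  have h4 : ‖(1 : F)‖ ≤ (resCard F : ℝ) ^ (0 - 1 : ℤ) := h3
  rw [← lt_zpow_iff hϖ] at h4
  simp at h4

end CongruenceGroup

section NewForm

variable {F : Type*} [NontriviallyNormedField F] [IsUltrametricDist F] {ϖ : Fˣ}
  {μ₁ μ₂ μ₃ : Fˣ →ₜ* ℂˣ} {c : ℕ}

/-- Comparison of diagonals in two Iwasawa type decompositions. -/
theorem apply_diag_of_diagonal_mul_unip_mul {a b : Fin 3 → Fˣ} {x y z x' y' z' : F}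
    {A : Matrix (Fin 3) (Fin 3) F}
    (h : Matrix.diagonal (fun i => (a i : F)) * (unip x y z : Matrix (Fin 3) (Fin 3) F) * A =
      Matrix.diagonal (fun i => (b i : F)) * (unip x' y' z' : Matrix (Fin 3) (Fin 3) F)) (i : Fin 3) :
    A i i = ((b i / a i : Fˣ) : F) := by
  have e := fun i j => congrFun (congrFun h i) j
  have h20 := e 2 0
  have h21 := e 2 1
  have h22 := e 2 2
  have h10 := e 1 0
  have h11 := e 1 1
  have h00 := e 0 0
  simp [unip, Matrix.mul_apply, Fin.sum_univ_three, Matrix.diagonal] at h20 h21 h22 h10 h11 h00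
  rw [h20, mul_zero, add_zero] at h10
  have h10' : A 1 0 = 0 := (mul_eq_zero.1 h10).resolve_left (a 1).ne_zero
  rw [h21, mul_zero, add_zero] at h11
  rw [h20, h10', mul_zero, mul_zero, add_zero, add_zero] at h00
  rw [Units.val_div_eq_div_val, eq_div_iff (a i).ne_zero, mul_comm]
  fin_cases i
  · exact h00
  · exact h11
  · exact h22

theorem unip_coe_GL (x y z : F) :
    ((unip x y z : GL (Fin 3) F) : Matrix (Fin 3) (Fin 3) F) = !![1, x, z; 0, 1, y; 0, 0, 1] := rfl

theorem newForm_eq (hϖ : IsNormalizedUniformizer ϖ) (hμ₁ : HasConductor μ₁ 0)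
    (hμ₃ : HasConductor μ₃ 0) (hc : 1 ≤ c) (hμ₂ : HasConductor μ₂ c) {g k : GL (Fin 3) F}
    {a : Fin 3 → Fˣ} {x y z : F} (hk : k ∈ K F c)
    (hg : (g : Matrix (Fin 3) (Fin 3) F) = Matrix.diagonal (fun i => (a i : F)) *
      (unip x y z : Matrix (Fin 3) (Fin 3) F) * (k : Matrix (Fin 3) (Fin 3) F)) :
    newForm μ₁ μ₂ μ₃ c g = (μ₁ (a 0) : ℂ) * (μ₂ (a 1) : ℂ) * (μ₃ (a 2) : ℂ) *
      ((‖(a 0 : F)‖ / ‖(a 2 : F)‖ : ℝ) : ℂ) := by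
  have hex : ∃ a : Fin 3 → Fˣ, ∃ x y z : F, ∃ k ∈ K F c,
      (g : Matrix (Fin 3) (Fin 3) F) = Matrix.diagonal (fun i => (a i : F)) *
        (unip x y z : Matrix (Fin 3) (Fin 3) F) * (k : Matrix (Fin 3) (Fin 3) F) :=
    ⟨a, x, y, z, k, hk, hg⟩
  rw [newForm, dif_pos hex]
  obtain ⟨x', y', z', k', hk', hg'⟩ := hex.choose_spec
  generalize hex.choose = b at *
  have hmul : ∀ {u v : Matrix (Fin 3) (Fin 3) F} {k k' : GL (Fin 3) F},
      u * (k : Matrix (Fin 3) (Fin 3) F) = v * (k' : Matrix (Fin 3) (Fin 3) F) →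
      u * ((k * k'⁻¹ : GL (Fin 3) F) : Matrix (Fin 3) (Fin 3) F) = v := fun {u v k k'} h => by
    rw [Units.val_mul, ← mul_assoc, h, mul_assoc, Units.mul_inv, mul_one]
  have h1 := apply_diag_of_diagonal_mul_unip_mul (hmul (hg.symm.trans hg'))
  have h2 := apply_diag_of_diagonal_mul_unip_mul (hmul (hg'.symm.trans hg))
  have k1 := (K_mul_mem hϖ hk (K_inv_mem hk')).1
  have k2 := (K_mul_mem hϖ hk' (K_inv_mem hk)).1
  obtain ⟨p00, -, -, -, p11, -, -, -, p22⟩ := k1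
  obtain ⟨q00, -, -, -, q11, -, -, -, q22⟩ := k2
  rw [h1, mem_fracIdeal_zero, Units.val_div_eq_div_val, norm_div,
    div_le_one₀ (norm_pos_iff.2 (Units.ne_zero _))] at p00 p22
  rw [h2, mem_fracIdeal_zero, Units.val_div_eq_div_val, norm_div,
    div_le_one₀ (norm_pos_iff.2 (Units.ne_zero _))] at q00 q22
  rw [h1] at p11
  have e0 : ‖(b 0 : F)‖ = ‖(a 0 : F)‖ := le_antisymm p00 q00
  have e2 : ‖(b 2 : F)‖ = ‖(a 2 : F)‖ := le_antisymm p22 q22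
  have e1 : μ₂ (b 1) = μ₂ (a 1) := by
    have : μ₂ (b 1 / a 1) = 1 := hμ₂.1 _ (by
      rw [unitFiltration, if_neg (by omega)]; exact p11)
    rwa [map_div, div_eq_one] at this
  rw [e0, e2, e1, hμ₁.eq_of_norm_eq e0, hμ₃.eq_of_norm_eq e2]

theorem newForm_mul_right (hϖ : IsNormalizedUniformizer ϖ) (hμ₁ : HasConductor μ₁ 0)
    (hμ₃ : HasConductor μ₃ 0) (hc : 1 ≤ c) (hμ₂ : HasConductor μ₂ c) (g : GL (Fin 3) F)
    {k : GL (Fin 3) F} (hk : k ∈ K F c) :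
    newForm μ₁ μ₂ μ₃ c (g * k) = newForm μ₁ μ₂ μ₃ c g := by
  by_cases hex : ∃ a : Fin 3 → Fˣ, ∃ x y z : F, ∃ k ∈ K F c,
      (g : Matrix (Fin 3) (Fin 3) F) = Matrix.diagonal (fun i => (a i : F)) *
        (unip x y z : Matrix (Fin 3) (Fin 3) F) * (k : Matrix (Fin 3) (Fin 3) F)
  · obtain ⟨a, x, y, z, k', hk', hg⟩ := hex
    rw [newForm_eq hϖ hμ₁ hμ₃ hc hμ₂ hk' hg, newForm_eq hϖ hμ₁ hμ₃ hc hμ₂ (K_mul_mem hϖ hk' hk)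
      (a := a) (x := x) (y := y) (z := z)]
    rw [Units.val_mul, Units.val_mul, hg, mul_assoc]
  · rw [newForm, newForm, dif_neg hex, dif_neg]
    rintro ⟨a, x, y, z, k', hk', hg⟩
    refine hex ⟨a, x, y, z, k' * k⁻¹, K_mul_mem hϖ hk' (K_inv_mem hk), ?_⟩
    rw [Units.val_mul, ← mul_assoc, ← hg, Units.val_mul, mul_assoc, Units.mul_inv, mul_one]

theorem newForm_diagonal_mul (hϖ : IsNormalizedUniformizer ϖ) (hμ₁ : HasConductor μ₁ 0)
    (hμ₃ : HasConductor μ₃ 0) (hc : 1 ≤ c) (hμ₂ : HasConductor μ₂ c) (g h : GL (Fin 3) F)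
    {b : Fin 3 → Fˣ} (hh : (h : Matrix (Fin 3) (Fin 3) F) = Matrix.diagonal (fun i => (b i : F)) * g) :
    newForm μ₁ μ₂ μ₃ c h = (μ₁ (b 0) : ℂ) * (μ₂ (b 1) : ℂ) * (μ₃ (b 2) : ℂ) *
      ((‖(b 0 : F)‖ / ‖(b 2 : F)‖ : ℝ) : ℂ) * newForm μ₁ μ₂ μ₃ c g := by
  have hdd : ∀ (a b : Fin 3 → Fˣ), Matrix.diagonal (fun i => (a i : F)) *
      Matrix.diagonal (fun i => (b i : F)) = Matrix.diagonal (fun i => (((a * b) i : Fˣ) : F)) := by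
    intro a b
    simp [Matrix.diagonal_mul_diagonal]
  by_cases hex : ∃ a : Fin 3 → Fˣ, ∃ x y z : F, ∃ k ∈ K F c,
      (g : Matrix (Fin 3) (Fin 3) F) = Matrix.diagonal (fun i => (a i : F)) *
        (unip x y z : Matrix (Fin 3) (Fin 3) F) * (k : Matrix (Fin 3) (Fin 3) F)
  · obtain ⟨a, x, y, z, k', hk', hg⟩ := hex
    rw [newForm_eq hϖ hμ₁ hμ₃ hc hμ₂ hk' hg, newForm_eq hϖ hμ₁ hμ₃ hc hμ₂ hk'
      (a := b * a) (x := x) (y := y) (z := z)]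
    · simp only [Pi.mul_apply, map_mul, Units.val_mul, norm_mul]
      push_cast
      have := (norm_pos_iff.2 (b 2).ne_zero).ne'
      have := (norm_pos_iff.2 (a 2).ne_zero).ne'
      field_simp
    · rw [hh, hg, ← hdd]; simp only [mul_assoc]
  · rw [newForm, newForm, dif_neg hex, dif_neg, mul_zero]
    rintro ⟨a, x, y, z, k', hk', hg⟩
    refine hex ⟨b⁻¹ * a, x, y, z, k', hk', ?_⟩
    rw [← hdd, mul_assoc, mul_assoc, ← mul_assoc _ _ (k' : Matrix (Fin 3) (Fin 3) F), ← hg, hh,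
      ← mul_assoc, hdd, inv_mul_cancel]
    simp

end NewForm

section BigCell

variable {F : Type*} [NontriviallyNormedField F] [IsUltrametricDist F] {ϖ : Fˣ}
  {μ₁ μ₂ μ₃ : Fˣ →ₜ* ℂˣ} {c : ℕ}

open Classical in
/-- Extension by zero of a quasi-character. -/
noncomputable def charExt (μ : Fˣ →ₜ* ℂˣ) (v : F) : ℂ :=
  if h : v = 0 then 0 else (μ (Units.mk0 v h) : ℂ)

theorem charExt_of_ne {μ : Fˣ →ₜ* ℂˣ} {v : F} (h : v ≠ 0) :
    charExt μ v = (μ (Units.mk0 v h) : ℂ) := dif_neg h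

theorem charExt_units {μ : Fˣ →ₜ* ℂˣ} (v : Fˣ) : charExt μ (v : F) = (μ v : ℂ) := by
  rw [charExt_of_ne v.ne_zero, Units.mk0_val]

theorem charExt_zero (μ : Fˣ →ₜ* ℂˣ) : charExt μ (0 : F) = 0 := dif_pos rfl

theorem charExt_mul (μ : Fˣ →ₜ* ℂˣ) (v w : F) : charExt μ (v * w) = charExt μ v * charExt μ w := by
  rcases eq_or_ne v 0 with rfl | hv
  · simp [charExt_zero]
  rcases eq_or_ne w 0 with rfl | hw
  · simp [charExt_zero]
  lift v to Fˣ using hv.isUnit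
  lift w to Fˣ using hw.isUnit
  rw [← Units.val_mul, charExt_units, charExt_units, charExt_units, map_mul, Units.val_mul]

theorem charExt_inv (μ : Fˣ →ₜ* ℂˣ) (v : F) : charExt μ v⁻¹ = (charExt μ v)⁻¹ := by
  rcases eq_or_ne v 0 with rfl | hv
  · simp [charExt_zero]
  lift v to Fˣ using hv.isUnit
  rw [← Units.val_inv_eq_inv_val, charExt_units, charExt_units, map_inv, Units.val_inv_eq_inv_val]

theorem HasConductor.charExt_eq (hϖ : IsNormalizedUniformizer ϖ) {μ : Fˣ →ₜ* ℂˣ}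
    (hμ : HasConductor μ 0) {v : F} {n : ℤ} (hv : ‖v‖ = (resCard F : ℝ) ^ n) :
    charExt μ v = (μ ϖ : ℂ) ^ (-n) := by
  have h0 : v ≠ 0 := norm_ne_zero_iff.1 (by rw [hv]; exact (zpow_pos (resCard_pos hϖ) _).ne')
  rw [charExt_of_ne h0, hμ.eq_zpow_of_norm_eq hϖ (n := -n) (by rw [neg_neg]; exact hv),
    Units.val_zpow_eq_zpow_val]

theorem HasConductor.charExt_eq_one {μ : Fˣ →ₜ* ℂˣ} (hc : 1 ≤ c) (hμ : HasConductor μ c) {v : F}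
    (h0 : v ≠ 0) (hv : v - 1 ∈ fracIdeal F c) : charExt μ v = 1 := by
  rw [charExt_of_ne h0, hμ.1 _ (by rw [unitFiltration, if_neg (by omega)]; exact hv), Units.val_one]

/-- The new form on the big cell, `f(w 𝔲(x, y, z))`. -/
noncomputable def bigCell (μ₁ μ₂ μ₃ : Fˣ →ₜ* ℂˣ) (c : ℕ) (x y z : F) : ℂ :=
  newForm μ₁ μ₂ μ₃ c (longWeyl * (unip x y z : GL (Fin 3) F))

theorem longWeyl_mul_unip (x y z : F) :
    ((longWeyl * (unip x y z : GL (Fin 3) F) : GL (Fin 3) F) : Matrix (Fin 3) (Fin 3) F) =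
      !![0, 0, 1; 0, 1, y; 1, x, z] := by
  rw [Units.val_mul, unip_coe_GL]
  ext i j
  fin_cases i <;> fin_cases j <;> simp [longWeyl, Matrix.mul_apply, Fin.sum_univ_three]

theorem not_mem_fracIdeal_iff (hϖ : IsNormalizedUniformizer ϖ) {n : ℤ} {x : F} :
    x ∉ fracIdeal F (n + 1) ↔ (resCard F : ℝ) ^ (-n) ≤ ‖x‖ := by
  rw [mem_fracIdeal, show -(n + 1) = -n - 1 by ring, ← lt_zpow_iff hϖ, not_lt]

theorem norm_le_of_bigCell_ne_zero (hϖ : IsNormalizedUniformizer ϖ) (hc : 1 ≤ c) {x y z : F}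
    (h : bigCell μ₁ μ₂ μ₃ c x y z ≠ 0) :
    ‖x‖ ≤ (resCard F : ℝ) ^ (-c : ℤ) * max ((resCard F : ℝ) ^ (c : ℤ)) ‖z‖ ∧
    ‖y‖ ≤ (resCard F : ℝ) ^ (-c : ℤ) * max ((resCard F : ℝ) ^ (c : ℤ)) ‖z - x * y‖ := by
  have hq := resCard_pos hϖ
  have key : ∀ {α s Z : ℝ}, 0 ≤ s → s * α ≤ (resCard F : ℝ) ^ (-c : ℤ) →
      ((resCard F : ℝ) ^ (-c : ℤ) ≤ α ∨ (resCard F : ℝ) ^ (-0 : ℤ) ≤ Z * α) → 0 < α →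
      s ≤ (resCard F : ℝ) ^ (-c : ℤ) * max ((resCard F : ℝ) ^ (c : ℤ)) Z := by
    intro α s Z hs h1 h2 hα
    rw [← mul_le_mul_iff_left₀ hα]
    refine h1.trans ?_
    rw [mul_assoc]
    refine le_mul_of_one_le_right (zpow_pos hq _).le ?_
    rcases h2 with h2 | h2
    · calc (1 : ℝ) = (resCard F : ℝ) ^ (c : ℤ) * (resCard F : ℝ) ^ (-c : ℤ) := by
            rw [← zpow_add₀ hq.ne', add_neg_cancel, zpow_zero]
        _ ≤ _ := mul_le_mul (le_max_left _ _) h2 (zpow_pos hq _).le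
            (le_max_of_le_left (zpow_pos hq _).le)
    · rw [neg_zero, zpow_zero] at h2
      exact h2.trans (mul_le_mul_of_nonneg_right (le_max_right _ _) hα.le)
  by_cases hex : ∃ a : Fin 3 → Fˣ, ∃ x' y' z' : F, ∃ k ∈ K F c,
      ((longWeyl * (unip x y z : GL (Fin 3) F) : GL (Fin 3) F) : Matrix (Fin 3) (Fin 3) F) =
        Matrix.diagonal (fun i => (a i : F)) *
        (unip x' y' z' : Matrix (Fin 3) (Fin 3) F) * (k : Matrix (Fin 3) (Fin 3) F)
  swap
  · exact absurd (by rw [bigCell, newForm, dif_neg hex]) h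
  obtain ⟨a, x', y', z', k, hk, hg⟩ := hex
  have hg' : (!![0, 0, 1; 0, 1, y; 1, x, z] : Matrix (Fin 3) (Fin 3) F) *
      (k⁻¹ : GL (Fin 3) F) = Matrix.diagonal (fun i => (a i : F)) *
        (unip x' y' z' : Matrix (Fin 3) (Fin 3) F) := by
    rw [← longWeyl_mul_unip, hg, mul_assoc, Units.mul_inv, mul_one]
  rw [longWeyl_mul_unip] at hg
  obtain ⟨s00, s01, s02, s10, s11, s12, s20, s21, s22⟩ := hk.1
  have hk' := K_inv_mem hk
  obtain ⟨r00, r01, r02, r10, r11, r12, r20, r21, r22⟩ := hk'.1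
  have p1 := K_last_row_primitive hϖ hc hk
  have p2 := K_first_col_primitive hϖ hc hk'
  rw [not_mem_fracIdeal_iff hϖ, show (1 : ℤ) = 0 + 1 by norm_num, not_mem_fracIdeal_iff hϖ] at p1 p2
  generalize ((k⁻¹ : GL (Fin 3) F) : Matrix (Fin 3) (Fin 3) F) = B at *
  generalize (k : Matrix (Fin 3) (Fin 3) F) = A at *
  have e := fun i j => congrFun (congrFun hg i) j
  have e' := fun i j => congrFun (congrFun hg' i) j
  have e20 := e 2 0
  have e21 := e 2 1
  have e22 := e 2 2
  have d00 := e' 0 0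
  have d10 := e' 1 0
  have d20 := e' 2 0
  simp [unip, Matrix.mul_apply, Fin.sum_univ_three, Matrix.diagonal] at e20 e21 e22 d00 d10 d20
  have ha2 : ‖(a 2 : F)‖ ≠ 0 := norm_ne_zero_iff.2 (a 2).ne_zero
  have ha0 : ‖(a 0 : F)‖ ≠ 0 := norm_ne_zero_iff.2 (a 0).ne_zero
  constructor
  · refine key (α := ‖(a 2 : F)‖⁻¹) (norm_nonneg _) ?_ ?_ (by positivity)
    · rw [e21, norm_mul, mul_comm, inv_mul_cancel_left₀ ha2]; exact s21
    · have : ‖A 2 0‖ = ‖(a 2 : F)‖⁻¹ := by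
        rw [← mul_eq_one_iff_eq_inv₀ ha2, mul_comm, ← norm_mul, ← e20, norm_one]
      rw [← this]
      refine p1.imp id fun h => ?_
      rw [e22, norm_mul, this, mul_comm, inv_mul_cancel_left₀ ha2]; exact h
  · have f1 : B 1 0 = -(y * a 0) := by rw [d00] at d10; linear_combination d10
    have f0 : B 0 0 = -((z - x * y) * a 0) := by rw [d00, f1] at d20; linear_combination d20
    refine key (α := ‖(a 0 : F)‖) (norm_nonneg _) ?_ ?_ (by positivity)
    · have := r10
      rwa [f1, neg_mem_fracIdeal, mem_fracIdeal, norm_mul] at this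
    · rw [d00, f0, norm_neg, norm_mul] at p2
      exact p2

theorem unip_mem_K (hϖ : IsNormalizedUniformizer ϖ) {x y z : F}
    (hz : z ∈ fracIdeal F (-c)) (hx : x ∈ fracIdeal F 0) (hy : y ∈ fracIdeal F 0) :
    (unip x y z : GL (Fin 3) F) ∈ K F c := by
  have h1 : ((unip x y z)⁻¹ : Matrix.SpecialLinearGroup (Fin 3) F) = unip (-x) (-y) (x * y - z) := by
    rw [inv_eq_iff_mul_eq_one]
    ext i j
    rw [Matrix.SpecialLinearGroup.coe_mul]
    fin_cases i <;> fin_cases j <;> simp [unip, Matrix.mul_apply, Fin.sum_univ_three] <;> ring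
  refine ⟨?_, ?_⟩
  · rw [unip_coe_GL]
    simp [KShape, one_mem_fracIdeal_zero, zero_mem_fracIdeal, hx, hy, hz]
  · rw [← map_inv, h1]
    change KShape c !![1, -x, x * y - z; 0, 1, -y; 0, 0, 1]
    have h2 : x * y - z ∈ fracIdeal F (-c) :=
      sub_mem_fracIdeal (mul_mem_fracIdeal_of_le hϖ hx hy (by omega)) hz
    simp [KShape, one_mem_fracIdeal_zero, zero_mem_fracIdeal, neg_mem_fracIdeal, hx, hy, h2]

/-- On the region `|z| ≤ q^c` the new form is constant on its support. -/
theorem bigCell_of_le (hϖ : IsNormalizedUniformizer ϖ) (hμ₁ : HasConductor μ₁ 0)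
    (hμ₃ : HasConductor μ₃ 0) (hμ₁₃ : ∀ a : Fˣ, μ₁ a * μ₃ a = 1) (hc : 1 ≤ c)
    (hμ₂ : HasConductor μ₂ c) {x y z : F}
    (hz : z ∈ fracIdeal F (-c)) (hx : x ∈ fracIdeal F 0) (hy : y ∈ fracIdeal F 0) :
    bigCell μ₁ μ₂ μ₃ c x y z = (μ₁ ϖ : ℂ) ^ (2 * c) * ((resCard F : ℂ) ^ (2 * c))⁻¹ := by
  have hq := resCard_pos hϖ
  have hu := unip_mem_K hϖ hz hx hy
  rw [bigCell, newForm_mul_right hϖ hμ₁ hμ₃ hc hμ₂ _ hu]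
  set α : Fˣ := ϖ ^ c with hα
  have hαn : ‖(α : F)‖ = (resCard F : ℝ) ^ (-c : ℤ) := by
    have := norm_uniformizer_zpow hϖ c
    rwa [zpow_natCast] at this
  have hαn' : ‖((α⁻¹ : Fˣ) : F)‖ = (resCard F : ℝ) ^ (c : ℤ) := by
    rw [Units.val_inv_eq_inv_val, norm_inv, hαn, zpow_neg, inv_inv]
  let k : GL (Fin 3) F :=
    ⟨!![0, 0, ((α⁻¹ : Fˣ) : F); 0, 1, 0; (α : F), 0, 0],
     !![0, 0, ((α⁻¹ : Fˣ) : F); 0, 1, 0; (α : F), 0, 0],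
     by ext i j; fin_cases i <;> fin_cases j <;> simp [Matrix.mul_apply, Fin.sum_univ_three],
     by ext i j; fin_cases i <;> fin_cases j <;> simp [Matrix.mul_apply, Fin.sum_univ_three]⟩
  have hks : KShape c (!![0, 0, ((α⁻¹ : Fˣ) : F); 0, 1, 0; (α : F), 0, 0]) := by
    have h1 : ((α⁻¹ : Fˣ) : F) ∈ fracIdeal F (-c) := by rw [mem_fracIdeal, hαn', neg_neg]
    have h2 : (α : F) ∈ fracIdeal F c := hαn.le
    rw [Units.val_inv_eq_inv_val] at h1
    simp [KShape, one_mem_fracIdeal_zero, zero_mem_fracIdeal, h1, h2]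
  rw [newForm_eq hϖ hμ₁ hμ₃ hc hμ₂ (k := k) (a := ![α, 1, α⁻¹]) (x := 0) (y := 0) (z := 0)
    ⟨hks, hks⟩]
  · have h3 : μ₃ α⁻¹ = μ₁ α := by rw [map_inv, inv_eq_iff_mul_eq_one, mul_comm]; exact hμ₁₃ α
    have h4 : (μ₁ α : ℂ) = (μ₁ ϖ : ℂ) ^ c := by rw [hα, map_pow, Units.val_pow_eq_pow_val]
    have h5 : ‖(α : F)‖ / ‖((α⁻¹ : Fˣ) : F)‖ = ((resCard F : ℝ) ^ (2 * c))⁻¹ := by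
      rw [hαn, hαn', ← zpow_sub₀ hq.ne', show (-c - c : ℤ) = -((2 * c : ℕ) : ℤ) by push_cast; ring,
        zpow_neg, zpow_natCast]
    simp only [Matrix.cons_val_zero, Matrix.cons_val_one, Matrix.cons_val, map_one, Units.val_one,
      mul_one, h3, h4]
    rw [h5]
    push_cast
    ring
  · ext i j
    fin_cases i <;> fin_cases j <;>
      simp [longWeyl, unip, k, Matrix.mul_apply, Fin.sum_univ_three, Matrix.diagonal]

/-- The explicit value of the new form on the region `|z| ≥ q^c`. -/
theorem bigCell_of_ge (hϖ : IsNormalizedUniformizer ϖ) (hμ₁ : HasConductor μ₁ 0)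
    (hμ₃ : HasConductor μ₃ 0) (hμ₁₃ : ∀ a : Fˣ, μ₁ a * μ₃ a = 1) (hc : 1 ≤ c)
    (hμ₂ : HasConductor μ₂ c) {x y z : F} (hz : (resCard F : ℝ) ^ (c : ℤ) ≤ ‖z‖)
    (hx : ‖x‖ ≤ (resCard F : ℝ) ^ (-c : ℤ) * ‖z‖)
    (hy : ‖y‖ ≤ (resCard F : ℝ) ^ (-c : ℤ) * ‖z - x * y‖) :
    bigCell μ₁ μ₂ μ₃ c x y z = charExt μ₂ ((z - x * y) / z) *
      charExt μ₁ (z - x * y)⁻¹ * charExt μ₁ z⁻¹ * ((‖z - x * y‖⁻¹ * ‖z‖⁻¹ : ℝ) : ℂ) := by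
  have hq := resCard_pos hϖ
  have hz0 : z ≠ 0 := norm_pos_iff.1 ((zpow_pos hq _).trans_le hz)
  have hw0 : z - x * y ≠ 0 := by
    intro h
    rw [h, norm_zero, mul_zero] at hy
    rw [norm_le_zero_iff.1 hy, mul_zero, sub_zero] at h
    exact hz0 h
  obtain ⟨w, hw⟩ : ∃ w, w = z - x * y := ⟨_, rfl⟩
  rw [← hw] at hy hw0 ⊢
  have hzn := norm_pos_iff.2 hz0
  have hwn := norm_pos_iff.2 hw0
  have m1 : z⁻¹ ∈ fracIdeal F c := by
    rw [mem_fracIdeal, norm_inv, zpow_neg]; exact inv_anti₀ (zpow_pos hq _) hz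
  have m2 : x / z ∈ fracIdeal F c := by
    rw [mem_fracIdeal, norm_div, div_le_iff₀ hzn]; exact hx
  have m3 : y / w ∈ fracIdeal F c := by
    rw [mem_fracIdeal, norm_div, div_le_iff₀ hwn]; exact hy
  have m4 : -(x / z * (y / w)) - z⁻¹ ∈ fracIdeal F c :=
    sub_mem_fracIdeal (neg_mem_fracIdeal.2 (mul_mem_fracIdeal_of_le hϖ m2 m3 (by omega))) m1
  let k : GL (Fin 3) F :=
    ⟨!![1, 0, 0; -(y / w), 1, 0; z⁻¹, x / z, 1],
     !![1, 0, 0; y / w, 1, 0; -(x / z * (y / w)) - z⁻¹, -(x / z), 1],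
     by ext i j; fin_cases i <;> fin_cases j <;>
          simp [Matrix.mul_apply, Fin.sum_univ_three] <;> ring,
     by ext i j; fin_cases i <;> fin_cases j <;>
          simp [Matrix.mul_apply, Fin.sum_univ_three] <;> ring⟩
  have hk : k ∈ K F c := by
    have i1 := fracIdeal_anti hϖ (show (0 : ℤ) ≤ c by omega) m2
    constructor
    · change KShape c !![1, 0, 0; -(y / w), 1, 0; z⁻¹, x / z, 1]
      simp [KShape, one_mem_fracIdeal_zero, zero_mem_fracIdeal, neg_mem_fracIdeal, m1, m2, m3]
    · change KShape c !![1, 0, 0; y / w, 1, 0; -(x / z * (y / w)) - z⁻¹, -(x / z), 1]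
      simp [KShape, one_mem_fracIdeal_zero, zero_mem_fracIdeal, neg_mem_fracIdeal, m4, m2, m3]
  have hg : ((longWeyl * (unip x y z : GL (Fin 3) F) : GL (Fin 3) F) : Matrix (Fin 3) (Fin 3) F) =
      Matrix.diagonal (fun i => ((![-(Units.mk0 w hw0)⁻¹, Units.mk0 w hw0 / Units.mk0 z hz0,
        Units.mk0 z hz0] i : Fˣ) : F)) *
      (unip (x * w / z) (y * z / w) (-w) : Matrix (Fin 3) (Fin 3) F) *
        (k : Matrix (Fin 3) (Fin 3) F) := by
    rw [longWeyl_mul_unip]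
    ext i j
    fin_cases i <;> fin_cases j <;>
      simp [unip, k, Matrix.mul_apply, Fin.sum_univ_three, Matrix.diagonal] <;> field_simp <;>
      (try rw [hw]) <;> ring
  rw [bigCell, newForm_eq hϖ hμ₁ hμ₃ hc hμ₂ hk hg]
  have v2 : charExt μ₂ (w / z) = (μ₂ (Units.mk0 w hw0 / Units.mk0 z hz0) : ℂ) := by
    rw [← charExt_units]; simp
  have v1 : charExt μ₁ w⁻¹ = (μ₁ (-(Units.mk0 w hw0)⁻¹) : ℂ) := by
    rw [hμ₁.eq_of_norm_eq (b := (Units.mk0 w hw0)⁻¹) (by simp), ← charExt_units]; simp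
  have v3 : charExt μ₁ z⁻¹ = (μ₃ (Units.mk0 z hz0) : ℂ) := by
    have : μ₃ (Units.mk0 z hz0) = μ₁ (Units.mk0 z hz0)⁻¹ := by
      rw [map_inv, eq_inv_iff_mul_eq_one, mul_comm]; exact hμ₁₃ _
    rw [this, ← charExt_units]; simp
  rw [v1, v2, v3]
  simp only [Matrix.cons_val_zero, Matrix.cons_val_one, Matrix.cons_val, Units.val_neg, norm_neg,
    Units.val_inv_eq_inv_val, Units.val_mk0, norm_inv]
  push_cast
  ring

open Classical in
theorem bigCell_eq_of_le (hϖ : IsNormalizedUniformizer ϖ) (hμ₁ : HasConductor μ₁ 0)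
    (hμ₃ : HasConductor μ₃ 0) (hμ₁₃ : ∀ a : Fˣ, μ₁ a * μ₃ a = 1) (hc : 1 ≤ c)
    (hμ₂ : HasConductor μ₂ c) {x y z : F} (hz : z ∈ fracIdeal F (-c)) :
    bigCell μ₁ μ₂ μ₃ c x y z = if x ∈ fracIdeal F 0 ∧ y ∈ fracIdeal F 0 then
      (μ₁ ϖ : ℂ) ^ (2 * c) * ((resCard F : ℂ) ^ (2 * c))⁻¹ else 0 := by
  have hq := resCard_pos hϖ
  split_ifs with h
  · exact bigCell_of_le hϖ hμ₁ hμ₃ hμ₁₃ hc hμ₂ hz h.1 h.2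
  · by_contra hne
    obtain ⟨h1, h2⟩ := norm_le_of_bigCell_ne_zero hϖ hc hne
    rw [mem_fracIdeal, neg_neg] at hz
    have hqq : (resCard F : ℝ) ^ (-c : ℤ) * (resCard F : ℝ) ^ (c : ℤ) = 1 := by
      rw [← zpow_add₀ hq.ne', neg_add_cancel, zpow_zero]
    rw [max_eq_left hz, hqq] at h1
    have hlt : (resCard F : ℝ) ^ (-c : ℤ) < 1 := by
      rw [zpow_neg, zpow_natCast]
      exact inv_lt_one_of_one_lt₀ (one_lt_pow₀ (one_lt_resCard hϖ) (by omega))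
    refine h ⟨mem_fracIdeal_zero.2 h1, mem_fracIdeal_zero.2 ?_⟩
    by_contra! hy
    have h3 : ‖z - x * y‖ ≤ max ((resCard F : ℝ) ^ (c : ℤ)) ‖y‖ :=
      norm_sub_le_of_le (hz.trans (le_max_left _ _)) (by
        rw [norm_mul]
        exact (mul_le_of_le_one_left (norm_nonneg _) h1).trans (le_max_right _ _))
    have h4 : ‖y‖ ≤ (resCard F : ℝ) ^ (-c : ℤ) * max ((resCard F : ℝ) ^ (c : ℤ)) ‖y‖ :=
      h2.trans (mul_le_mul_of_nonneg_left (max_le (le_max_left _ _) h3) (zpow_pos hq _).le)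
    rcases le_total ((resCard F : ℝ) ^ (c : ℤ)) ‖y‖ with h5 | h5
    · rw [max_eq_right h5] at h4
      nlinarith
    · rw [max_eq_left h5, hqq] at h4
      linarith

open Classical in
theorem bigCell_eq_of_ge (hϖ : IsNormalizedUniformizer ϖ) (hμ₁ : HasConductor μ₁ 0)
    (hμ₃ : HasConductor μ₃ 0) (hμ₁₃ : ∀ a : Fˣ, μ₁ a * μ₃ a = 1) (hc : 1 ≤ c)
    (hμ₂ : HasConductor μ₂ c) {x y z : F} (hz : (resCard F : ℝ) ^ (c : ℤ) ≤ ‖z‖) :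
    bigCell μ₁ μ₂ μ₃ c x y z = if ‖x‖ ≤ (resCard F : ℝ) ^ (-c : ℤ) * ‖z‖ ∧
        ‖y‖ ≤ (resCard F : ℝ) ^ (-c : ℤ) * ‖z - x * y‖ then
      charExt μ₂ ((z - x * y) / z) * charExt μ₁ (z - x * y)⁻¹ * charExt μ₁ z⁻¹ *
        ((‖z - x * y‖⁻¹ * ‖z‖⁻¹ : ℝ) : ℂ) else 0 := by
  have hq := resCard_pos hϖ
  split_ifs with h
  · exact bigCell_of_ge hϖ hμ₁ hμ₃ hμ₁₃ hc hμ₂ hz h.1 h.2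
  · by_contra hne
    obtain ⟨h1, h2⟩ := norm_le_of_bigCell_ne_zero hϖ hc hne
    rw [max_eq_right hz] at h1
    refine h ⟨h1, ?_⟩
    rcases le_or_gt ((resCard F : ℝ) ^ (c : ℤ)) ‖z - x * y‖ with h3 | h3
    · rwa [max_eq_right h3] at h2
    · exfalso
      have hqq : (resCard F : ℝ) ^ (-c : ℤ) * (resCard F : ℝ) ^ (c : ℤ) = 1 := by
        rw [← zpow_add₀ hq.ne', neg_add_cancel, zpow_zero]
      have hlt : (resCard F : ℝ) ^ (-c : ℤ) < 1 := by
        rw [zpow_neg, zpow_natCast]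
        exact inv_lt_one_of_one_lt₀ (one_lt_pow₀ (one_lt_resCard hϖ) (by omega))
      rw [max_eq_left h3.le, hqq] at h2
      have hzpos : 0 < ‖z‖ := (zpow_pos hq _).trans_le hz
      have h4 : ‖x * y‖ < ‖z‖ := by
        rw [norm_mul]
        calc ‖x‖ * ‖y‖ ≤ ‖x‖ := mul_le_of_le_one_right (norm_nonneg _) h2
          _ ≤ _ := h1
          _ < ‖z‖ := mul_lt_of_lt_one_left hzpos hlt
      rw [norm_sub_eq_left h4] at h3
      exact absurd hz (not_le.2 h3)

/-- The new form on the big cell is invariant under `U ∩ K_c`. -/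
theorem bigCell_mul_right (hϖ : IsNormalizedUniformizer ϖ) (hμ₁ : HasConductor μ₁ 0)
    (hμ₃ : HasConductor μ₃ 0) (hc : 1 ≤ c)
    (hμ₂ : HasConductor μ₂ c) (x y z : F) {x' y' z' : F}
    (hz : z' ∈ fracIdeal F (-c)) (hx : x' ∈ fracIdeal F 0) (hy : y' ∈ fracIdeal F 0) :
    bigCell μ₁ μ₂ μ₃ c (x + x') (y + y') (z + z' + x * y') = bigCell μ₁ μ₂ μ₃ c x y z := by
  have h1 : unip (x + x') (y + y') (z + z' + x * y') = unip x y z * unip x' y' z' := by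
    ext i j
    rw [Matrix.SpecialLinearGroup.coe_mul]
    fin_cases i <;> fin_cases j <;> simp [unip, Matrix.mul_apply, Fin.sum_univ_three] <;> ring
  rw [bigCell, h1, map_mul, ← mul_assoc,
    newForm_mul_right hϖ hμ₁ hμ₃ hc hμ₂ _ (unip_mem_K hϖ hz hx hy), bigCell]

theorem continuous_bigCell (hϖ : IsNormalizedUniformizer ϖ) (hμ₁ : HasConductor μ₁ 0)
    (hμ₃ : HasConductor μ₃ 0) (hc : 1 ≤ c) (hμ₂ : HasConductor μ₂ c) :
    Continuous fun p : F × F × F => bigCell μ₁ μ₂ μ₃ c p.1 p.2.1 p.2.2 := by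
  refine IsLocallyConstant.continuous ?_
  rw [IsLocallyConstant.iff_eventually_eq]
  rintro ⟨x, y, z⟩
  have o0 := (isOpen_fracIdeal (F := F) hϖ 0).mem_nhds (zero_mem_fracIdeal _)
  have oc := (isOpen_fracIdeal (F := F) hϖ (-c)).mem_nhds (zero_mem_fracIdeal _)
  have t1 : Tendsto (fun p : F × F × F => p.1 - x) (𝓝 (x, y, z)) (𝓝 0) := by
    have : Continuous (fun p : F × F × F => p.1 - x) := by fun_prop
    simpa using this.tendsto (x, y, z)
  have t2 : Tendsto (fun p : F × F × F => p.2.1 - y) (𝓝 (x, y, z)) (𝓝 0) := by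
    have : Continuous (fun p : F × F × F => p.2.1 - y) := by fun_prop
    simpa using this.tendsto (x, y, z)
  have t3 : Tendsto (fun p : F × F × F => p.2.2 - z - x * (p.2.1 - y)) (𝓝 (x, y, z)) (𝓝 0) := by
    have : Continuous (fun p : F × F × F => p.2.2 - z - x * (p.2.1 - y)) := by fun_prop
    simpa using this.tendsto (x, y, z)
  filter_upwards [t1 o0, t2 o0, t3 oc] with p h1 h2 h3
  have := bigCell_mul_right hϖ hμ₁ hμ₃ hc hμ₂ x y z h3 h1 h2
  rw [← this]
  congr 1 <;> ring

end BigCell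

/-- The hypotheses under which the new form `newForm μ₁ μ₂ μ₃ c` is studied. -/
structure IsNewFormDatum {F : Type*} [NontriviallyNormedField F] [IsUltrametricDist F] (ϖ : Fˣ)
    (μ₁ μ₂ μ₃ : Fˣ →ₜ* ℂˣ) (c : ℕ) : Prop where
  unif : IsNormalizedUniformizer ϖ
  unr₁ : HasConductor μ₁ 0
  unr₃ : HasConductor μ₃ 0
  mul_eq_one : ∀ a : Fˣ, μ₁ a * μ₃ a = 1
  one_le : 1 ≤ c
  ram : HasConductor μ₂ c

section Decomposition

variable {F : Type*} [NontriviallyNormedField F] [IsUltrametricDist F] [LocallyCompactSpace F]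
  [MeasurableSpace F] [BorelSpace F] {ϖ : Fˣ} (dx : Measure F)

theorem setIntegral_fracIdeal_eq_add_sum (hϖ : IsNormalizedUniformizer ϖ) {N L : ℤ} (h : N ≤ L)
    {f : F → ℂ} (hf : IntegrableOn f (fracIdeal F (-L)) dx) :
    ∫ x in fracIdeal F (-L), f x ∂dx = ∫ x in fracIdeal F (-N), f x ∂dx +
      ∑ n ∈ Finset.Ioc N L, ∫ x in sphereZ F n, f x ∂dx := by
  induction L, h using Int.leInduction with
  | base => simp
  | succ L hL ih =>
    have h1 : Finset.Ioc N (L + 1) = insert (L + 1) (Finset.Ioc N L) := by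
      ext; simp only [Finset.mem_Ioc, Finset.mem_insert]; omega
    have h2 : fracIdeal F (-L) ⊆ fracIdeal F (-(L + 1)) := fracIdeal_anti hϖ (by omega)
    have h3 : fracIdeal F (-(L + 1)) = fracIdeal F (-L) ∪ sphereZ F (L + 1) := by
      rw [fracIdeal_eq_union_sphereZ hϖ, show -(L + 1) + 1 = -L by ring]
    have h4 : sphereZ F (L + 1) ⊆ fracIdeal F (-(L + 1)) := h3 ▸ Set.subset_union_right
    rw [h1, Finset.sum_insert (by simp), h3, setIntegral_union _ (measurableSet_sphereZ _)
      (hf.mono_set h2) (hf.mono_set h4), ih (hf.mono_set h2)]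
    · ring
    · rw [sphereZ_eq_diff hϖ, show -(L + 1) + 1 = -L by ring]; exact Set.disjoint_sdiff_right

end Decomposition

section RamifiedIntegral

variable {F : Type*} [NontriviallyNormedField F] [IsUltrametricDist F] [LocallyCompactSpace F]
  [MeasurableSpace F] [BorelSpace F] [SecondCountableTopology F] {ϖ : Fˣ} (dx : Measure F)
  [dx.IsAddHaarMeasure] (hdx : dx (fracIdeal F 0) = 1)
  {μ₁ μ₂ μ₃ : Fˣ →ₜ* ℂˣ} {c : ℕ}

open Classical in
/-- The function `μ₂ μ₁⁻¹ |·|⁻¹` on the set `|1 - v| ≤ q^(k - c) |v|`, `|1 - v| ≤ q^r`. -/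
noncomputable def ratioFun (μ₁ μ₂ : Fˣ →ₜ* ℂˣ) (c : ℕ) (k r : ℤ) (v : F) : ℂ :=
  if ‖1 - v‖ ≤ (resCard F : ℝ) ^ (k - c) * ‖v‖ ∧ 1 - v ∈ fracIdeal F (-r) then
    charExt μ₂ v * (charExt μ₁ v)⁻¹ * ((‖v‖⁻¹ : ℝ) : ℂ) else 0

theorem exists_ne_one_of_hasConductor (hϖ : IsNormalizedUniformizer ϖ) (hc : 1 ≤ c)
    (hμ₂ : HasConductor μ₂ c) :
    ∃ u : Fˣ, ‖(u : F)‖ = 1 ∧ (u : F) - 1 ∈ fracIdeal F (c - 1) ∧ μ₂ u ≠ 1 := by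
  have h1 : ¬ (c - 1) ∈ {n : ℕ | ∀ a ∈ unitFiltration (F := F) n, μ₂ a = 1} := fun h => by
    have := hμ₂.2 h
    omega
  simp only [Set.mem_ofPred_eq, not_forall] at h1
  obtain ⟨u, hu, hne⟩ := h1
  rw [unitFiltration] at hu
  split_ifs at hu with h0
  · have hu' : ‖(u : F)‖ = 1 := hu
    refine ⟨u, hu, ?_, hne⟩
    rw [show (c : ℤ) - 1 = 0 by omega]
    exact sub_mem_fracIdeal (mem_fracIdeal_zero.2 hu'.le) one_mem_fracIdeal_zero
  · have hu' : (u : F) - 1 ∈ fracIdeal F (c - 1 : ℕ) := hu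
    rw [Nat.cast_sub hc, Nat.cast_one] at hu'
    exact ⟨u, norm_eq_one_of_sub_one_mem hϖ (by omega) hu', hu', hne⟩

theorem ratio_cond_mul (hϖ : IsNormalizedUniformizer ϖ) {k r : ℤ} (hk : 1 ≤ k) (hc : 1 ≤ c)
    (hr : -(c : ℤ) < r) {u v : F} (hu : ‖u‖ = 1) (hu1 : u - 1 ∈ fracIdeal F (c - 1))
    (h : ‖1 - v‖ ≤ (resCard F : ℝ) ^ (k - c) * ‖v‖ ∧ 1 - v ∈ fracIdeal F (-r)) :
    ‖1 - u * v‖ ≤ (resCard F : ℝ) ^ (k - c) * ‖u * v‖ ∧ 1 - u * v ∈ fracIdeal F (-r) := by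
  have hq := resCard_pos hϖ
  have hq1 := (one_lt_resCard hϖ).le
  have h1 : 1 - u * v = (1 - v) - (u - 1) * v := by ring
  have h2 : ‖(u - 1) * v‖ ≤ (resCard F : ℝ) ^ (1 - c : ℤ) * ‖v‖ := by
    rw [norm_mul]
    refine mul_le_mul_of_nonneg_right ?_ (norm_nonneg _)
    rw [mem_fracIdeal] at hu1
    rwa [neg_sub] at hu1
  rw [norm_mul, hu, one_mul, h1]
  refine ⟨norm_sub_le_of_le h.1 (h2.trans (mul_le_mul_of_nonneg_right
    (zpow_le_zpow_right₀ hq1 (by omega)) (norm_nonneg _))), sub_mem_fracIdeal h.2 ?_⟩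
  rw [mem_fracIdeal, neg_neg]
  refine h2.trans ?_
  have h3 : ‖v‖ ≤ max 1 ((resCard F : ℝ) ^ r) := by
    have : v = 1 - (1 - v) := by ring
    rw [this]
    refine norm_sub_le_of_le (by rw [norm_one]; exact le_max_left _ _) (le_trans ?_ (le_max_right _ _))
    have := h.2
    rwa [mem_fracIdeal, neg_neg] at this
  rcases le_max_iff.1 h3 with h4 | h4
  · calc _ ≤ (resCard F : ℝ) ^ (1 - c : ℤ) * 1 := mul_le_mul_of_nonneg_left h4 (zpow_pos hq _).le
      _ ≤ _ := by rw [mul_one]; exact zpow_le_zpow_right₀ hq1 (by omega)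
  · calc _ ≤ 1 * ‖v‖ := mul_le_mul_of_nonneg_right
          (by rw [← zpow_zero (resCard F : ℝ)]; exact zpow_le_zpow_right₀ hq1 (by omega))
          (norm_nonneg _)
      _ ≤ _ := by rw [one_mul]; exact h4

include hdx in
theorem integral_ratioFun (hϖ : IsNormalizedUniformizer ϖ) (hμ₁ : HasConductor μ₁ 0) (hc : 1 ≤ c)
    (hμ₂ : HasConductor μ₂ c) {k : ℤ} (hk : 1 ≤ k) (r : ℤ) :
    ∫ v, ratioFun μ₁ μ₂ c k r v ∂dx = if r ≤ -c then (((resCard F : ℝ) ^ r : ℝ) : ℂ) else 0 := by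
  have hq := resCard_pos hϖ
  split_ifs with hr
  · have h1 : ∀ v : F, ratioFun μ₁ μ₂ c k r v =
        (fracIdeal F (-r)).indicator (fun _ => (1 : ℂ)) (1 - v) := fun v => by
      by_cases hv : 1 - v ∈ fracIdeal F (-r)
      · have hv' : v - 1 ∈ fracIdeal F c := by
          rw [← neg_mem_fracIdeal, neg_sub]; exact fracIdeal_anti hϖ (by omega) hv
        have hv1 : ‖v‖ = 1 := norm_eq_one_of_sub_one_mem hϖ (by omega) hv'
        have hv0 : v ≠ 0 := norm_ne_zero_iff.1 (by rw [hv1]; exact one_ne_zero)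
        have hμ1 : charExt μ₁ v = 1 := by
          rw [hμ₁.charExt_eq hϖ (n := 0) (by rw [hv1, zpow_zero])]; simp
        rw [ratioFun, if_pos, hμ1, hμ₂.charExt_eq_one hc hv0 hv', hv1]
        · simp [hv]
        · refine ⟨?_, hv⟩
          rw [hv1, mul_one]
          refine le_trans hv (zpow_le_zpow_right₀ (one_lt_resCard hϖ).le (by omega))
      · rw [ratioFun, if_neg (fun h => hv h.2), Set.indicator_of_notMem hv]
    simp_rw [h1]
    rw [integral_sub_left_eq_self (fun v => (fracIdeal F (-r)).indicator (fun _ => (1 : ℂ)) v) dx 1,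
      integral_indicator (measurableSet_fracIdeal _)]
    simp [measureReal_fracIdeal dx hdx hϖ]
  · obtain ⟨u, hu, hu1, hne⟩ := exists_ne_one_of_hasConductor hϖ hc hμ₂
    have hiu : ‖((u⁻¹ : Fˣ) : F)‖ = 1 := by rw [Units.val_inv_eq_inv_val, norm_inv, hu, inv_one]
    have hiu1 : ((u⁻¹ : Fˣ) : F) - 1 ∈ fracIdeal F (c - 1) := by
      have : ((u⁻¹ : Fˣ) : F) - 1 = -(((u⁻¹ : Fˣ) : F) * (u - 1)) := by
        rw [mul_sub, Units.inv_mul]; ring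
      rw [this, neg_mem_fracIdeal]
      exact mul_mem_fracIdeal_of_le hϖ (mem_fracIdeal_zero.2 hiu.le) hu1 (by omega)
    have h2 : ∀ v : F, ratioFun μ₁ μ₂ c k r (u * v) = (μ₂ u : ℂ) * ratioFun μ₁ μ₂ c k r v := by
      intro v
      have h3 : (‖1 - v‖ ≤ (resCard F : ℝ) ^ (k - c) * ‖v‖ ∧ 1 - v ∈ fracIdeal F (-r)) ↔
          (‖1 - u * v‖ ≤ (resCard F : ℝ) ^ (k - c) * ‖u * v‖ ∧ 1 - u * v ∈ fracIdeal F (-r)) := by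
        refine ⟨ratio_cond_mul hϖ hk hc (by omega) hu hu1, fun h => ?_⟩
        have := ratio_cond_mul hϖ hk hc (by omega) hiu hiu1 h
        rwa [Units.inv_mul_cancel_left] at this
      rw [ratioFun, ratioFun]
      by_cases h4 : ‖1 - v‖ ≤ (resCard F : ℝ) ^ (k - c) * ‖v‖ ∧ 1 - v ∈ fracIdeal F (-r)
      · rw [if_pos h4, if_pos (h3.1 h4), charExt_mul, charExt_mul, charExt_units, charExt_units,
          hμ₁.eq_one_of_norm_eq_one hu, norm_mul, hu, one_mul, Units.val_one, one_mul]
        ring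
      · rw [if_neg h4, if_neg (fun h => h4 (h3.2 h)), mul_zero]
    have h5 := integral_comp_mul_left dx hdx hϖ u.ne_zero (ratioFun μ₁ μ₂ c k r)
    simp_rw [h2] at h5
    rw [integral_const_mul, hu, inv_one, Complex.ofReal_one, one_mul] at h5
    have h6 : ((μ₂ u : ℂ) - 1) * ∫ v, ratioFun μ₁ μ₂ c k r v ∂dx = 0 := by
      rw [sub_mul, h5, one_mul, sub_self]
    refine (mul_eq_zero.1 h6).resolve_left ?_
    rw [sub_eq_zero]
    exact fun h => hne (Units.ext h)

end RamifiedIntegral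

section SphereIntegral

variable {F : Type*} [NontriviallyNormedField F] [IsUltrametricDist F] [LocallyCompactSpace F]
  [MeasurableSpace F] [BorelSpace F] [SecondCountableTopology F] {ϖ : Fˣ} (dx : Measure F)
  [dx.IsAddHaarMeasure] (hdx : dx (fracIdeal F 0) = 1)
  {μ₁ μ₂ μ₃ : Fˣ →ₜ* ℂˣ} {c : ℕ} {ψ : AddChar F Circle}

theorem ne_zero_of_norm_eq_zpow (hϖ : IsNormalizedUniformizer ϖ) {x : F} {n : ℤ}
    (h : ‖x‖ = (resCard F : ℝ) ^ n) : x ≠ 0 :=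
  norm_ne_zero_iff.1 (by rw [h]; exact (zpow_pos (resCard_pos hϖ) _).ne')

theorem zpow_mul_le_iff (hϖ : IsNormalizedUniformizer ϖ) {n m : ℤ} {r : ℝ} :
    (resCard F : ℝ) ^ n * r ≤ (resCard F : ℝ) ^ m ↔ r ≤ (resCard F : ℝ) ^ (m - n) := by
  have hq := resCard_pos hϖ
  rw [zpow_sub₀ hq.ne', le_div_iff₀ (zpow_pos hq _), mul_comm]

/-- The new form on the big cell in the coordinate `v = (z - x y) / z`. -/
theorem indicator_bigCell_ratio (D : IsNewFormDatum ϖ μ₁ μ₂ μ₃ c) {x z : F} {k n : ℤ} (K : ℤ)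
    (hx : ‖x‖ = (resCard F : ℝ) ^ k) (hz : ‖z‖ = (resCard F : ℝ) ^ n) (hk : 1 ≤ k)
    (hn : c + k ≤ n) (v : F) :
    (fracIdeal F (-K)).indicator (fun y => bigCell μ₁ μ₂ μ₃ c x y z) (z / x * (1 - v)) =
      (μ₁ ϖ : ℂ) ^ (2 * n) * (resCard F : ℂ) ^ (-2 * n) * ratioFun μ₁ μ₂ c k (K + k - n) v := by
  have hϖ := D.unif
  have hq := resCard_pos hϖ
  have hq1 := one_lt_resCard hϖ
  have hx0 := ne_zero_of_norm_eq_zpow hϖ hx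
  have hz0 := ne_zero_of_norm_eq_zpow hϖ hz
  have hzx : ‖z / x‖ = (resCard F : ℝ) ^ (n - k) := by
    rw [norm_div, hx, hz, zpow_sub₀ hq.ne']
  have h1 : z / x * (1 - v) ∈ fracIdeal F (-K) ↔ 1 - v ∈ fracIdeal F (-(K + k - n)) := by
    rw [mem_fracIdeal, mem_fracIdeal, norm_mul, hzx, zpow_mul_le_iff hϖ]
    congr! 2; ring
  have h2 : z - x * (z / x * (1 - v)) = z * v := by field_simp; ring
  have h3 : (‖x‖ ≤ (resCard F : ℝ) ^ (-c : ℤ) * ‖z‖ ∧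
      ‖z / x * (1 - v)‖ ≤ (resCard F : ℝ) ^ (-c : ℤ) * ‖z * v‖) ↔
      ‖1 - v‖ ≤ (resCard F : ℝ) ^ (k - c) * ‖v‖ := by
    rw [hx, hz, ← zpow_add₀ hq.ne', and_iff_right (zpow_le_zpow_right₀ hq1.le (by omega)),
      norm_mul, norm_mul, hzx, hz, ← mul_assoc, ← zpow_add₀ hq.ne',
      show (-c + n : ℤ) = (n - k) + (k - c) by ring, zpow_add₀ hq.ne', mul_assoc,
      mul_le_mul_iff_right₀ (zpow_pos hq _)]
  by_cases h4 : 1 - v ∈ fracIdeal F (-(K + k - n))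
  · rw [Set.indicator_of_mem (h1.2 h4), bigCell_eq_of_ge hϖ D.unr₁ D.unr₃ D.mul_eq_one D.one_le D.ram
      (by rw [hz]; exact zpow_le_zpow_right₀ hq1.le (by omega)), h2, ratioFun]
    by_cases h5 : ‖1 - v‖ ≤ (resCard F : ℝ) ^ (k - c) * ‖v‖
    · rw [if_pos (h3.2 h5), if_pos ⟨h5, h4⟩, mul_div_cancel_left₀ _ hz0, mul_inv, charExt_mul,
        charExt_inv, charExt_inv, D.unr₁.charExt_eq hϖ hz, norm_mul, hz]
      rw [zpow_neg, inv_inv, mul_comm 2 n, zpow_mul, show -2 * n = n * (-2) by ring, zpow_mul]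
      push_cast
      rw [show (-2 : ℤ) = -((2 : ℕ) : ℤ) by norm_num, zpow_neg, zpow_natCast,
        show (2 : ℤ) = ((2 : ℕ) : ℤ) by norm_num, zpow_natCast]
      ring
    · rw [if_neg (fun h => h5 (h3.1 h)), if_neg (fun h => h5 h.1), mul_zero]
  · rw [Set.indicator_of_notMem (fun h => h4 (h1.1 h)), ratioFun, if_neg (fun h => h4 h.2), mul_zero]

theorem IsNewFormDatum.continuous_bigCell_comp {X : Type*} [TopologicalSpace X]
    (D : IsNewFormDatum ϖ μ₁ μ₂ μ₃ c) {f g h : X → F} (hf : Continuous f) (hg : Continuous g)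
    (hh : Continuous h) : Continuous fun v => bigCell μ₁ μ₂ μ₃ c (f v) (g v) (h v) := by
  have := (continuous_bigCell D.unif D.unr₁ D.unr₃ D.one_le D.ram).comp (hf.prodMk (hg.prodMk hh))
  exact this

theorem integrable_ratioFun (D : IsNewFormDatum ϖ μ₁ μ₂ μ₃ c) {k : ℤ} (hk : 1 ≤ k) (r : ℤ) :
    Integrable (ratioFun μ₁ μ₂ c k r) dx := by
  have hϖ := D.unif
  have hq := resCard_pos hϖ
  obtain ⟨n, hn⟩ : ∃ n : ℤ, c + k ≤ n := ⟨_, le_rfl⟩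
  obtain ⟨x, hx⟩ : ∃ x : F, ‖x‖ = (resCard F : ℝ) ^ k :=
    ⟨_, by rw [norm_uniformizer_zpow hϖ (-k), neg_neg]⟩
  obtain ⟨z, hz⟩ : ∃ z : F, ‖z‖ = (resCard F : ℝ) ^ n :=
    ⟨_, by rw [norm_uniformizer_zpow hϖ (-n), neg_neg]⟩
  obtain ⟨C, hC⟩ : ∃ C, C = (μ₁ ϖ : ℂ) ^ (2 * n) * (resCard F : ℂ) ^ (-2 * n) := ⟨_, rfl⟩
  have hC0 : C ≠ 0 := by
    rw [hC]
    have hqC : (resCard F : ℂ) ≠ 0 := by exact_mod_cast hq.ne'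
    exact mul_ne_zero (zpow_ne_zero _ (μ₁ ϖ).ne_zero) (zpow_ne_zero _ hqC)
  have h1 : ratioFun μ₁ μ₂ c k r = fun v => C⁻¹ *
      ((fracIdeal F (-(r - k + n))).indicator (fun y => bigCell μ₁ μ₂ μ₃ c x y z)
        (z / x * (1 - v))) := by
    funext v
    rw [indicator_bigCell_ratio D (r - k + n) hx hz hk hn, ← hC, inv_mul_cancel_left₀ hC0]
    congr 1; ring
  have hcont : Continuous fun v : F => bigCell μ₁ μ₂ μ₃ c x (z / x * (1 - v)) z :=
    D.continuous_bigCell_comp continuous_const (by fun_prop) continuous_const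
  set S : Set F := (fun v => z / x * (1 - v)) ⁻¹' fracIdeal F (-(r - k + n)) with hS
  have hSm : MeasurableSet S := by
    have : Continuous fun v : F => z / x * (1 - v) := by fun_prop
    exact this.measurable (measurableSet_fracIdeal _)
  have hj : S ⊆ fracIdeal F (min 0 (-r)) := by
    intro v hv
    have hv' : z / x * (1 - v) ∈ fracIdeal F (-(r - k + n)) := hv
    have h2 : 1 - v ∈ fracIdeal F (-r) := by
      rw [mem_fracIdeal, norm_mul, norm_div, hx, hz, ← zpow_sub₀ hq.ne', zpow_mul_le_iff hϖ] at hv'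
      rw [mem_fracIdeal]
      convert hv' using 2; ring
    have : v = 1 - (1 - v) := by ring
    rw [this]
    exact sub_mem_fracIdeal (fracIdeal_anti hϖ (min_le_left _ _) one_mem_fracIdeal_zero)
      (fracIdeal_anti hϖ (min_le_right _ _) h2)
  have h3 : (fun v => (fracIdeal F (-(r - k + n))).indicator
      (fun y => bigCell μ₁ μ₂ μ₃ c x y z) (z / x * (1 - v))) =
      S.indicator (fun v => bigCell μ₁ μ₂ μ₃ c x (z / x * (1 - v)) z) := by
    funext v
    rfl
  have h4 : Integrable (S.indicator (fun v => bigCell μ₁ μ₂ μ₃ c x (z / x * (1 - v)) z)) dx := by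
    rw [integrable_indicator_iff hSm]
    exact (hcont.continuousOn.integrableOn_compact (isCompact_fracIdeal _)).mono_set hj
  rw [h1]
  rw [← h3] at h4
  exact h4.const_mul _

include hdx

theorem setIntegral_bigCell_ratio (D : IsNewFormDatum ϖ μ₁ μ₂ μ₃ c) {x z : F} {k n : ℤ} (K : ℤ)
    (hx : ‖x‖ = (resCard F : ℝ) ^ k) (hz : ‖z‖ = (resCard F : ℝ) ^ n) (hk : 1 ≤ k)
    (hn : c + k ≤ n) (b : F) :
    ∫ y in fracIdeal F (-K), bigCell μ₁ μ₂ μ₃ c x y z * (ψ (b * y) : ℂ) ∂dx =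
      (μ₁ ϖ : ℂ) ^ (2 * n) * (resCard F : ℂ) ^ (-n - k) *
        ∫ v, ratioFun μ₁ μ₂ c k (K + k - n) v * (ψ (b * (1 - v) / x * z) : ℂ) ∂dx := by
  have hϖ := D.unif
  have hq := resCard_pos hϖ
  have hx0 := ne_zero_of_norm_eq_zpow hϖ hx
  have hz0 := ne_zero_of_norm_eq_zpow hϖ hz
  have hqC : (resCard F : ℂ) ≠ 0 := by exact_mod_cast hq.ne'
  set g : F → ℂ := (fracIdeal F (-K)).indicator
    (fun y => bigCell μ₁ μ₂ μ₃ c x y z * (ψ (b * y) : ℂ)) with hg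
  have h1 : ∀ v, g (z / x * (1 - v)) = (μ₁ ϖ : ℂ) ^ (2 * n) * (resCard F : ℂ) ^ (-2 * n) *
      (ratioFun μ₁ μ₂ c k (K + k - n) v * (ψ (b * (1 - v) / x * z) : ℂ)) := by
    intro v
    rw [← mul_assoc, ← indicator_bigCell_ratio D K hx hz hk hn v, hg]
    have : b * (1 - v) / x * z = b * (z / x * (1 - v)) := by ring
    rw [this]
    by_cases h : z / x * (1 - v) ∈ fracIdeal F (-K)
    · simp only [Set.indicator_of_mem h]
    · simp only [Set.indicator_of_notMem h, zero_mul]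
  have h2 : ∫ v, g (z / x * (1 - v)) ∂dx = ((‖z / x‖⁻¹ : ℝ) : ℂ) * ∫ y, g y ∂dx := by
    rw [integral_sub_left_eq_self (fun v => g (z / x * v)) dx 1,
      integral_comp_mul_left dx hdx hϖ (div_ne_zero hz0 hx0)]
  simp_rw [h1] at h2
  rw [integral_const_mul, norm_div, hx, hz, hg, integral_indicator (measurableSet_fracIdeal _),
    ← zpow_sub₀ hq.ne', ← zpow_neg, Complex.ofReal_zpow, Complex.ofReal_natCast] at h2
  have h3 : (resCard F : ℂ) ^ (n - k) * (resCard F : ℂ) ^ (-(n - k)) = 1 := by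
    rw [← zpow_add₀ hqC, add_neg_cancel, zpow_zero]
  have h4 : (resCard F : ℂ) ^ (n - k) * (resCard F : ℂ) ^ (-2 * n) = (resCard F : ℂ) ^ (-n - k) := by
    rw [← zpow_add₀ hqC]; congr 1; ring
  calc _ = (resCard F : ℂ) ^ (n - k) * ((resCard F : ℂ) ^ (-(n - k)) *
        ∫ y in fracIdeal F (-K), bigCell μ₁ μ₂ μ₃ c x y z * (ψ (b * y) : ℂ) ∂dx) := by
        rw [← mul_assoc, h3, one_mul]
    _ = _ := by rw [← h2, ← h4]; ring

theorem setIntegral_sphereZ_bigCell (D : IsNewFormDatum ϖ μ₁ μ₂ μ₃ c) (hψ : IsUnramifiedAddChar ψ)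
    {x b : F} {k n K m : ℤ} (hx : ‖x‖ = (resCard F : ℝ) ^ k) (hk : 1 ≤ k)
    (hn : c + k ≤ n) (hb : ‖b‖ = (resCard F : ℝ) ^ (-m)) (hK : m + 1 ≤ K) :
    ∫ z in sphereZ F n, ∫ y in fracIdeal F (-K), bigCell μ₁ μ₂ μ₃ c x y z * (ψ (b * y) : ℂ) ∂dx ∂dx =
      if n = c + k + m then (μ₁ ϖ : ℂ) ^ (2 * n) * (resCard F : ℂ) ^ (-k - c) else 0 := by
  have hϖ := D.unif
  have hq := resCard_pos hϖ
  have hqC : (resCard F : ℂ) ≠ 0 := by exact_mod_cast hq.ne'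
  have hx0 := ne_zero_of_norm_eq_zpow hϖ hx
  have h1 : ∀ z ∈ sphereZ F n,
      ∫ y in fracIdeal F (-K), bigCell μ₁ μ₂ μ₃ c x y z * (ψ (b * y) : ℂ) ∂dx =
      (μ₁ ϖ : ℂ) ^ (2 * n) * (resCard F : ℂ) ^ (-n - k) *
        ∫ v, ratioFun μ₁ μ₂ c k (K + k - n) v * (ψ (b * (1 - v) / x * z) : ℂ) ∂dx :=
    fun z hz => setIntegral_bigCell_ratio dx hdx D K hx hz hk hn b
  rw [setIntegral_congr_fun (measurableSet_sphereZ n) h1, integral_const_mul]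
  have hint : Integrable (Function.uncurry fun z v =>
      ratioFun μ₁ μ₂ c k (K + k - n) v * (ψ (b * (1 - v) / x * z) : ℂ))
      ((dx.restrict (sphereZ F n)).prod dx) := by
    have hs : Integrable (fun _ : F => (1 : ℂ)) (dx.restrict (sphereZ F n)) := by
      have : IntegrableOn (fun _ : F => (1 : ℂ)) (fracIdeal F (-n)) dx :=
        continuous_const.continuousOn.integrableOn_compact (isCompact_fracIdeal _)
      refine this.mono_set ?_
      rw [sphereZ_eq_diff hϖ]; exact Set.sdiff_subset
    have h2 := hs.mul_prod (integrable_ratioFun dx D hk (K + k - n))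
    have hc : Continuous fun p : F × F => (ψ (b * (1 - p.2) / x * p.1) : ℂ) :=
      continuous_subtype_val.comp (hψ.1.comp (by fun_prop))
    have h3 := h2.bdd_mul (c := 1) hc.aestronglyMeasurable
      (Eventually.of_forall fun p => (norm_addChar (F := F) _).le)
    refine h3.congr (Eventually.of_forall fun p => ?_)
    simp only [Function.uncurry, one_mul]
    rw [mul_comm]
  rw [integral_integral_swap hint]
  have h3 : ∀ v, ∫ z in sphereZ F n,
      ratioFun μ₁ μ₂ c k (K + k - n) v * (ψ (b * (1 - v) / x * z) : ℂ) ∂dx =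
      (resCard F : ℂ) ^ n * ratioFun μ₁ μ₂ c k (m + k - n) v -
        (resCard F : ℂ) ^ (n - 1) * ratioFun μ₁ μ₂ c k (m + k - n + 1) v := by
    intro v
    rw [integral_const_mul, setIntegral_addChar_sphereZ dx hdx hϖ hψ]
    have hnorm : ‖b * (1 - v) / x‖ = (resCard F : ℝ) ^ (-m - k) * ‖1 - v‖ := by
      rw [norm_div, norm_mul, hb, hx, zpow_sub₀ hq.ne']; ring
    have hiff : ∀ j : ℤ, ‖b * (1 - v) / x‖ ≤ (resCard F : ℝ) ^ j ↔
        1 - v ∈ fracIdeal F (-(m + k + j)) := fun j => by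
      rw [hnorm, zpow_mul_le_iff hϖ, mem_fracIdeal]; congr! 2; ring
    have hmul : ∀ j : ℤ, m + k + j ≤ K + k - n →
        ∀ w : ℂ, ratioFun μ₁ μ₂ c k (K + k - n) v * (if ‖b * (1 - v) / x‖ ≤ (resCard F : ℝ) ^ j
          then w else 0) = w * ratioFun μ₁ μ₂ c k (m + k + j) v := fun j hj w => by
      by_cases h5 : 1 - v ∈ fracIdeal F (-(m + k + j))
      · rw [if_pos ((hiff j).2 h5), mul_comm, ratioFun, ratioFun]
        have h6 : 1 - v ∈ fracIdeal F (-(K + k - n)) := fracIdeal_anti hϖ (by omega) h5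
        simp only [h5, h6, and_true]
      · rw [if_neg (fun h => h5 ((hiff j).1 h)), mul_zero]
        rw [ratioFun, if_neg (fun h => h5 h.2), mul_zero]
    rw [mul_sub, hmul _ (by omega), hmul _ (by omega), Complex.ofReal_zpow, Complex.ofReal_zpow,
      Complex.ofReal_natCast, show m + k + -n = m + k - n by ring,
      show m + k + (-n + 1) = m + k - n + 1 by ring]
  simp_rw [h3]
  rw [integral_sub ((integrable_ratioFun dx D hk _).const_mul _)
    ((integrable_ratioFun dx D hk _).const_mul _), integral_const_mul, integral_const_mul,
    integral_ratioFun dx hdx hϖ D.unr₁ D.one_le D.ram hk,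
    integral_ratioFun dx hdx hϖ D.unr₁ D.one_le D.ram hk, Complex.ofReal_zpow, Complex.ofReal_zpow,
    Complex.ofReal_natCast]
  rcases lt_trichotomy n (c + k + m) with h | h | h
  · rw [if_neg (by omega), if_neg (by omega), if_neg (by omega)]; ring
  · rw [if_pos (by omega), if_neg (by omega), if_pos h, mul_zero, sub_zero, mul_assoc,
      ← zpow_add₀ hqC, ← zpow_add₀ hqC]
    congr 2; rw [h]; ring
  · rw [if_pos (by omega), if_pos (by omega), if_neg (by omega), ← zpow_add₀ hqC, ← zpow_add₀ hqC,
      show n - 1 + (m + k - n + 1) = n + (m + k - n) by ring, sub_self, mul_zero]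

end SphereIntegral

theorem sum_Ioc_add_natCast (g : ℤ → ℂ) (N : ℤ) (m : ℕ) :
    ∑ n ∈ Finset.Ioc N (N + m), g n = ∑ j ∈ Finset.range m, g (N + 1 + j) := by
  induction m with
  | zero => simp
  | succ m ih =>
    have h1 : Finset.Ioc N (N + (m + 1 : ℕ)) = insert (N + m + 1) (Finset.Ioc N (N + m)) := by
      ext; simp only [Finset.mem_Ioc, Finset.mem_insert]; omega
    rw [h1, Finset.sum_insert (by simp), ih, Finset.sum_range_succ, add_comm, add_right_comm]

section JacquetIntegral

variable {F : Type*} [NontriviallyNormedField F] [IsUltrametricDist F] [LocallyCompactSpace F]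
  [MeasurableSpace F] [BorelSpace F] [SecondCountableTopology F] {ϖ : Fˣ} (dx : Measure F)
  [dx.IsAddHaarMeasure] (hdx : dx (fracIdeal F 0) = 1)
  {μ₁ μ₂ μ₃ : Fˣ →ₜ* ℂˣ} {c : ℕ} {ψ : AddChar F Circle}

theorem integrable_bigCell_pair (D : IsNewFormDatum ϖ μ₁ μ₂ μ₃ c) (hψ : IsUnramifiedAddChar ψ)
    (b x : F) (K L : ℤ) :
    Integrable (Function.uncurry fun z y => bigCell μ₁ μ₂ μ₃ c x y z * (ψ (b * y) : ℂ))
      ((dx.restrict (fracIdeal F (-L))).prod (dx.restrict (fracIdeal F (-K)))) := by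
  rw [Measure.prod_restrict]
  have h1 : Continuous fun p : F × F => bigCell μ₁ μ₂ μ₃ c x p.2 p.1 :=
    D.continuous_bigCell_comp continuous_const continuous_snd continuous_fst
  have h2 : Continuous fun p : F × F => (ψ (b * p.2) : ℂ) :=
    (continuous_addChar_mul hψ b).comp continuous_snd
  exact (h1.mul h2).continuousOn.integrableOn_compact
    ((isCompact_fracIdeal _).prod (isCompact_fracIdeal _))

theorem integrableOn_integral_bigCell (D : IsNewFormDatum ϖ μ₁ μ₂ μ₃ c) (hψ : IsUnramifiedAddChar ψ)
    (b x : F) (K L : ℤ) :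
    IntegrableOn (fun z => ∫ y in fracIdeal F (-K), bigCell μ₁ μ₂ μ₃ c x y z * (ψ (b * y) : ℂ) ∂dx)
      (fracIdeal F (-L)) dx :=
  (integrable_bigCell_pair dx D hψ b x K L).integral_prod_left

include hdx

theorem integral_bigCell_of_norm_eq (D : IsNewFormDatum ϖ μ₁ μ₂ μ₃ c) (hψ : IsUnramifiedAddChar ψ)
    {x b : F} {k K L m : ℤ} (hx : ‖x‖ = (resCard F : ℝ) ^ k) (hk : 1 ≤ k) (hm : 0 ≤ m)
    (hb : ‖b‖ = (resCard F : ℝ) ^ (-m)) (hK : m + 1 ≤ K) :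
    ∫ z in fracIdeal F (-L), ∫ y in fracIdeal F (-K),
      bigCell μ₁ μ₂ μ₃ c x y z * (ψ (b * y) : ℂ) ∂dx ∂dx =
      if c + k + m ≤ L then (μ₁ ϖ : ℂ) ^ (2 * (c + k + m)) * (resCard F : ℂ) ^ (-k - c) else 0 := by
  have hϖ := D.unif
  have hq := resCard_pos hϖ
  have hq1 := one_lt_resCard hϖ
  have h0 : ∀ z ∈ fracIdeal F (-(c + k - 1)), ∫ y in fracIdeal F (-K),
      bigCell μ₁ μ₂ μ₃ c x y z * (ψ (b * y) : ℂ) ∂dx = 0 := by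
    intro z hz
    have : ∀ y, bigCell μ₁ μ₂ μ₃ c x y z = 0 := fun y => by
      by_contra hne
      have h1 := (norm_le_of_bigCell_ne_zero hϖ D.one_le hne).1
      rw [mem_fracIdeal, neg_neg] at hz
      have h2 : max ((resCard F : ℝ) ^ (c : ℤ)) ‖z‖ ≤ (resCard F : ℝ) ^ (c + k - 1 : ℤ) :=
        max_le (zpow_le_zpow_right₀ hq1.le (by omega)) hz
      have h3 := h1.trans (mul_le_mul_of_nonneg_left h2 (zpow_pos hq _).le)
      rw [hx, ← zpow_add₀ hq.ne', zpow_le_zpow_iff_right₀ hq1] at h3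
      omega
    simp [this]
  rcases lt_or_ge L (c + k - 1) with hL | hL
  · rw [if_neg (by omega), setIntegral_congr_fun (measurableSet_fracIdeal _)
      (fun z hz => h0 z (fracIdeal_anti hϖ (by omega) hz)), integral_zero]
  · rw [setIntegral_fracIdeal_eq_add_sum dx hϖ hL (integrableOn_integral_bigCell dx D hψ b x K L),
      setIntegral_congr_fun (measurableSet_fracIdeal _) h0, integral_zero, zero_add,
      Finset.sum_congr rfl fun n hn => setIntegral_sphereZ_bigCell dx hdx D hψ hx hk
        (by have := (Finset.mem_Ioc.1 hn).1; omega) hb hK, Finset.sum_ite_eq']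
    refine if_congr ?_ rfl rfl
    rw [Finset.mem_Ioc]; omega

theorem integral_bigCell_of_mem (D : IsNewFormDatum ϖ μ₁ μ₂ μ₃ c) (hψ : IsUnramifiedAddChar ψ)
    {x b : F} {K L m : ℤ} (hx : x ∈ fracIdeal F 0) (hm : 0 ≤ m)
    (hb : ‖b‖ = (resCard F : ℝ) ^ (-m)) (hK : m + 1 ≤ K) (hL : c + m ≤ L) :
    ∫ z in fracIdeal F (-L), ∫ y in fracIdeal F (-K),
      bigCell μ₁ μ₂ μ₃ c x y z * (ψ (b * y) : ℂ) ∂dx ∂dx =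
      (resCard F : ℂ) ^ (-c : ℤ) * ((μ₁ ϖ : ℂ) ^ (2 * (c : ℤ)) +
        (1 - (resCard F : ℂ)⁻¹) * ∑ n ∈ Finset.Ioc (c : ℤ) (c + m), (μ₁ ϖ : ℂ) ^ (2 * n)) := by
  have hϖ := D.unif
  have hq := resCard_pos hϖ
  have hq1 := one_lt_resCard hϖ
  have hqC : (resCard F : ℂ) ≠ 0 := by exact_mod_cast hq.ne'
  have hx1 : ‖x‖ ≤ 1 := mem_fracIdeal_zero.1 hx
  have hind : ∀ j : ℤ, ∀ w : ℂ, ∫ y in fracIdeal F (-K),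
      (fracIdeal F (-j)).indicator (fun y => w * (ψ (b * y) : ℂ)) y ∂dx =
      if j ≤ m then w * (resCard F : ℂ) ^ j else 0 := by
    intro j w
    rw [setIntegral_indicator (measurableSet_fracIdeal _)]
    have h1 : fracIdeal F (-K) ∩ fracIdeal F (-j) = fracIdeal F (-(min K j)) := by
      rcases le_total K j with h | h
      · rw [min_eq_left h]; exact Set.inter_eq_left.2 (fracIdeal_anti hϖ (by omega))
      · rw [min_eq_right h]; exact Set.inter_eq_right.2 (fracIdeal_anti hϖ (by omega))
    rw [h1, integral_const_mul, setIntegral_addChar_fracIdeal dx hdx hϖ hψ, hb]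
    simp only [zpow_le_zpow_iff_right₀ hq1]
    by_cases h : j ≤ m
    · rw [if_pos h, if_pos (by omega), min_eq_right (by omega), neg_neg, Complex.ofReal_zpow,
        Complex.ofReal_natCast]
    · rw [if_neg h, if_neg (by omega), mul_zero]
  have hin : ∀ z ∈ fracIdeal F (-c), ∫ y in fracIdeal F (-K),
      bigCell μ₁ μ₂ μ₃ c x y z * (ψ (b * y) : ℂ) ∂dx =
        (μ₁ ϖ : ℂ) ^ (2 * c) * ((resCard F : ℂ) ^ (2 * c))⁻¹ := by
    intro z hz
    have h := hind 0 ((μ₁ ϖ : ℂ) ^ (2 * c) * ((resCard F : ℂ) ^ (2 * c))⁻¹)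
    rw [if_pos hm, zpow_zero, mul_one] at h
    rw [← h]
    congr 1
    funext y
    rw [bigCell_eq_of_le hϖ D.unr₁ D.unr₃ D.mul_eq_one D.one_le D.ram hz, neg_zero]
    by_cases hy : y ∈ fracIdeal F 0
    · rw [if_pos ⟨hx, hy⟩, Set.indicator_of_mem hy]
    · rw [if_neg fun h => hy h.2, Set.indicator_of_notMem hy, zero_mul]
  have hout : ∀ n ∈ Finset.Ioc (c : ℤ) L, ∫ z in sphereZ F n, ∫ y in fracIdeal F (-K),
      bigCell μ₁ μ₂ μ₃ c x y z * (ψ (b * y) : ℂ) ∂dx ∂dx =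
        if n ≤ c + m then (resCard F : ℂ) ^ (-c : ℤ) * (1 - (resCard F : ℂ)⁻¹) *
          (μ₁ ϖ : ℂ) ^ (2 * n) else 0 := by
    intro n hn
    have hn := (Finset.mem_Ioc.1 hn).1
    have h1 : ∀ z ∈ sphereZ F n, ∫ y in fracIdeal F (-K),
        bigCell μ₁ μ₂ μ₃ c x y z * (ψ (b * y) : ℂ) ∂dx =
        if n - c ≤ m then (μ₁ ϖ : ℂ) ^ (2 * n) * (resCard F : ℂ) ^ (-2 * n) *
          (resCard F : ℂ) ^ (n - c) else 0 := by
      intro z hz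
      have hz' : ‖z‖ = (resCard F : ℝ) ^ n := hz
      have hz0 := ne_zero_of_norm_eq_zpow hϖ hz'
      rw [← hind]
      congr 1
      funext y
      rw [bigCell_eq_of_ge hϖ D.unr₁ D.unr₃ D.mul_eq_one D.one_le D.ram
        (by rw [hz']; exact zpow_le_zpow_right₀ hq1.le hn.le)]
      have hxz : ‖x‖ ≤ (resCard F : ℝ) ^ (-c : ℤ) * ‖z‖ := by
        rw [hz', ← zpow_add₀ hq.ne']
        exact hx1.trans (one_le_zpow₀ hq1.le (by omega))
      have hlt : (resCard F : ℝ) ^ (-c : ℤ) < 1 :=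
        zpow_lt_one_of_neg₀ hq1 (by have := D.one_le; omega)
      have hcond : ∀ w : F, ‖w‖ = ‖z‖ → (‖y‖ ≤ (resCard F : ℝ) ^ (-c : ℤ) * ‖w‖ ↔
          y ∈ fracIdeal F (-(n - c))) := fun w hw => by
        rw [hw, hz', ← zpow_add₀ hq.ne', mem_fracIdeal]
        congr! 2; ring
      have hxy : ‖x * y‖ ≤ ‖y‖ := by
        rw [norm_mul]; exact mul_le_of_le_one_left (norm_nonneg _) hx1
      by_cases hy : y ∈ fracIdeal F (-(n - c))
      · have hyz := (hcond z rfl).2 hy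
        have hlt' : ‖x * y‖ < ‖z‖ :=
          (hxy.trans hyz).trans_lt (mul_lt_of_lt_one_left (norm_pos_iff.2 hz0) hlt)
        have hw := norm_sub_eq_left hlt'
        have hw0 : z - x * y ≠ 0 := norm_ne_zero_iff.1 (by rw [hw]; exact norm_ne_zero_iff.2 hz0)
        have hone : charExt μ₂ ((z - x * y) / z) = 1 := by
          refine D.ram.charExt_eq_one D.one_le (div_ne_zero hw0 hz0) ?_
          have : (z - x * y) / z - 1 = -(x * y / z) := by field_simp; ring
          rw [this, neg_mem_fracIdeal, mem_fracIdeal, norm_div,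
            div_le_iff₀ (norm_pos_iff.2 hz0)]
          exact hxy.trans hyz
        rw [if_pos ⟨hxz, (hcond _ hw).2 hy⟩, hone, charExt_inv, charExt_inv,
          D.unr₁.charExt_eq hϖ (hw.trans hz'), D.unr₁.charExt_eq hϖ hz', hw, hz',
          Set.indicator_of_mem hy, zpow_neg, inv_inv, one_mul, two_mul,
          zpow_add₀ (μ₁ ϖ).ne_zero, show -2 * n = -n + -n by ring, zpow_add₀ hqC, ← zpow_neg]
        push_cast
        ring
      · rw [Set.indicator_of_notMem hy, if_neg, zero_mul]
        rintro ⟨-, h⟩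
        have hyw : ‖x * y‖ < ‖z - x * y‖ := by
          rcases eq_or_ne (z - x * y) 0 with h0 | h0
          · rw [h0, norm_zero, mul_zero] at h
            rw [norm_le_zero_iff.1 h] at hy
            exact absurd (zero_mem_fracIdeal _) hy
          · exact (hxy.trans h).trans_lt (mul_lt_of_lt_one_left (norm_pos_iff.2 h0) hlt)
        have := norm_add_eq_left hyw
        rw [sub_add_cancel] at this
        exact hy ((hcond _ this.symm).1 h)
    rw [setIntegral_congr_fun (measurableSet_sphereZ n) h1, setIntegral_const]
    have hvol : ((dx.real (sphereZ F n) : ℝ) : ℂ) =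
        (resCard F : ℂ) ^ n - (resCard F : ℂ) ^ (n - 1) := by
      have := setIntegral_addChar_sphereZ dx hdx hϖ hψ 0 n
      simp only [zero_mul, AddChar.map_zero_eq_one, Circle.coe_one, norm_zero] at this
      rw [if_pos (zpow_pos hq _).le, if_pos (zpow_pos hq _).le, setIntegral_const] at this
      simpa using this
    rw [Complex.real_smul, hvol]
    by_cases h : n ≤ c + m
    · rw [if_pos h, if_pos (by omega), mul_assoc ((μ₁ ϖ : ℂ) ^ (2 * n)), ← zpow_add₀ hqC,
        show -2 * n + (n - c) = -n + -c by ring, zpow_sub_one₀ hqC, zpow_add₀ hqC, zpow_neg _ n]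
      have := zpow_ne_zero n hqC
      field_simp
    · rw [if_neg h, if_neg (by omega), mul_zero]
  rw [setIntegral_fracIdeal_eq_add_sum dx hϖ (show (c : ℤ) ≤ L by omega)
    (integrableOn_integral_bigCell dx D hψ b x K L),
    setIntegral_congr_fun (measurableSet_fracIdeal _) hin, setIntegral_const,
    measureReal_fracIdeal dx hdx hϖ, Finset.sum_congr rfl hout, mul_add]
  congr 1
  · rw [neg_neg, Complex.real_smul, Complex.ofReal_zpow, Complex.ofReal_natCast, zpow_neg,
      zpow_natCast, show (2 * (c : ℤ)) = ((2 * c : ℕ) : ℤ) by push_cast; ring, zpow_natCast, two_mul,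
      pow_add (resCard F : ℂ)]
    have := pow_ne_zero c hqC
    field_simp
  · rw [← Finset.sum_filter, ← mul_assoc, Finset.mul_sum]
    refine Finset.sum_congr ?_ fun _ _ => rfl
    ext n; simp only [Finset.mem_filter, Finset.mem_Ioc]; omega

theorem integral_bigCell (D : IsNewFormDatum ϖ μ₁ μ₂ μ₃ c) (hψ : IsUnramifiedAddChar ψ)
    {b : F} {m : ℕ} {K L : ℤ} (hb : ‖b‖ = (resCard F : ℝ) ^ (-m : ℤ)) (hK : m + 1 ≤ K)
    (hL : c + 2 * m + 1 ≤ L) :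
    ∫ p in fracIdeal F (-K) ×ˢ (fracIdeal F (-K) ×ˢ fracIdeal F (-L)),
      bigCell μ₁ μ₂ μ₃ c p.1 p.2.1 p.2.2 * ((ψ (-b * p.1) : ℂ) * (ψ (b * p.2.1) : ℂ))
        ∂(dx.prod (dx.prod dx)) =
      (resCard F : ℂ) ^ (-c : ℤ) * (μ₁ ϖ : ℂ) ^ (2 * c) *
        (1 - (μ₁ ϖ : ℂ) ^ 2 * (resCard F : ℂ)⁻¹) *
        ∑ j ∈ Finset.range (2 * m + 1), ((μ₁ ϖ : ℂ) ^ 2) ^ j := by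
  have hϖ := D.unif
  have hq := resCard_pos hϖ
  have hq1 := one_lt_resCard hϖ
  have hqC : (resCard F : ℂ) ≠ 0 := by exact_mod_cast hq.ne'
  have hint : IntegrableOn (fun p : F × F × F => bigCell μ₁ μ₂ μ₃ c p.1 p.2.1 p.2.2 *
      ((ψ (-b * p.1) : ℂ) * (ψ (b * p.2.1) : ℂ)))
      (fracIdeal F (-K) ×ˢ (fracIdeal F (-K) ×ˢ fracIdeal F (-L))) (dx.prod (dx.prod dx)) := by
    have h1 : Continuous fun p : F × F × F => bigCell μ₁ μ₂ μ₃ c p.1 p.2.1 p.2.2 :=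
      continuous_bigCell D.unif D.unr₁ D.unr₃ D.one_le D.ram
    have h2 : Continuous fun p : F × F × F => (ψ (-b * p.1) : ℂ) :=
      (continuous_addChar_mul hψ _).comp continuous_fst
    have h3 : Continuous fun p : F × F × F => (ψ (b * p.2.1) : ℂ) :=
      (continuous_addChar_mul hψ _).comp (continuous_fst.comp continuous_snd)
    exact (h1.mul (h2.mul h3)).continuousOn.integrableOn_compact
      ((isCompact_fracIdeal _).prod ((isCompact_fracIdeal _).prod (isCompact_fracIdeal _)))
  have hinner : ∀ x, ∫ w in fracIdeal F (-K) ×ˢ fracIdeal F (-L),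
      bigCell μ₁ μ₂ μ₃ c x w.1 w.2 * ((ψ (-b * x) : ℂ) * (ψ (b * w.1) : ℂ)) ∂(dx.prod dx) =
      (ψ (-b * x) : ℂ) * ∫ z in fracIdeal F (-L), ∫ y in fracIdeal F (-K),
        bigCell μ₁ μ₂ μ₃ c x y z * (ψ (b * y) : ℂ) ∂dx ∂dx := by
    intro x
    have hp := integrable_bigCell_pair dx D hψ b x K L
    rw [integral_integral_swap hp, ← integral_const_mul]
    have hp' := hp.swap
    rw [Measure.prod_restrict] at hp'
    have : ∀ w : F × F, bigCell μ₁ μ₂ μ₃ c x w.1 w.2 * ((ψ (-b * x) : ℂ) * (ψ (b * w.1) : ℂ)) =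
        (ψ (-b * x) : ℂ) * (bigCell μ₁ μ₂ μ₃ c x w.1 w.2 * (ψ (b * w.1) : ℂ)) := fun w => by ring
    simp_rw [this]
    have hsw : ∫ w in fracIdeal F (-K) ×ˢ fracIdeal F (-L),
        bigCell μ₁ μ₂ μ₃ c x w.1 w.2 * (ψ (b * w.1) : ℂ) ∂(dx.prod dx) =
        ∫ y in fracIdeal F (-K), ∫ z in fracIdeal F (-L),
          bigCell μ₁ μ₂ μ₃ c x y z * (ψ (b * y) : ℂ) ∂dx ∂dx := setIntegral_prod _ hp'
    rw [integral_const_mul, hsw, integral_const_mul]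
  have hint' : IntegrableOn (fun x => (ψ (-b * x) : ℂ) * ∫ z in fracIdeal F (-L),
      ∫ y in fracIdeal F (-K), bigCell μ₁ μ₂ μ₃ c x y z * (ψ (b * y) : ℂ) ∂dx ∂dx)
      (fracIdeal F (-K)) dx := by
    have h1 := hint
    rw [IntegrableOn, ← Measure.prod_restrict] at h1
    refine h1.integral_prod_left.congr (Eventually.of_forall fun x => hinner x)
  rw [setIntegral_prod _ hint]
  simp_rw [hinner]
  rw [setIntegral_fracIdeal_eq_add_sum dx hϖ (show (0 : ℤ) ≤ K by omega) hint', neg_zero]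
  have hin : ∫ x in fracIdeal F 0, (ψ (-b * x) : ℂ) * ∫ z in fracIdeal F (-L),
      ∫ y in fracIdeal F (-K), bigCell μ₁ μ₂ μ₃ c x y z * (ψ (b * y) : ℂ) ∂dx ∂dx ∂dx =
      (resCard F : ℂ) ^ (-c : ℤ) * ((μ₁ ϖ : ℂ) ^ (2 * (c : ℤ)) +
        (1 - (resCard F : ℂ)⁻¹) * ∑ n ∈ Finset.Ioc (c : ℤ) (c + m), (μ₁ ϖ : ℂ) ^ (2 * n)) := by
    rw [setIntegral_congr_fun (measurableSet_fracIdeal 0) fun x hx => congrArg _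
      (integral_bigCell_of_mem dx hdx D hψ hx (by omega) hb hK (by omega)), integral_mul_const,
      setIntegral_addChar_fracIdeal dx hdx hϖ hψ, norm_neg, hb,
      if_pos (zpow_le_zpow_right₀ hq1.le (by omega)), neg_zero, zpow_zero, Complex.ofReal_one,
      one_mul]
  have hout : ∀ k ∈ Finset.Ioc (0 : ℤ) K, ∫ x in sphereZ F k, (ψ (-b * x) : ℂ) *
      ∫ z in fracIdeal F (-L), ∫ y in fracIdeal F (-K),
        bigCell μ₁ μ₂ μ₃ c x y z * (ψ (b * y) : ℂ) ∂dx ∂dx ∂dx =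
      ((if k ≤ m then (resCard F : ℂ) ^ k else 0) -
        (if k ≤ m + 1 then (resCard F : ℂ) ^ (k - 1) else 0)) *
      (if c + k + m ≤ L then (μ₁ ϖ : ℂ) ^ (2 * (c + k + m)) * (resCard F : ℂ) ^ (-k - c) else 0) := by
    intro k hk
    have hk1 := (Finset.mem_Ioc.1 hk).1
    rw [setIntegral_congr_fun (measurableSet_sphereZ k) fun x hx => congrArg _
      (integral_bigCell_of_norm_eq dx hdx D hψ (L := L) hx (by omega) (by omega) hb hK),
      integral_mul_const, setIntegral_addChar_sphereZ dx hdx hϖ hψ, norm_neg, hb,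
      Complex.ofReal_zpow, Complex.ofReal_zpow, Complex.ofReal_natCast]
    simp only [zpow_le_zpow_iff_right₀ hq1]
    congr 2
    · exact if_congr (by omega) rfl rfl
    · exact if_congr (by omega) rfl rfl
  rw [hin, Finset.sum_congr rfl hout]
  have hsub : Finset.Ioc (0 : ℤ) (0 + (m + 1 : ℕ)) ⊆ Finset.Ioc 0 K :=
    Finset.Ioc_subset_Ioc_right (by push_cast; omega)
  rw [← Finset.sum_subset hsub]
  swap
  · intro k hk0 hk
    rw [Finset.mem_Ioc] at hk hk0
    push_cast at hk
    rw [if_neg (by omega), if_neg (by omega), sub_zero, zero_mul]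
  rw [sum_Ioc_add_natCast, sum_Ioc_add_natCast, Finset.sum_range_succ]
  have hterm : ∀ j ∈ Finset.range m, ((if 0 + 1 + (j : ℤ) ≤ m then
      (resCard F : ℂ) ^ (0 + 1 + (j : ℤ)) else 0) -
        (if 0 + 1 + (j : ℤ) ≤ m + 1 then (resCard F : ℂ) ^ (0 + 1 + (j : ℤ) - 1) else 0)) *
      (if c + (0 + 1 + (j : ℤ)) + m ≤ L then (μ₁ ϖ : ℂ) ^ (2 * (c + (0 + 1 + (j : ℤ)) + m)) *
        (resCard F : ℂ) ^ (-(0 + 1 + (j : ℤ)) - c) else 0) =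
      (resCard F : ℂ) ^ (-c : ℤ) * (μ₁ ϖ : ℂ) ^ (2 * c) * (1 - (resCard F : ℂ)⁻¹) *
        ((μ₁ ϖ : ℂ) ^ 2) ^ (m + j + 1) := by
    intro j hj
    have hj := Finset.mem_range.1 hj
    rw [if_pos (by omega), if_pos (by omega), if_pos (by omega), zpow_sub_one₀ hqC,
      zpow_sub₀ hqC, zpow_neg _ (c : ℤ), zpow_neg,
      show 2 * (c + (0 + 1 + (j : ℤ)) + m) = ((2 * c + 2 * (m + j + 1) : ℕ) : ℤ) by push_cast; ring,
      zpow_natCast, pow_add, pow_mul _ 2 (m + j + 1)]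
    have h1 := zpow_ne_zero (0 + 1 + (j : ℤ)) hqC
    have h2 := zpow_ne_zero (c : ℤ) hqC
    field_simp
  rw [Finset.sum_congr rfl hterm, if_neg (by omega), if_pos (by omega), if_pos (by omega), zero_sub,
    ← Finset.mul_sum]
  have e1 : ∀ j ∈ Finset.range m, (μ₁ ϖ : ℂ) ^ (2 * ((c : ℤ) + 1 + j)) =
      (μ₁ ϖ : ℂ) ^ (2 * c) * ((μ₁ ϖ : ℂ) ^ 2) ^ (j + 1) := fun j _ => by
    rw [show 2 * ((c : ℤ) + 1 + j) = ((2 * c + 2 * (j + 1) : ℕ) : ℤ) by push_cast; ring,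
      zpow_natCast, pow_add, pow_mul _ 2 (j + 1)]
  have e2 : (μ₁ ϖ : ℂ) ^ (2 * (c + (0 + 1 + (m : ℤ)) + m)) =
      (μ₁ ϖ : ℂ) ^ (2 * c) * ((μ₁ ϖ : ℂ) ^ 2) ^ (2 * m + 1) := by
    rw [show 2 * (c + (0 + 1 + (m : ℤ)) + m) = ((2 * c + 2 * (2 * m + 1) : ℕ) : ℤ) by
      push_cast; ring, zpow_natCast, pow_add, pow_mul _ 2 (2 * m + 1)]
  have e3 : (μ₁ ϖ : ℂ) ^ (2 * (c : ℤ)) = (μ₁ ϖ : ℂ) ^ (2 * c) := by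
    rw [show 2 * (c : ℤ) = ((2 * c : ℕ) : ℤ) by push_cast; ring, zpow_natCast]
  have e4 : (resCard F : ℂ) ^ (0 + 1 + (m : ℤ) - 1) * (resCard F : ℂ) ^ (-(0 + 1 + (m : ℤ)) - c) =
      (resCard F : ℂ)⁻¹ * (resCard F : ℂ) ^ (-c : ℤ) := by
    rw [← zpow_neg_one, ← zpow_add₀ hqC, ← zpow_add₀ hqC]; congr 1; ring
  rw [Finset.sum_congr rfl e1, ← Finset.mul_sum, e2, e3]
  generalize (μ₁ ϖ : ℂ) ^ 2 = u
  have g1 : ∑ j ∈ Finset.range (2 * m + 1), u ^ j =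
      1 + ∑ j ∈ Finset.range m, u ^ (j + 1) + ∑ j ∈ Finset.range m, u ^ (m + j + 1) := by
    rw [Finset.sum_range_succ', two_mul, Finset.sum_range_add]; ring
  have g2 := mul_neg_geom_sum u (2 * m + 1)
  generalize ∑ j ∈ Finset.range (2 * m + 1), u ^ j = G at *
  generalize ∑ j ∈ Finset.range m, u ^ (j + 1) = A at *
  generalize ∑ j ∈ Finset.range m, u ^ (m + j + 1) = B at *
  generalize (μ₁ ϖ : ℂ) ^ (2 * c) = T at *
  have g3 : u ^ (2 * m + 1) = 1 - (1 - u) * G := by rw [g2]; ring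
  rw [g3]
  generalize (resCard F : ℂ) ^ (-c : ℤ) = Q at *
  have g4 : A = G - 1 - B := by rw [g1]; ring
  rw [g4]
  linear_combination (-(T * (1 - (1 - u) * G))) * e4

end JacquetIntegral

theorem unip_mul_unip {F : Type*} [Field F] (x y z x' y' z' : F) :
    unip x y z * unip x' y' z' = unip (x + x') (y + y') (z + (z' + x * y')) := by
  ext i j
  rw [Matrix.SpecialLinearGroup.coe_mul]
  fin_cases i <;> fin_cases j <;> simp [unip, Matrix.mul_apply, Fin.sum_univ_three] <;> ring

section WhittakerValues

variable {F : Type*} [NontriviallyNormedField F] [IsUltrametricDist F] [LocallyCompactSpace F]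
  [MeasurableSpace F] [BorelSpace F] [SecondCountableTopology F] {ϖ : Fˣ} (dx : Measure F)
  [dx.IsAddHaarMeasure] (hdx : dx (fracIdeal F 0) = 1)
  {μ₁ μ₂ μ₃ : Fˣ →ₜ* ℂˣ} {c : ℕ} {ψ : AddChar F Circle}

/-- The domain of the truncated Jacquet integral. -/
def jacquetBox (F : Type*) [NontriviallyNormedField F] [IsUltrametricDist F] (k : ℕ) :
    Set (F × F × F) :=
  {p | p.1 ∈ fracIdeal F (-k) ∧ p.2.1 ∈ fracIdeal F (-k) ∧ p.2.2 ∈ fracIdeal F (-(2 * k))}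

theorem jacquetBox_eq_prod (k : ℕ) : jacquetBox F k =
    fracIdeal F (-k) ×ˢ (fracIdeal F (-k) ×ˢ fracIdeal F (-(2 * k))) := rfl

theorem measurableSet_jacquetBox (k : ℕ) : MeasurableSet (jacquetBox F k) := by
  rw [jacquetBox_eq_prod]
  exact (measurableSet_fracIdeal _).prod ((measurableSet_fracIdeal _).prod
    (measurableSet_fracIdeal _))

theorem truncatedJacquet_eq (f : GL (Fin 3) F → ℂ) (g : GL (Fin 3) F) (k : ℕ) :
    truncatedJacquet dx ψ f g k = ∫ p, (jacquetBox F k).indicator (fun p =>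
      f (longWeyl * (unip p.1 p.2.1 p.2.2 : GL (Fin 3) F) * g) *
        (((ψ (p.1 - p.2.1))⁻¹ : Circle) : ℂ)) p ∂(dx.prod (dx.prod dx)) := by
  rw [integral_indicator (measurableSet_jacquetBox k)]
  rfl

/-- Right translation by an element of the unipotent group, in coordinates. -/
def unipTranslate (x₀ y₀ z₀ : F) : F × F × F ≃ᵐ F × F × F where
  toFun p := (p.1 + x₀, p.2.1 + y₀, p.2.2 + (z₀ + p.1 * y₀))
  invFun p := (p.1 - x₀, p.2.1 - y₀, p.2.2 - (z₀ + (p.1 - x₀) * y₀))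
  left_inv p := by ext <;> simp
  right_inv p := by ext <;> simp
  measurable_toFun := by
    change Measurable fun p : F × F × F => (p.1 + x₀, p.2.1 + y₀, p.2.2 + (z₀ + p.1 * y₀))
    fun_prop
  measurable_invFun := by
    change Measurable fun p : F × F × F =>
      (p.1 - x₀, p.2.1 - y₀, p.2.2 - (z₀ + (p.1 - x₀) * y₀))
    fun_prop

theorem measurePreserving_unipTranslate (x₀ y₀ z₀ : F) :
    MeasurePreserving (unipTranslate x₀ y₀ z₀) (dx.prod (dx.prod dx)) (dx.prod (dx.prod dx)) := by
  have h1 : ∀ x : F, MeasurePreserving (fun w : F × F => (w.1 + y₀, w.2 + (z₀ + x * y₀)))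
      (dx.prod dx) (dx.prod dx) := fun x =>
    (measurePreserving_add_right dx y₀).prod (measurePreserving_add_right dx (z₀ + x * y₀))
  have h2 := (measurePreserving_add_right dx x₀).skew_product (μc := dx.prod dx)
    (μd := dx.prod dx) (g := fun (x : F) (w : F × F) => (w.1 + y₀, w.2 + (z₀ + x * y₀)))
    (by fun_prop) (Eventually.of_forall fun x => (h1 x).map_eq)
  exact h2

theorem unipTranslate_mem_jacquetBox_iff (hϖ : IsNormalizedUniformizer ϖ) {k : ℕ} {x₀ y₀ z₀ : F}
    (h : (x₀, y₀, z₀) ∈ jacquetBox F k) (p : F × F × F) :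
    unipTranslate x₀ y₀ z₀ p ∈ jacquetBox F k ↔ p ∈ jacquetBox F k := by
  obtain ⟨h1, h2, h3⟩ := h
  constructor
  · rintro ⟨q1, q2, q3⟩
    have p1 : p.1 ∈ fracIdeal F (-k) := by
      have := sub_mem_fracIdeal q1 h1
      simpa only [unipTranslate, MeasurableEquiv.coe_mk, Equiv.coe_fn_mk, add_sub_cancel_right]
        using this
    have p2 : p.2.1 ∈ fracIdeal F (-k) := by
      have := sub_mem_fracIdeal q2 h2
      simpa only [unipTranslate, MeasurableEquiv.coe_mk, Equiv.coe_fn_mk, add_sub_cancel_right]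
        using this
    refine ⟨p1, p2, ?_⟩
    have := sub_mem_fracIdeal q3 (add_mem_fracIdeal h3
      (mul_mem_fracIdeal_of_le (k := -(2 * k)) hϖ p1 h2 (by omega)))
    simpa only [unipTranslate, MeasurableEquiv.coe_mk, Equiv.coe_fn_mk, add_sub_cancel_right]
        using this
  · rintro ⟨p1, p2, p3⟩
    exact ⟨add_mem_fracIdeal p1 h1, add_mem_fracIdeal p2 h2, add_mem_fracIdeal p3
      (add_mem_fracIdeal h3 (mul_mem_fracIdeal_of_le hϖ p1 h2 (by omega)))⟩

theorem truncatedJacquet_unip_mul (hϖ : IsNormalizedUniformizer ϖ) (f : GL (Fin 3) F → ℂ)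
    (g : GL (Fin 3) F) {k : ℕ} {x₀ y₀ z₀ : F} (h : (x₀, y₀, z₀) ∈ jacquetBox F k) :
    truncatedJacquet dx ψ f ((unip x₀ y₀ z₀ : GL (Fin 3) F) * g) k =
      (ψ (x₀ - y₀) : ℂ) * truncatedJacquet dx ψ f g k := by
  have hcomp := (measurePreserving_unipTranslate dx x₀ y₀ z₀).integral_comp'
    (g := (jacquetBox F k).indicator (fun p =>
      f (longWeyl * (unip p.1 p.2.1 p.2.2 : GL (Fin 3) F) * g) *
        (((ψ (p.1 - p.2.1))⁻¹ : Circle) : ℂ)))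
  rw [truncatedJacquet_eq, truncatedJacquet_eq, ← hcomp, ← integral_const_mul]
  congr 1
  funext p
  by_cases hp : p ∈ jacquetBox F k
  · rw [Set.indicator_of_mem hp,
      Set.indicator_of_mem ((unipTranslate_mem_jacquetBox_iff hϖ h p).2 hp)]
    have h1 : longWeyl * (unip p.1 p.2.1 p.2.2 : GL (Fin 3) F) *
        ((unip x₀ y₀ z₀ : GL (Fin 3) F) * g) = longWeyl *
        (unip (p.1 + x₀) (p.2.1 + y₀) (p.2.2 + (z₀ + p.1 * y₀)) : GL (Fin 3) F) * g := by
      rw [← unip_mul_unip, map_mul]; simp only [mul_assoc]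
    rw [h1]
    have h2 : ψ ((p.1 + x₀) - (p.2.1 + y₀)) = ψ (p.1 - p.2.1) * ψ (x₀ - y₀) := by
      rw [← AddChar.map_add_eq_mul]; congr 1; ring
    change _ = _ * (_ * (((ψ ((p.1 + x₀) - (p.2.1 + y₀)))⁻¹ : Circle) : ℂ))
    rw [h2, mul_inv, Circle.coe_mul, Circle.coe_inv (ψ (x₀ - y₀))]
    have h3 : (ψ (x₀ - y₀) : ℂ) ≠ 0 := Circle.coe_ne_zero _
    simp only [unipTranslate, MeasurableEquiv.coe_mk, Equiv.coe_fn_mk]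
    field_simp
  · rw [Set.indicator_of_notMem hp,
      Set.indicator_of_notMem (fun h' => hp ((unipTranslate_mem_jacquetBox_iff hϖ h p).1 h')),
      mul_zero]

theorem truncatedJacquet_mul_right (D : IsNewFormDatum ϖ μ₁ μ₂ μ₃ c) (g : GL (Fin 3) F)
    {κ : GL (Fin 3) F} (hκ : κ ∈ K F c) (k : ℕ) :
    truncatedJacquet dx ψ (newForm μ₁ μ₂ μ₃ c) (g * κ) k =
      truncatedJacquet dx ψ (newForm μ₁ μ₂ μ₃ c) g k := by
  rw [truncatedJacquet, truncatedJacquet]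
  congr 1
  funext p
  rw [← mul_assoc, newForm_mul_right D.unif D.unr₁ D.unr₃ D.one_le D.ram _ hκ]

theorem exists_mem_fracIdeal_neg (hϖ : IsNormalizedUniformizer ϖ) (x : F) :
    ∃ n : ℕ, ∀ k : ℕ, n ≤ k → x ∈ fracIdeal F (-k) := by
  obtain ⟨n, hn⟩ := pow_unbounded_of_one_lt ‖x‖ (one_lt_resCard hϖ)
  refine ⟨n, fun k hk => ?_⟩
  rw [mem_fracIdeal, neg_neg, zpow_natCast]
  exact hn.le.trans (pow_le_pow_right₀ (one_lt_resCard hϖ).le hk)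

theorem eventually_mem_jacquetBox (hϖ : IsNormalizedUniformizer ϖ) (x y z : F) :
    ∀ᶠ k : ℕ in atTop, (x, y, z) ∈ jacquetBox F k := by
  obtain ⟨n₁, h₁⟩ := exists_mem_fracIdeal_neg hϖ x
  obtain ⟨n₂, h₂⟩ := exists_mem_fracIdeal_neg hϖ y
  obtain ⟨n₃, h₃⟩ := exists_mem_fracIdeal_neg hϖ z
  filter_upwards [eventually_ge_atTop n₁, eventually_ge_atTop n₂, eventually_ge_atTop n₃]
    with k k₁ k₂ k₃
  exact ⟨h₁ k k₁, h₂ k k₂, fracIdeal_anti hϖ (by omega) (h₃ k k₃)⟩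

theorem torusSL_coe_GL (a b : Fˣ) : ((torusSL a b : GL (Fin 3) F) : Matrix (Fin 3) (Fin 3) F) =
    !![(a : F), 0, 0; 0, (b : F), 0; 0, 0, ((a⁻¹ * b⁻¹ : Fˣ) : F)] := rfl

/-- The scaling of the unipotent group by conjugation with the torus, in coordinates. -/
def unipScale (a : Fˣ) : F × F × F ≃ᵐ F × F × F :=
  (MeasurableEquiv.mulLeft₀ (a : F) a.ne_zero).prodCongr
    ((MeasurableEquiv.mulLeft₀ (a : F) a.ne_zero).prodCongr
      (MeasurableEquiv.mulLeft₀ ((a : F) ^ 2) (pow_ne_zero 2 a.ne_zero)))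

theorem unipScale_apply (a : Fˣ) (x y z : F) :
    unipScale a (x, y, z) = ((a : F) * x, (a : F) * y, (a : F) ^ 2 * z) := rfl

theorem newForm_longWeyl_mul_unip_mul_torusSL (D : IsNewFormDatum ϖ μ₁ μ₂ μ₃ c) (a : Fˣ)
    (x y z : F) :
    newForm μ₁ μ₂ μ₃ c (longWeyl * (unip (a * x) (a * y) (a ^ 2 * z) : GL (Fin 3) F) *
      (torusSL a 1 : GL (Fin 3) F)) =
      ((μ₁ a : ℂ) ^ 2)⁻¹ * (((‖(a : F)‖ ^ 2)⁻¹ : ℝ) : ℂ) * bigCell μ₁ μ₂ μ₃ c x y z := by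
  have hmat : ((longWeyl * (unip (a * x) (a * y) (a ^ 2 * z) : GL (Fin 3) F) *
      (torusSL a 1 : GL (Fin 3) F) : GL (Fin 3) F) : Matrix (Fin 3) (Fin 3) F) =
      Matrix.diagonal (fun i => ((![a⁻¹, 1, a] i : Fˣ) : F)) *
        ((longWeyl * (unip x y z : GL (Fin 3) F) : GL (Fin 3) F) : Matrix (Fin 3) (Fin 3) F) := by
    rw [Units.val_mul, longWeyl_mul_unip, longWeyl_mul_unip, torusSL_coe_GL]
    have := a.ne_zero
    ext i j
    fin_cases i <;> fin_cases j <;>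
      simp [Matrix.mul_apply, Fin.sum_univ_three, Matrix.diagonal] <;> field_simp
  rw [newForm_diagonal_mul D.unif D.unr₁ D.unr₃ D.one_le D.ram _ _ hmat, bigCell]
  have h3 : μ₃ a = (μ₁ a)⁻¹ := by rw [eq_inv_iff_mul_eq_one, mul_comm]; exact D.mul_eq_one a
  congr 1
  simp only [Matrix.cons_val_zero, Matrix.cons_val_one, Matrix.cons_val, map_one, Units.val_one,
    mul_one, h3, map_inv, Units.val_inv_eq_inv_val, norm_inv]
  push_cast
  rw [sq, sq, mul_inv, mul_inv]
  rfl

include hdx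

theorem integral_comp_unipScale (hϖ : IsNormalizedUniformizer ϖ) (a : Fˣ) (g : F × F × F → ℂ) :
    ∫ p, g p ∂(dx.prod (dx.prod dx)) =
      ((‖(a : F)‖ ^ 4 : ℝ) : ℂ) * ∫ p, g (unipScale a p) ∂(dx.prod (dx.prod dx)) := by
  have ha := norm_pos_iff.2 a.ne_zero
  have h1 : (dx.prod (dx.prod dx)).map (unipScale a) =
      ENNReal.ofReal ((‖(a : F)‖ ^ 4)⁻¹) • dx.prod (dx.prod dx) := by
    have e1 : dx.map (MeasurableEquiv.mulLeft₀ (a : F) a.ne_zero) = ENNReal.ofReal (‖(a : F)‖⁻¹) • dx :=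
      map_mul_left_eq dx hdx hϖ a.ne_zero
    have e2 : dx.map (MeasurableEquiv.mulLeft₀ ((a : F) ^ 2) (pow_ne_zero 2 a.ne_zero)) =
        ENNReal.ofReal (‖(a : F) ^ 2‖⁻¹) • dx :=
      map_mul_left_eq dx hdx hϖ (pow_ne_zero 2 a.ne_zero)
    have e3 : (dx.prod (dx.prod dx)).map (unipScale a) =
        (dx.map (MeasurableEquiv.mulLeft₀ (a : F) a.ne_zero)).prod
          ((dx.map (MeasurableEquiv.mulLeft₀ (a : F) a.ne_zero)).prod
            (dx.map (MeasurableEquiv.mulLeft₀ ((a : F) ^ 2) (pow_ne_zero 2 a.ne_zero)))) := by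
      rw [Measure.map_prod_map _ _ (MeasurableEquiv.measurable _) (MeasurableEquiv.measurable _),
        Measure.map_prod_map _ _ (MeasurableEquiv.measurable _)
          ((MeasurableEquiv.measurable _).prodMap (MeasurableEquiv.measurable _))]
      rfl
    rw [e3, e1, e2, Measure.prod_smul_left, Measure.prod_smul_left, Measure.prod_smul_right,
      Measure.prod_smul_right, Measure.prod_smul_right, smul_smul, smul_smul, norm_pow,
      ← ENNReal.ofReal_mul (by positivity), ← ENNReal.ofReal_mul (by positivity)]
    congr 2
    rw [← mul_inv, ← mul_inv]; congr 1; ring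
  have h2 := integral_map_equiv (μ := dx.prod (dx.prod dx)) (unipScale a) g
  rw [h1, integral_smul_measure, ENNReal.toReal_ofReal (by positivity)] at h2
  rw [← h2, Complex.real_smul, ← mul_assoc, ← Complex.ofReal_mul, mul_inv_cancel₀ (by positivity),
    Complex.ofReal_one, one_mul]

theorem truncatedJacquet_torusSL (D : IsNewFormDatum ϖ μ₁ μ₂ μ₃ c) (hψ : IsUnramifiedAddChar ψ)
    (m : ℕ) {k : ℕ} (hk : c + 1 ≤ k) :
    truncatedJacquet dx ψ (newForm μ₁ μ₂ μ₃ c) (torusSL (ϖ ^ (m : ℤ)) 1 : GL (Fin 3) F) k =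
      (((μ₁ ϖ : ℂ) ^ 2) ^ m)⁻¹ * ((resCard F : ℂ) ^ (2 * m))⁻¹ *
      ((resCard F : ℂ) ^ (-c : ℤ) * (μ₁ ϖ : ℂ) ^ (2 * c) *
        (1 - (μ₁ ϖ : ℂ) ^ 2 * (resCard F : ℂ)⁻¹) *
        ∑ j ∈ Finset.range (2 * m + 1), ((μ₁ ϖ : ℂ) ^ 2) ^ j) := by
  have hϖ := D.unif
  have hq := resCard_pos hϖ
  have hqC : (resCard F : ℂ) ≠ 0 := by exact_mod_cast hq.ne'
  obtain ⟨a, ha⟩ : ∃ a : Fˣ, a = ϖ ^ (m : ℤ) := ⟨_, rfl⟩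
  have hb : ‖(a : F)‖ = (resCard F : ℝ) ^ (-m : ℤ) := by rw [ha, norm_uniformizer_zpow hϖ]
  rw [← ha]
  rw [← integral_bigCell dx hdx D hψ hb (K := k + m) (L := 2 * k + 2 * m) (by omega) (by omega),
    truncatedJacquet_eq, integral_comp_unipScale dx hdx hϖ a, ← integral_indicator
      ((measurableSet_fracIdeal _).prod ((measurableSet_fracIdeal _).prod
        (measurableSet_fracIdeal _))), ← integral_const_mul, ← integral_const_mul]
  congr 1
  funext p
  obtain ⟨x, y, z⟩ := p
  have hmem : unipScale a (x, y, z) ∈ jacquetBox F k ↔ (x, y, z) ∈ fracIdeal F (-(k + m)) ×ˢ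
      (fracIdeal F (-(k + m)) ×ˢ fracIdeal F (-(2 * k + 2 * m))) := by
    have e := fun (n : ℤ) => Set.ext_iff.1 (preimage_mul_left_fracIdeal hϖ hb n)
    have hb2 : ‖(a : F) ^ 2‖ = (resCard F : ℝ) ^ (-(2 * m) : ℤ) := by
      rw [norm_pow, hb, ← zpow_natCast, ← zpow_mul]; congr 1; push_cast; ring
    have e' := fun (n : ℤ) => Set.ext_iff.1 (preimage_mul_left_fracIdeal hϖ hb2 n)
    have i1 := e (-k) x
    have i2 := e (-k) y
    have i3 := e' (-(2 * k)) z
    rw [show (-k + -m : ℤ) = -(k + m) by ring] at i1 i2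
    rw [show (-(2 * k) + -(2 * m) : ℤ) = -(2 * k + 2 * m) by ring] at i3
    exact and_congr i1 (and_congr i2 i3)
  by_cases hp : unipScale a (x, y, z) ∈ jacquetBox F k
  · rw [Set.indicator_of_mem hp, Set.indicator_of_mem (hmem.1 hp)]
    rw [unipScale_apply]
    dsimp only
    rw [newForm_longWeyl_mul_unip_mul_torusSL D]
    have h1 : (ψ (a * x - a * y))⁻¹ = ψ (-a * x) * ψ (a * y) := by
      rw [← AddChar.map_neg_eq_inv, ← AddChar.map_add_eq_mul]; congr 1; ring
    have h2 : (μ₁ a : ℂ) = (μ₁ ϖ : ℂ) ^ m := by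
      rw [ha, zpow_natCast, map_pow, Units.val_pow_eq_pow_val]
    have h3 : ((‖(a : F)‖ : ℝ) : ℂ) = ((resCard F : ℂ) ^ m)⁻¹ := by
      rw [hb, Complex.ofReal_zpow, Complex.ofReal_natCast, zpow_neg, zpow_natCast]
    rw [h1, Circle.coe_mul, h2]
    push_cast
    rw [h3]
    have h4 := pow_ne_zero m hqC
    have h5 := pow_ne_zero m (μ₁ ϖ).ne_zero
    rw [pow_mul _ 2 m, pow_right_comm _ 2 m, pow_right_comm (resCard F : ℂ) 2 m]
    field_simp
  · rw [Set.indicator_of_notMem hp, Set.indicator_of_notMem fun h => hp (hmem.2 h), mul_zero,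
      mul_zero]

omit hdx in
theorem truncatedJacquet_torusSL_eq_zero (D : IsNewFormDatum ϖ μ₁ μ₂ μ₃ c)
    (hψ : IsUnramifiedAddChar ψ) {m : ℤ} (hm : m < 0) :
    ∀ᶠ k in atTop, truncatedJacquet dx ψ (newForm μ₁ μ₂ μ₃ c)
      (torusSL (ϖ ^ m) 1 : GL (Fin 3) F) k = 0 := by
  have hϖ := D.unif
  obtain ⟨y, hy, hψy⟩ := hψ.2.2
  obtain ⟨a, ha⟩ : ∃ a : Fˣ, a = ϖ ^ m := ⟨_, rfl⟩
  have hx : ((a⁻¹ : Fˣ) : F) * y ∈ fracIdeal F 0 := by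
    have h1 : ((a⁻¹ : Fˣ) : F) ∈ fracIdeal F (-m) := by
      rw [ha, ← zpow_neg]; exact (norm_uniformizer_zpow hϖ (-m)).le
    exact mul_mem_fracIdeal_of_le hϖ h1 hy (by omega)
  rw [← ha]
  filter_upwards [eventually_mem_jacquetBox hϖ y 0 0] with k hk
  have h2 := truncatedJacquet_unip_mul dx (ψ := ψ) hϖ (newForm μ₁ μ₂ μ₃ c)
    (torusSL a 1 : GL (Fin 3) F) hk
  have h3 : (unip y 0 0 : GL (Fin 3) F) * (torusSL a 1 : GL (Fin 3) F) =
      (torusSL a 1 : GL (Fin 3) F) * (unip (((a⁻¹ : Fˣ) : F) * y) 0 0 : GL (Fin 3) F) := by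
    rw [← map_mul, ← map_mul]
    congr 1
    ext i j
    rw [Matrix.SpecialLinearGroup.coe_mul, Matrix.SpecialLinearGroup.coe_mul]
    fin_cases i <;> fin_cases j <;>
      simp [unip, torusSL, Matrix.mul_apply, Fin.sum_univ_three]
  rw [h3, truncatedJacquet_mul_right dx D _ (unip_mem_K hϖ (zero_mem_fracIdeal _) hx
    (zero_mem_fracIdeal _)), sub_zero] at h2
  have h4 : ((ψ y : ℂ) - 1) * truncatedJacquet dx ψ (newForm μ₁ μ₂ μ₃ c)
      (torusSL a 1 : GL (Fin 3) F) k = 0 := by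
    rw [sub_mul, ← h2, one_mul, sub_self]
  refine (mul_eq_zero.1 h4).resolve_left ?_
  rw [sub_eq_zero]
  exact fun h => hψy (Subtype.ext h)

/-- The values of the Whittaker function on `N₂ T₀ K_c`. -/
theorem whittaker_eq (D : IsNewFormDatum ϖ μ₁ μ₂ μ₃ c)
    (hψ : IsUnramifiedAddChar ψ) (m : ℤ) (r t : F) {κ : GL (Fin 3) F} (hκ : κ ∈ K F c) :
    whittaker dx ψ (newForm μ₁ μ₂ μ₃ c)
      ((unip r r t : GL (Fin 3) F) * (torusSL (ϖ ^ m) 1 : GL (Fin 3) F) * κ) =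
    if m < 0 then 0 else
      (((μ₁ ϖ : ℂ) ^ 2) ^ m.toNat)⁻¹ * ((resCard F : ℂ) ^ (2 * m.toNat))⁻¹ *
      ((resCard F : ℂ) ^ (-c : ℤ) * (μ₁ ϖ : ℂ) ^ (2 * c) *
        (1 - (μ₁ ϖ : ℂ) ^ 2 * (resCard F : ℂ)⁻¹) *
        ∑ j ∈ Finset.range (2 * m.toNat + 1), ((μ₁ ϖ : ℂ) ^ 2) ^ j) := by
  have hϖ := D.unif
  refine Tendsto.limUnder_eq (tendsto_const_nhds.congr' ?_)
  have h1 : ∀ᶠ k in atTop, truncatedJacquet dx ψ (newForm μ₁ μ₂ μ₃ c)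
      ((unip r r t : GL (Fin 3) F) * (torusSL (ϖ ^ m) 1 : GL (Fin 3) F) * κ) k =
      truncatedJacquet dx ψ (newForm μ₁ μ₂ μ₃ c) (torusSL (ϖ ^ m) 1 : GL (Fin 3) F) k := by
    filter_upwards [eventually_mem_jacquetBox hϖ r r t] with k hk
    rw [truncatedJacquet_mul_right dx D _ hκ, truncatedJacquet_unip_mul dx hϖ _ _ hk, sub_self,
      AddChar.map_zero_eq_one, Circle.coe_one, one_mul]
  split_ifs with hm
  · filter_upwards [h1, truncatedJacquet_torusSL_eq_zero dx D hψ hm] with k e1 e2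
    rw [e1, e2]
  · filter_upwards [h1, eventually_ge_atTop (c + 1)] with k e1 hk
    rw [e1, ← truncatedJacquet_torusSL dx hdx D hψ m.toNat hk, Int.toNat_of_nonneg (by omega)]

end WhittakerValues

section G2Computations

open scoped Matrix

variable {F : Type*} [Field F]

theorem xAlpha_mul_neg (r : F) : xAlpha r * xAlpha (-r) = 1 := by
  ext i j
  rw [Matrix.mul_apply]
  fin_cases i <;> simp [xAlpha, Fin.sum_univ_eight] <;> fin_cases j <;> simp <;> ring

theorem xBeta_mul_neg (r : F) : xBeta r * xBeta (-r) = 1 := by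
  ext i j
  rw [Matrix.mul_apply]
  fin_cases i <;> simp [xBeta, Fin.sum_univ_eight] <;> fin_cases j <;> simp

theorem xNegAlpha_mul_neg (r : F) : xNegAlpha r * xNegAlpha (-r) = 1 := by
  have h := congrArg Matrix.transpose (xAlpha_mul_neg (-r))
  rwa [Matrix.transpose_mul, neg_neg, Matrix.transpose_one] at h

theorem xNegBeta_mul_neg (r : F) : xNegBeta r * xNegBeta (-r) = 1 := by
  have h := congrArg Matrix.transpose (xBeta_mul_neg (-r))
  rwa [Matrix.transpose_mul, neg_neg, Matrix.transpose_one] at h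

theorem wBetaAt_mul_neg (t : F) : wBetaAt t * wBetaAt (-t) = 1 := by
  have h : wBetaAt t * wBetaAt (-t) = xBeta t * (xNegBeta (-t⁻¹) * (xBeta t * xBeta (-t)) *
      xNegBeta (-(-t)⁻¹)) * xBeta (-t) := by
    simp only [wBetaAt, mul_assoc]
  rw [h, xBeta_mul_neg, mul_one, inv_neg, xNegBeta_mul_neg, mul_one, xBeta_mul_neg]

/-- The element `γ` of `G₂(F)` used to identify `H_ρ` with `SL₃(F)`. -/
def gammaG₂ (τ : F) : Matrix (Fin 8) (Fin 8) F :=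
  hBeta (2 * τ)⁻¹ * xAlpha (2 * τ)⁻¹ * xNegAlpha (-τ)

/-- The inverse of `γ`. -/
def gammaG₂Inv (τ : F) : Matrix (Fin 8) (Fin 8) F :=
  xNegAlpha τ * xAlpha (-(2 * τ)⁻¹) * (wBeta * wBetaAt (-(2 * τ)⁻¹))

theorem gammaG₂_mul_inv (τ : F) : gammaG₂ τ * gammaG₂Inv τ = 1 := by
  have h : gammaG₂ τ * gammaG₂Inv τ = wBetaAt (2 * τ)⁻¹ * (wBetaAt (-1) *
      (xAlpha (2 * τ)⁻¹ * (xNegAlpha (-τ) * xNegAlpha τ) * xAlpha (-(2 * τ)⁻¹)) * wBeta) *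
      wBetaAt (-(2 * τ)⁻¹) := by
    simp only [gammaG₂, gammaG₂Inv, hBeta, mul_assoc]
  have h1 := xNegAlpha_mul_neg (-τ)
  have h2 := wBetaAt_mul_neg (-1 : F)
  rw [neg_neg] at h1 h2
  rw [h, h1, mul_one, xAlpha_mul_neg, mul_one, wBeta, h2, mul_one, wBetaAt_mul_neg]

/-- The embedding `i` composed with conjugation by `diag(1, 1, -1)`. -/
noncomputable def iEmbConj (g : Matrix.SpecialLinearGroup (Fin 3) F) :
    Matrix (Fin 8) (Fin 8) F :=
  iEmb (Matrix.diagonal ![1, 1, -1] * (g : Matrix (Fin 3) (Fin 3) F) *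
    Matrix.diagonal ![1, 1, -1])

theorem jEmb_eq (τ : F) (g : Matrix.SpecialLinearGroup (Fin 3) F) :
    jEmb τ g = gammaG₂Inv τ * iEmbConj g * gammaG₂ τ := rfl

/-- The basis vectors of the eight-dimensional representation, grouped according to the
decomposition under `SL₃`. -/
def g₂Index : Fin 8 ≃ (Fin 3 ⊕ Fin 3) ⊕ Fin 2 where
  toFun := ![.inl (.inr 2), .inl (.inl 0), .inl (.inl 1), .inr 0, .inr 1, .inl (.inr 1),
    .inl (.inr 0), .inl (.inl 2)]
  invFun := Sum.elim (Sum.elim ![1, 2, 7] ![6, 5, 0]) ![3, 4]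
  left_inv := by decide
  right_inv := by decide

theorem iEmb_eq_submatrix (A : Matrix (Fin 3) (Fin 3) F) :
    iEmb A = (Matrix.fromBlocks (Matrix.fromBlocks A 0 0 (A⁻¹).transpose) 0 0 1).submatrix
      g₂Index g₂Index := by
  ext i j
  fin_cases i <;> fin_cases j <;> rfl

theorem iEmb_mul (A B : Matrix (Fin 3) (Fin 3) F) : iEmb (A * B) = iEmb A * iEmb B := by
  simp only [iEmb_eq_submatrix, Matrix.submatrix_mul_equiv, Matrix.fromBlocks_multiply,
    Matrix.mul_inv_rev, Matrix.transpose_mul]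
  simp

theorem iEmb_one : iEmb (1 : Matrix (Fin 3) (Fin 3) F) = 1 := by
  rw [iEmb_eq_submatrix, inv_one, Matrix.transpose_one, Matrix.fromBlocks_one,
    Matrix.fromBlocks_one, Matrix.submatrix_one_equiv]

theorem diagonal_sq : (Matrix.diagonal ![1, 1, -1] : Matrix (Fin 3) (Fin 3) F) *
    Matrix.diagonal ![1, 1, -1] = 1 := by
  rw [Matrix.diagonal_mul_diagonal, ← Matrix.diagonal_one]
  congr 1
  ext i
  fin_cases i <;> simp

theorem iEmbConj_mul (g h : Matrix.SpecialLinearGroup (Fin 3) F) :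
    iEmbConj (g * h) = iEmbConj g * iEmbConj h := by
  rw [iEmbConj, iEmbConj, iEmbConj, ← iEmb_mul, Matrix.SpecialLinearGroup.coe_mul]
  congr 1
  have h1 := diagonal_sq (F := F)
  generalize (Matrix.diagonal ![1, 1, -1] : Matrix (Fin 3) (Fin 3) F) = d at h1 ⊢
  calc _ = d * (g.1 * 1 * h.1) * d := by rw [mul_one]
    _ = d * (g.1 * (d * d) * h.1) * d := by rw [h1]
    _ = _ := by simp only [mul_assoc]

theorem iEmbConj_one : iEmbConj (1 : Matrix.SpecialLinearGroup (Fin 3) F) = 1 := by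
  rw [iEmbConj, Matrix.SpecialLinearGroup.coe_one, mul_one, diagonal_sq, iEmb_one]

theorem wBetaAt_mulVec (t : F) (ht : t ≠ 0) (v : Fin 8 → F) :
    wBetaAt t *ᵥ v = ![v 0, t * v 2, -t⁻¹ * v 1, v 3, v 4, -t * v 6, t⁻¹ * v 5, v 7] := by
  rw [wBetaAt, ← Matrix.mulVec_mulVec, ← Matrix.mulVec_mulVec]
  ext i
  fin_cases i <;>
    simp [xBeta, xNegBeta, Matrix.mulVec, dotProduct, Fin.sum_univ_eight] <;> field_simp <;> ring

theorem xAlpha_mulVec (r : F) (v : Fin 8 → F) :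
    xAlpha r *ᵥ v = ![v 0 + r * v 1, v 1, v 2 + r * v 3 + r * v 4 - r ^ 2 * v 5, v 3 - r * v 5,
      v 4 - r * v 5, v 5, v 6 - r * v 7, v 7] := by
  ext i
  fin_cases i <;> simp [xAlpha, Matrix.mulVec, dotProduct, Fin.sum_univ_eight] <;> ring

theorem xNegAlpha_mulVec (r : F) (v : Fin 8 → F) :
    xNegAlpha r *ᵥ v = ![v 0, v 1 + r * v 0, v 2, v 3 + r * v 2, v 4 + r * v 2,
      v 5 - r * v 3 - r * v 4 - r ^ 2 * v 2, v 6, v 7 - r * v 6] := by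
  ext i
  fin_cases i <;> simp [xAlpha, xNegAlpha, Matrix.mulVec, dotProduct, Fin.sum_univ_eight] <;> ring

theorem gammaG₂_mulVec_zero {τ : F} (h2 : (2 : F) ≠ 0) (hτ : τ ≠ 0) :
    (gammaG₂ τ * wBetaAt (-1)) *ᵥ ![1, 0, 0, 0, 0, 0, 0, 0] =
      ![2⁻¹, -2⁻¹, 0, 0, 0, 0, 0, 0] := by
  have h : (2 * τ)⁻¹ ≠ 0 := inv_ne_zero (mul_ne_zero h2 hτ)
  simp only [gammaG₂, hBeta, ← Matrix.mulVec_mulVec, wBetaAt_mulVec _ h,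
    wBetaAt_mulVec (-1 : F) (by simp), xAlpha_mulVec, xNegAlpha_mulVec]
  ext i
  fin_cases i <;> simp <;> field_simp <;> ring

theorem gammaG₂_mulVec_one {τ : F} (h2 : (2 : F) ≠ 0) (hτ : τ ≠ 0) :
    (gammaG₂ τ * wBetaAt (-1)) *ᵥ ![0, 1, 0, 0, 0, 0, 0, 0] =
      ![0, 0, τ / 2, -τ / 2, -τ / 2, -τ / 2, 0, 0] := by
  have h : (2 * τ)⁻¹ ≠ 0 := inv_ne_zero (mul_ne_zero h2 hτ)
  simp only [gammaG₂, hBeta, ← Matrix.mulVec_mulVec, wBetaAt_mulVec _ h,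
    wBetaAt_mulVec (-1 : F) (by simp), xAlpha_mulVec, xNegAlpha_mulVec]
  ext i
  fin_cases i <;> simp <;> field_simp <;> ring

theorem mulVec_eq_of_colZero {p : Matrix (Fin 8) (Fin 8) F}
    (hp : ∀ i j : Fin 8, 2 ≤ i → j < 2 → p i j = 0) :
    p *ᵥ ![1, 0, 0, 0, 0, 0, 0, 0] = ![p 0 0, p 1 0, 0, 0, 0, 0, 0, 0] ∧
    p *ᵥ ![0, 1, 0, 0, 0, 0, 0, 0] = ![p 0 1, p 1 1, 0, 0, 0, 0, 0, 0] := by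
  have h0 : ∀ i : Fin 8, 2 ≤ i → p i 0 = 0 := fun i hi => hp i 0 hi (by decide)
  have h1 : ∀ i : Fin 8, 2 ≤ i → p i 1 = 0 := fun i hi => hp i 1 hi (by decide)
  constructor
  · ext i
    have hi := h0 i
    simp only [Matrix.mulVec, dotProduct, Fin.sum_univ_eight]
    fin_cases i <;> simp at hi ⊢ <;> first | rfl | exact hi
  · ext i
    have hi := h1 i
    simp only [Matrix.mulVec, dotProduct, Fin.sum_univ_eight]
    fin_cases i <;> simp at hi ⊢ <;> first | rfl | exact hi

theorem iEmb_mulVec (A : Matrix (Fin 3) (Fin 3) F) (v : Fin 8 → F) :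
    iEmb A *ᵥ v =
      ![A⁻¹ 2 2 * v 0 + A⁻¹ 1 2 * v 5 + A⁻¹ 0 2 * v 6, A 0 0 * v 1 + A 0 1 * v 2 + A 0 2 * v 7,
        A 1 0 * v 1 + A 1 1 * v 2 + A 1 2 * v 7, v 3, v 4,
        A⁻¹ 2 1 * v 0 + A⁻¹ 1 1 * v 5 + A⁻¹ 0 1 * v 6,
        A⁻¹ 2 0 * v 0 + A⁻¹ 1 0 * v 5 + A⁻¹ 0 0 * v 6,
        A 2 0 * v 1 + A 2 1 * v 2 + A 2 2 * v 7] := by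
  ext i
  fin_cases i <;> simp [iEmb, Matrix.mulVec, dotProduct, Fin.sum_univ_eight]

/-- If `w_β j(g)` and `w_β j(g')` lie in the same coset of `P`, then `g` and `g'` differ by an
element of `N₂ T₀`, whose torus part is given by `det p`. -/
theorem eq_mul_of_wBeta_jEmb_eq {τ : F} (h2 : (2 : F) ≠ 0) (hτ : τ ≠ 0)
    {g g' : Matrix.SpecialLinearGroup (Fin 3) F} {p : Matrix (Fin 8) (Fin 8) F} (hp : p ∈ P F)
    (h : wBeta * jEmb τ g = p * wBeta * jEmb τ g') :
    ∃ (r t : F) (s : Fˣ), detP p = s ∧ g = unip r r t * torusSL s 1 * g' := by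
  have hww : wBeta (F := F) * wBetaAt (-1) = 1 := wBetaAt_mul_neg 1
  have hww' : wBetaAt (-1) * wBeta (F := F) = 1 := mul_eq_one_comm.1 hww
  have hγ := gammaG₂_mul_inv τ
  have hγ' : gammaG₂Inv τ * gammaG₂ τ = 1 := mul_eq_one_comm.1 hγ
  set k := g * g'⁻¹ with hk
  have key : iEmbConj k * (gammaG₂ τ * wBetaAt (-1)) = gammaG₂ τ * wBetaAt (-1) * p := by
    have e1 : iEmbConj k = iEmbConj g * iEmbConj g'⁻¹ := iEmbConj_mul _ _
    have e2 : iEmbConj g' * iEmbConj g'⁻¹ = 1 := by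
      rw [← iEmbConj_mul, mul_inv_cancel, iEmbConj_one]
    rw [jEmb_eq, jEmb_eq] at h
    have h3 := congrArg (fun X => gammaG₂ τ * wBetaAt (-1) * X *
      (gammaG₂Inv τ * iEmbConj g'⁻¹ * (gammaG₂ τ * wBetaAt (-1)))) h
    have e3 : gammaG₂ τ * wBetaAt (-1) * (wBeta * (gammaG₂Inv τ * iEmbConj g * gammaG₂ τ)) *
        (gammaG₂Inv τ * iEmbConj g'⁻¹ * (gammaG₂ τ * wBetaAt (-1))) =
        (gammaG₂ τ * (wBetaAt (-1) * wBeta) * gammaG₂Inv τ) * (iEmbConj g *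
          (gammaG₂ τ * gammaG₂Inv τ) * iEmbConj g'⁻¹) * (gammaG₂ τ * wBetaAt (-1)) := by
      simp only [mul_assoc]
    have e4 : gammaG₂ τ * wBetaAt (-1) * (p * wBeta * (gammaG₂Inv τ * iEmbConj g' * gammaG₂ τ)) *
        (gammaG₂Inv τ * iEmbConj g'⁻¹ * (gammaG₂ τ * wBetaAt (-1))) =
        gammaG₂ τ * wBetaAt (-1) * p * (wBeta * (gammaG₂Inv τ * (iEmbConj g' *
          (gammaG₂ τ * gammaG₂Inv τ) * iEmbConj g'⁻¹) * gammaG₂ τ) * wBetaAt (-1)) := by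
      simp only [mul_assoc]
    rw [e3, e4, hww', hγ, mul_one, mul_one, mul_one, hγ, one_mul, e2, mul_one, hγ', mul_one, hww,
      mul_one, ← e1] at h3
    exact h3
  obtain ⟨-, hp⟩ := hp
  obtain ⟨c0, c1⟩ := mulVec_eq_of_colZero hp
  have lin : ∀ a b : F, (gammaG₂ τ * wBetaAt (-1)) *ᵥ ![a, b, 0, 0, 0, 0, 0, 0] =
      a • ![2⁻¹, -2⁻¹, 0, 0, 0, 0, 0, 0] +
        b • ![0, 0, τ / 2, -τ / 2, -τ / 2, -τ / 2, 0, 0] := by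
    intro a b
    rw [← gammaG₂_mulVec_zero h2 hτ, ← gammaG₂_mulVec_one h2 hτ, ← Matrix.mulVec_smul,
      ← Matrix.mulVec_smul, ← Matrix.mulVec_add]
    simp
  have k0 : iEmbConj k *ᵥ ![2⁻¹, -2⁻¹, 0, 0, 0, 0, 0, 0] = p 0 0 • ![2⁻¹, -2⁻¹, 0, 0, 0, 0, 0, 0] +
      p 1 0 • ![0, 0, τ / 2, -τ / 2, -τ / 2, -τ / 2, 0, 0] := by
    rw [← lin, ← c0, ← gammaG₂_mulVec_zero h2 hτ, Matrix.mulVec_mulVec, Matrix.mulVec_mulVec, key]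
  have k1 : iEmbConj k *ᵥ ![0, 0, τ / 2, -τ / 2, -τ / 2, -τ / 2, 0, 0] =
      p 0 1 • ![2⁻¹, -2⁻¹, 0, 0, 0, 0, 0, 0] +
      p 1 1 • ![0, 0, τ / 2, -τ / 2, -τ / 2, -τ / 2, 0, 0] := by
    rw [← lin, ← c1, ← gammaG₂_mulVec_one h2 hτ, Matrix.mulVec_mulVec, Matrix.mulVec_mulVec, key]
  rw [iEmbConj, iEmb_mulVec] at k0 k1
  have hinv : (Matrix.diagonal ![1, 1, -1] * (k : Matrix (Fin 3) (Fin 3) F) *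
      Matrix.diagonal ![1, 1, -1])⁻¹ = Matrix.diagonal ![1, 1, -1] *
        ((k⁻¹ : Matrix.SpecialLinearGroup (Fin 3) F) : Matrix (Fin 3) (Fin 3) F) *
      Matrix.diagonal ![1, 1, -1] := by
    apply Matrix.inv_eq_right_inv
    have hd := diagonal_sq (F := F)
    have hkk : (k : Matrix (Fin 3) (Fin 3) F) *
        ((k⁻¹ : Matrix.SpecialLinearGroup (Fin 3) F) : Matrix (Fin 3) (Fin 3) F) = 1 := by
      rw [← Matrix.SpecialLinearGroup.coe_mul, mul_inv_cancel, Matrix.SpecialLinearGroup.coe_one]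
    generalize (Matrix.diagonal ![1, 1, -1] : Matrix (Fin 3) (Fin 3) F) = d at hd ⊢
    generalize ((k⁻¹ : Matrix.SpecialLinearGroup (Fin 3) F) : Matrix (Fin 3) (Fin 3) F) = B at *
    calc d * k.1 * d * (d * B * d) = d * (k.1 * (d * d) * B) * d := by simp only [mul_assoc]
      _ = 1 := by rw [hd, mul_one, hkk, mul_one, hd]
  rw [hinv] at k0 k1
  have a2 := congrFun k0 2
  have a3 := congrFun k0 3
  have a0 := congrFun k0 0
  have a1 := congrFun k0 1
  have a7 := congrFun k0 7
  have b0 := congrFun k1 0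
  have b1 := congrFun k1 1
  have b2 := congrFun k1 2
  have b3 := congrFun k1 3
  have b7 := congrFun k1 7
  have b5 := congrFun k1 5
  have hdet := k.2
  rw [Matrix.det_fin_three] at hdet
  simp [Matrix.SpecialLinearGroup.coe_inv, Matrix.adjugate_fin_three, h2, hτ] at a0 a1 a2 a3 a7 b0 b1 b2 b3 b7 b5
  have h10 : k 1 0 = 0 := by simpa [a3, h2] using a2
  have h22 : k 0 0 * k 2 2 = 1 := by
    rw [b3, a7, mul_zero, sub_zero] at b5
    exact b5
  have h0 : k 0 0 ≠ 0 := left_ne_zero_of_mul_eq_one h22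
  have h01 : k 0 1 = k 0 0 * k 1 2 := by
    rw [h10] at b0
    have hτ2 : τ / 2 ≠ 0 := div_ne_zero hτ h2
    apply mul_right_cancel₀ hτ2
    linear_combination b1 + b0
  refine ⟨k 0 1, k 0 0 * k 0 2, Units.mk0 _ h0, ?_, ?_⟩
  · rw [detP, a3, b3, ← a1, Units.val_mk0]
    ring
  · rw [← mul_inv_eq_iff_eq_mul, ← hk]
    clear_value k
    ext i j
    rw [Matrix.SpecialLinearGroup.coe_mul]
    fin_cases i <;> fin_cases j <;>
      simp [unip, torusSL, Matrix.mul_apply, Fin.sum_univ_three, h10, a7, b7, b2, b3]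
    · field_simp
    · exact (eq_mul_inv_iff_mul_eq₀ h0).2 ((mul_comm _ _).trans h01.symm)
    · exact eq_inv_of_mul_eq_one_right h22

end G2Computations

section TorusAction

variable {F : Type*} [Field F]

theorem torusSL_one_mul (a b : Fˣ) : torusSL a 1 * torusSL b 1 = torusSL (a * b) 1 := by
  ext i j
  rw [Matrix.SpecialLinearGroup.coe_mul]
  fin_cases i <;> fin_cases j <;>
    simp [torusSL, Matrix.mul_apply, Fin.sum_univ_three, mul_comm]

theorem torusSL_inv (a : Fˣ) : (torusSL a 1)⁻¹ = torusSL a⁻¹ 1 := by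
  rw [inv_eq_iff_mul_eq_one, torusSL_one_mul, mul_inv_cancel]
  ext i j
  fin_cases i <;> fin_cases j <;> simp [torusSL]

theorem torusSL_mul_unip (a : Fˣ) (x y z : F) :
    torusSL a 1 * unip x y z = unip (a * x) (a * y) (a ^ 2 * z) * torusSL a 1 := by
  ext i j
  rw [Matrix.SpecialLinearGroup.coe_mul, Matrix.SpecialLinearGroup.coe_mul]
  fin_cases i <;> fin_cases j <;>
    simp [unip, torusSL, Matrix.mul_apply, Fin.sum_univ_three]
  · field_simp
  · field_simp

theorem unip_inv (x y z : F) : (unip x y z)⁻¹ = unip (-x) (-y) (x * y - z) := by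
  rw [inv_eq_iff_mul_eq_one, unip_mul_unip]
  ext i j
  fin_cases i <;> fin_cases j <;> simp [unip]
  ring

theorem unip_mem_N₂ (r t : F) : unip r r t ∈ N₂ F := ⟨r, t, rfl⟩

theorem torusSL_unip_torusSL_unip_torusSL (a a' b : Fˣ) (r t x : F) :
    ((torusSL a 1)⁻¹ * unip r r t * torusSL a' 1 * unip x 0 0 * torusSL 1 b).1 =
      !![(a' : F) / a, b * ((a' : F) / a * x + r / a), t / (a * a' * b); 0, b, r / (a' * b);
        0, 0, a / (a' * b)] := by
  rw [torusSL_inv]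
  have h1 : (torusSL a⁻¹ 1 * unip r r t).1 = !![(a : F)⁻¹, r / a, t / a; 0, 1, r; 0, 0, a] := by
    rw [Matrix.SpecialLinearGroup.coe_mul]
    ext i j
    fin_cases i <;> fin_cases j <;>
      simp [unip, torusSL, Matrix.mul_apply, Fin.sum_univ_three] <;> ring
  have h2 : (torusSL a' 1 * unip x 0 0 * torusSL 1 b).1 =
      !![(a' : F), a' * x * b, 0; 0, b, 0; 0, 0, ((a' : F) * b)⁻¹] := by
    rw [Matrix.SpecialLinearGroup.coe_mul, Matrix.SpecialLinearGroup.coe_mul]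
    ext i j
    fin_cases i <;> fin_cases j <;>
      simp [unip, torusSL, Matrix.mul_apply, Fin.sum_univ_three] <;> ring
  rw [show (torusSL a⁻¹ 1 * unip r r t * torusSL a' 1 * unip x 0 0 * torusSL 1 b) =
    (torusSL a⁻¹ 1 * unip r r t) * (torusSL a' 1 * unip x 0 0 * torusSL 1 b) by
      simp only [mul_assoc], Matrix.SpecialLinearGroup.coe_mul, h1, h2]
  ext i j
  fin_cases i <;> fin_cases j <;>
    simp [Matrix.mul_apply, Fin.sum_univ_three] <;> field_simp

end TorusAction

section Twist

variable {F : Type*} [NontriviallyNormedField F] [IsUltrametricDist F] {ϖ : Fˣ}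
  {χ : Fˣ →ₜ* ℂˣ} {c : ℕ} {s : ℂ}

theorem twist_units (χ : Fˣ →ₜ* ℂˣ) (s : ℂ) (a : Fˣ) :
    twist χ s (a : F) = (χ a : ℂ) * ((‖(a : F)‖ : ℝ) : ℂ) ^ (3 * s) := by
  rw [twist, dif_neg a.ne_zero, Units.mk0_val]

theorem twist_mul (χ : Fˣ →ₜ* ℂˣ) (s : ℂ) (a b : Fˣ) :
    twist χ s ((a * b : Fˣ) : F) = twist χ s (a : F) * twist χ s (b : F) := by
  rw [twist_units, twist_units, twist_units, map_mul, Units.val_mul, Units.val_mul, norm_mul,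
    Complex.ofReal_mul, Complex.mul_cpow_ofReal_nonneg (norm_nonneg _) (norm_nonneg _)]
  ring

theorem twist_eq_of_norm_eq (hχ : HasConductor χ 0) {a b : Fˣ} (h : ‖(a : F)‖ = ‖(b : F)‖) :
    twist χ s (a : F) = twist χ s (b : F) := by
  rw [twist_units, twist_units, h, hχ.eq_of_norm_eq h]

theorem twist_zpow (hϖ : IsNormalizedUniformizer ϖ) (χ : Fˣ →ₜ* ℂˣ) (s : ℂ) (m : ℕ) :
    twist χ s ((ϖ ^ (m : ℤ) : Fˣ) : F) =
      ((χ ϖ : ℂ) * (resCard F : ℂ) ^ (-(3 * s))) ^ m := by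
  have hq := resCard_pos hϖ
  have h1 : twist χ s (ϖ : F) = (χ ϖ : ℂ) * (resCard F : ℂ) ^ (-(3 * s)) := by
    rw [twist_units, hϖ.2, Complex.ofReal_inv, Complex.cpow_neg, Complex.inv_cpow,
      Complex.ofReal_natCast]
    rw [Complex.ofReal_natCast, Complex.natCast_arg]
    exact Real.pi_pos.ne
  rw [← h1, zpow_natCast]
  induction m with
  | zero =>
    rw [pow_zero, pow_zero, twist_units, map_one]
    simp
  | succ m ih => rw [pow_succ, twist_mul, ih, pow_succ]

theorem torusSL_mem_KSL (hϖ : IsNormalizedUniformizer ϖ) (hc : 1 ≤ c) {a b : Fˣ}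
    (ha : ‖(a : F)‖ = 1) (hb : (b : F) - 1 ∈ fracIdeal F c) : torusSL a b ∈ KSL F c := by
  have hb1 : ‖(b : F)‖ = 1 := norm_eq_one_of_sub_one_mem hϖ (by exact_mod_cast hc) hb
  have hinv : (torusSL a b)⁻¹ = torusSL a⁻¹ b⁻¹ := by
    rw [inv_eq_iff_mul_eq_one]
    ext i j
    rw [Matrix.SpecialLinearGroup.coe_mul]
    fin_cases i <;> fin_cases j <;> simp [torusSL, Matrix.mul_apply, Fin.sum_univ_three]
    field_simp
  have key : ∀ {a b : Fˣ}, ‖(a : F)‖ = 1 → ‖(b : F)‖ = 1 → (b : F) - 1 ∈ fracIdeal F c →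
      KShape c (torusSL a b).1 := by
    intro a b ha hb1 hb
    have h : ∀ n, (0 : F) ∈ fracIdeal F n := zero_mem_fracIdeal
    refine ⟨?_, h _, h _, h _, hb, h _, h _, h _, ?_⟩
    · exact mem_fracIdeal_zero.2 ha.le
    · exact mem_fracIdeal_zero.2 (by simp [torusSL, ha, hb1])
  refine ⟨key ha hb1 hb, ?_⟩
  rw [← map_inv, hinv]
  refine key (by simp [ha]) (by simp [hb1]) ?_
  rw [Units.val_inv_eq_inv_val, mem_fracIdeal,
    show (b : F)⁻¹ - 1 = -((b : F) - 1) * (b : F)⁻¹ by field_simp; ring, norm_mul, norm_neg,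
    norm_inv, hb1, inv_one, mul_one]
  exact hb

/-- The value of the section on the cells which make up its support. -/
theorem sectionSL_eq_twist (hϖ : IsNormalizedUniformizer ϖ) (hc : 1 ≤ c) (hχ : HasConductor χ 0)
    {g n k : Matrix.SpecialLinearGroup (Fin 3) F} {a : Fˣ} (hn : n ∈ N₂ F) (hk : k ∈ KSL F c)
    (hg : g = n * torusSL a 1 * k) : sectionSL χ c s g = twist χ s (a : F) := by
  have hex : ∃ q : Fˣ × Fˣ × F, ∃ n ∈ N₂ F, ∃ k ∈ KSL F c,
      g = n * torusSL q.1 1 * unip q.2.2 0 0 * torusSL 1 q.2.1 * k := by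
    refine ⟨(a, 1, 0), n, hn, k, hk, ?_⟩
    have h1 : unip (0 : F) 0 0 = 1 := by ext i j; fin_cases i <;> fin_cases j <;> simp [unip]
    have h2 : torusSL (1 : Fˣ) 1 = 1 := by ext i j; fin_cases i <;> fin_cases j <;> simp [torusSL]
    rw [hg, h1, h2, mul_one, mul_one]
  rw [sectionSL, dif_pos hex]
  obtain ⟨n', hn', k', hk', hg'⟩ := hex.choose_spec
  generalize hex.choose = q at hg' ⊢
  obtain ⟨a', b, x⟩ := q
  dsimp only at hg' ⊢
  obtain ⟨r, t, hrt⟩ : n⁻¹ * n' ∈ N₂ F := mul_mem (inv_mem hn) hn'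
  have hmem : k * k'⁻¹ ∈ KSL F c := KSL_mul_mem hϖ hk (KSL_inv_mem hk')
  have heq : k * k'⁻¹ =
      (torusSL a 1)⁻¹ * unip r r t * torusSL a' 1 * unip x 0 0 * torusSL 1 b := by
    rw [← hrt, mul_inv_eq_iff_eq_mul]
    rw [hg'] at hg
    calc k = (torusSL a 1)⁻¹ * n⁻¹ * (n * torusSL a 1 * k) := by group
      _ = _ := by rw [← hg]; group
  rw [heq] at hmem
  obtain ⟨k00, k01, -, -, k11, k12, -, -, k22⟩ := hmem.1
  have hM := torusSL_unip_torusSL_unip_torusSL a a' b r t x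
  rw [Matrix.SpecialLinearGroup.coe_GL_coe_matrix] at k00 k01 k11 k12 k22
  rw [hM] at k00 k01 k11 k12 k22
  simp only [Matrix.of_apply, Matrix.cons_val', Matrix.cons_val_zero, Matrix.cons_val_one,
    Matrix.cons_val, Matrix.cons_val_fin_one] at k00 k01 k11 k12 k22
  have hb1 : ‖(b : F)‖ = 1 := norm_eq_one_of_sub_one_mem hϖ (by exact_mod_cast hc) k11
  have ha0 : 0 < ‖(a : F)‖ := norm_pos_iff.2 a.ne_zero
  have ha0' : 0 < ‖(a' : F)‖ := norm_pos_iff.2 a'.ne_zero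
  simp only [mem_fracIdeal_zero, norm_mul, norm_div, hb1, one_mul, mul_one] at k00 k01 k12 k22
  rw [div_le_one ha0] at k00
  rw [div_le_one ha0'] at k22 k12
  have haa : ‖(a' : F)‖ = ‖(a : F)‖ := le_antisymm k00 k22
  have hx : x ∈ fracIdeal F 0 := by
    have h1 : ‖r / (a : F)‖ ≤ 1 := by rw [norm_div, div_le_one ha0, ← haa]; exact k12
    have h2 := norm_sub_le_of_le k01 h1
    rw [add_sub_cancel_right, norm_mul, norm_div, haa, div_self ha0.ne', one_mul] at h2
    exact mem_fracIdeal_zero.2 h2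
  rw [Set.indicator_of_mem (by exact k11), Set.indicator_of_mem hx, mul_one, mul_one]
  exact twist_eq_of_norm_eq hχ haa

/-- The support of the section. -/
theorem exists_of_sectionSL_ne_zero (hϖ : IsNormalizedUniformizer ϖ) (hc : 1 ≤ c)
    {g : Matrix.SpecialLinearGroup (Fin 3) F} (hg : sectionSL χ c s g ≠ 0) :
    ∃ n ∈ N₂ F, ∃ a : Fˣ, ∃ k ∈ KSL F c, g = n * torusSL a 1 * k := by
  rw [sectionSL] at hg
  split_ifs at hg with hex
  · obtain ⟨n', hn', k', hk', hg'⟩ := hex.choose_spec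
    generalize hex.choose = q at hg hg'
    obtain ⟨a', b, x⟩ := q
    dsimp only at hg hg'
    have hb : (b : F) - 1 ∈ fracIdeal F c := by
      by_contra h
      exact hg (by rw [Set.indicator_of_notMem (by exact h), mul_zero, zero_mul])
    have hx : x ∈ fracIdeal F 0 := by
      by_contra h
      exact hg (by rw [Set.indicator_of_notMem h, mul_zero])
    refine ⟨n', hn', a', unip x 0 0 * torusSL 1 b * k', ?_, by rw [hg']; simp only [mul_assoc]⟩
    exact KSL_mul_mem hϖ (KSL_mul_mem hϖ (unip_mem_K hϖ (zero_mem_fracIdeal _) hx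
      (zero_mem_fracIdeal _)) (torusSL_mem_KSL hϖ hc (by simp) hb)) hk'
  · exact absurd rfl hg

theorem sectionSL_torusSL_mul (hϖ : IsNormalizedUniformizer ϖ) (hc : 1 ≤ c)
    (hχ : HasConductor χ 0) (r t : F) (a : Fˣ) (g : Matrix.SpecialLinearGroup (Fin 3) F) :
    sectionSL χ c s (unip r r t * torusSL a 1 * g) = twist χ s (a : F) * sectionSL χ c s g := by
  by_cases hex : ∃ n ∈ N₂ F, ∃ b : Fˣ, ∃ k ∈ KSL F c, g = n * torusSL b 1 * k
  · obtain ⟨_, ⟨r', t', rfl⟩, b, k, hk, hg⟩ := hex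
    rw [sectionSL_eq_twist hϖ hc hχ (unip_mem_N₂ r' t') hk hg, ← twist_mul]
    refine sectionSL_eq_twist hϖ hc hχ (n := unip r r t * unip (a * r') (a * r') (a ^ 2 * t'))
      (mul_mem (unip_mem_N₂ _ _) (unip_mem_N₂ _ _)) hk ?_
    rw [hg, ← torusSL_one_mul]
    simp only [← mul_assoc]
    rw [mul_assoc (unip r r t) (torusSL a 1), torusSL_mul_unip]
    simp only [mul_assoc]
  · have h0 : sectionSL χ c s g = 0 := by
      by_contra h
      exact hex (exists_of_sectionSL_ne_zero hϖ hc h)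
    rw [h0, mul_zero]
    by_contra h
    obtain ⟨_, ⟨r', t', rfl⟩, b, k, hk, hg⟩ := exists_of_sectionSL_ne_zero hϖ hc h
    refine hex ⟨unip (((a⁻¹ : Fˣ) : F) * (r' - r)) (((a⁻¹ : Fˣ) : F) * (r' - r))
      (((a⁻¹ : Fˣ) : F) ^ 2 * ((r * r - t) + (t' + -r * r'))), unip_mem_N₂ _ _, a⁻¹ * b, k, hk, ?_⟩
    have h1 : g = torusSL a⁻¹ 1 * ((unip r r t)⁻¹ * unip r' r' t') * torusSL b 1 * k := by
      rw [← torusSL_inv]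
      calc g = (torusSL a 1)⁻¹ * ((unip r r t)⁻¹ * (unip r r t * torusSL a 1 * g)) := by group
        _ = _ := by rw [hg]; group
    rw [h1, unip_inv, unip_mul_unip, torusSL_mul_unip, ← torusSL_one_mul, neg_add_eq_sub]
    simp only [mul_assoc]

theorem one_mem_P : (1 : Matrix (Fin 8) (Fin 8) F) ∈ P F := by
  refine ⟨one_mem _, fun i j hi hj => Matrix.one_apply_ne ?_⟩
  rintro rfl
  exact absurd hi (not_le.2 hj)

/-- The extension of the section to `G₂(F)` restricts to the section on `w_β H_ρ`. -/
theorem extendToG₂_wBeta_jEmb (h_two : (2 : F) ≠ 0) (hϖ : IsNormalizedUniformizer ϖ) (hc : 1 ≤ c)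
    (hχ : HasConductor χ 0) {τ : F} (hτ : τ ≠ 0) (g : Matrix.SpecialLinearGroup (Fin 3) F) :
    extendToG₂ τ χ s (sectionSL χ c s) (wBeta * jEmb τ g) = sectionSL χ c s g := by
  have hex : ∃ q : Matrix (Fin 8) (Fin 8) F × Matrix.SpecialLinearGroup (Fin 3) F,
      q.1 ∈ P F ∧ wBeta * jEmb τ g = q.1 * wBeta * jEmb τ q.2 :=
    ⟨(1, g), one_mem_P, by rw [one_mul]⟩
  rw [extendToG₂, dif_pos hex]
  obtain ⟨hp, h⟩ := hex.choose_spec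
  obtain ⟨r, t, a, hdet, hg⟩ := eq_mul_of_wBeta_jEmb_eq h_two hτ hp h
  rw [hdet, ← sectionSL_torusSL_mul hϖ hc hχ r t a, ← hg]

end Twist

section Cells

variable {F : Type*} [NontriviallyNormedField F] [IsUltrametricDist F] {ϖ : Fˣ} {c : ℕ}

/-- The double coset `N₂ h(a, 1) (K_c ∩ SL₃(F))`. -/
def cell (c : ℕ) (a : Fˣ) : Set (Matrix.SpecialLinearGroup (Fin 3) F) :=
  {g | ∃ n ∈ N₂ F, ∃ k ∈ KSL F c, g = n * torusSL a 1 * k}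

theorem mul_mem_cell_iff {a : Fˣ} {n g : Matrix.SpecialLinearGroup (Fin 3) F} (hn : n ∈ N₂ F) :
    n * g ∈ cell c a ↔ g ∈ cell c a := by
  constructor
  · rintro ⟨n', hn', k, hk, h⟩
    refine ⟨n⁻¹ * n', mul_mem (inv_mem hn) hn', k, hk, ?_⟩
    calc g = n⁻¹ * (n * g) := by group
      _ = _ := by rw [h]; group
  · rintro ⟨n', hn', k, hk, rfl⟩
    exact ⟨n * n', mul_mem hn hn', k, hk, by simp only [mul_assoc]⟩

theorem exists_out_eq_mul (g : Matrix.SpecialLinearGroup (Fin 3) F) :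
    ∃ n ∈ N₂ F, (Quotient.mk (QuotientGroup.rightRel (N₂ F)) g).out = n * g := by
  have h : (QuotientGroup.rightRel (N₂ F)).r
    (Quotient.mk (QuotientGroup.rightRel (N₂ F)) g).out g := Quotient.mk_out g
  have h2 := QuotientGroup.rightRel_apply.1 h
  refine ⟨_, inv_mem h2, ?_⟩
  group

theorem cell_disjoint (hϖ : IsNormalizedUniformizer ϖ) (hc : 1 ≤ c) {m m' : ℤ}
    {g : Matrix.SpecialLinearGroup (Fin 3) F} (h : g ∈ cell c (ϖ ^ m)) (h' : g ∈ cell c (ϖ ^ m')) :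
    m = m' := by
  obtain ⟨n, hn, k, hk, e⟩ := h
  obtain ⟨n', hn', k', hk', e'⟩ := h'
  have h1 : HasConductor (1 : Fˣ →ₜ* ℂˣ) 0 := ⟨fun a _ => rfl, fun n _ => Nat.zero_le n⟩
  have h2 := sectionSL_eq_twist (s := 1 / 3) hϖ hc h1 hn hk e
  rw [sectionSL_eq_twist (s := 1 / 3) hϖ hc h1 hn' hk' e', twist_units, twist_units,
    norm_uniformizer_zpow hϖ, norm_uniformizer_zpow hϖ] at h2
  simp only [ContinuousMonoidHom.one_toFun, Units.val_one, one_mul] at h2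
  rw [show (3 : ℂ) * (1 / 3) = 1 by norm_num, Complex.cpow_one, Complex.cpow_one,
    Complex.ofReal_inj] at h2
  have := zpow_right_injective₀ (resCard_pos hϖ) (one_lt_resCard hϖ).ne' h2
  omega

theorem isOpen_KSL (hϖ : IsNormalizedUniformizer ϖ) (c : ℕ) : IsOpen (KSL F c) := by
  have h : ∀ i j, Continuous fun g : Matrix.SpecialLinearGroup (Fin 3) F => g.1 i j := fun i j =>
    (continuous_subtype_val).matrix_elem i j
  have h' : ∀ {f : Matrix.SpecialLinearGroup (Fin 3) F → F}, Continuous f → ∀ n : ℤ,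
      IsOpen {g | f g ∈ fracIdeal F n} := fun hf n => (isOpen_fracIdeal hϖ n).preimage hf
  have hS : IsOpen {g : Matrix.SpecialLinearGroup (Fin 3) F | KShape c g.1} := by
    refine (h' (h 0 0) _).inter <| (h' (h 0 1) _).inter <| (h' (h 0 2) _).inter <|
      (h' (h 1 0) _).inter <| (h' ((h 1 1).sub continuous_const) _).inter <|
      (h' (h 1 2) _).inter <| (h' (h 2 0) _).inter <| (h' (h 2 1) _).inter (h' (h 2 2) _)
  have h2 : KSL F c = {g : Matrix.SpecialLinearGroup (Fin 3) F | KShape c g.1} ∩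
      (fun g => g⁻¹) ⁻¹' {g : Matrix.SpecialLinearGroup (Fin 3) F | KShape c g.1} := by
    ext g
    change _ ∧ _ ↔ _ ∧ _
    rw [← map_inv]
    rfl
  rw [h2]
  exact hS.inter (hS.preimage continuous_inv)

theorem isCompact_KSL [LocallyCompactSpace F] (hϖ : IsNormalizedUniformizer ϖ) (c : ℕ) :
    IsCompact (KSL F c) := by
  have hcl : IsClosed (KSL F c) := by
    have hG : ∃ H : Subgroup (Matrix.SpecialLinearGroup (Fin 3) F), (H : Set _) = KSL F c :=
      ⟨{ carrier := KSL F c, mul_mem' := KSL_mul_mem hϖ, one_mem' := KSL_one_mem,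
         inv_mem' := KSL_inv_mem }, rfl⟩
    obtain ⟨H, hH⟩ := hG
    rw [← hH]
    exact Subgroup.isClosed_of_isOpen H (by rw [hH]; exact isOpen_KSL hϖ c)
  have hemb : IsClosedEmbedding
      (Subtype.val : Matrix.SpecialLinearGroup (Fin 3) F → Matrix (Fin 3) (Fin 3) F) :=
    (isClosed_eq (Continuous.matrix_det continuous_id) continuous_const).isClosedEmbedding_subtypeVal
  have hK : IsCompact {A : Matrix (Fin 3) (Fin 3) F | ∀ i j, A i j ∈ fracIdeal F (-c)} := by
    have h := isCompact_univ_pi (fun _ : Fin 3 => isCompact_univ_pi (fun _ : Fin 3 =>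
      isCompact_fracIdeal (F := F) (-c)))
    have e : {A : Fin 3 → Fin 3 → F | ∀ i j, A i j ∈ fracIdeal F (-c)} =
        Set.univ.pi fun _ => Set.univ.pi fun _ => fracIdeal F (-c) := by
      ext A
      simp [Set.mem_pi]
    exact e ▸ h
  refine (hemb.isCompact_preimage hK).of_isClosed_subset hcl ?_
  rintro g ⟨⟨h00, h01, h02, h10, h11, h12, h20, h21, h22⟩, -⟩ i j
  have e : ∀ {n : ℤ} {x : F}, -(c : ℤ) ≤ n → x ∈ fracIdeal F n → x ∈ fracIdeal F (-c) :=
    fun hn hx => fracIdeal_anti hϖ hn hx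
  have h11' := mem_fracIdeal_zero_of_sub_one_mem hϖ h11
  fin_cases i <;> fin_cases j
  exacts [e (by omega) h00, e (by omega) h01, h02, e (by omega) h10, e (by omega) h11',
    e (by omega) h12, e (by omega) h20, e (by omega) h21, e (by omega) h22]

theorem isOpen_cell (hϖ : IsNormalizedUniformizer ϖ) (a : Fˣ) : IsOpen (cell (F := F) c a) := by
  have h : cell (F := F) c a = ⋃ n ∈ N₂ F, (fun g => (n * torusSL a 1)⁻¹ * g) ⁻¹' KSL F c := by
    ext g
    simp only [Set.mem_iUnion, Set.mem_preimage, exists_prop]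
    constructor
    · rintro ⟨n, hn, k, hk, rfl⟩
      exact ⟨n, hn, by rwa [inv_mul_cancel_left]⟩
    · rintro ⟨n, hn, hk⟩
      exact ⟨n, hn, _, hk, by rw [mul_inv_cancel_left]⟩
  rw [h]
  exact isOpen_biUnion fun n _ => (isOpen_KSL hϖ c).preimage (continuous_const_mul _)

/-- The image of a cell in `N₂ \ SL₃(F)`. -/
def quotCell (c : ℕ) (a : Fˣ) : Set (QuotN₂ F) := {x | x.out ∈ cell c a}

theorem unip_mem_KSL_iff (hϖ : IsNormalizedUniformizer ϖ) {r t : F} :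
    unip r r t ∈ KSL F c ↔ r ∈ fracIdeal F 0 ∧ t ∈ fracIdeal F (-c) :=
  ⟨fun h => ⟨h.1.2.1, h.1.2.2.1⟩, fun h => unip_mem_K hϖ h.2 h.1 h.1⟩

end Cells

section QuotientMeasure

variable {F : Type*} [NontriviallyNormedField F] [IsUltrametricDist F] [LocallyCompactSpace F]
  [MeasurableSpace F] [BorelSpace F] [SecondCountableTopology F]
  [MeasurableSpace (Matrix.SpecialLinearGroup (Fin 3) F)]
  [BorelSpace (Matrix.SpecialLinearGroup (Fin 3) F)] {ϖ : Fˣ} {c : ℕ}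
  (dx : Measure F) [dx.IsAddHaarMeasure] (hdx : dx (fracIdeal F 0) = 1)
  (dg : Measure (Matrix.SpecialLinearGroup (Fin 3) F)) [dg.IsHaarMeasure]
  (ν : Measure (QuotN₂ F)) (hν : IsQuotientMeasure dx dg ν)

theorem measurableSet_quotCell (hϖ : IsNormalizedUniformizer ϖ) (a : Fˣ) :
    MeasurableSet (quotCell (F := F) c a) := by
  rw [measurableSet_quotient]
  have h : (Quotient.mk'' : _ → QuotN₂ F) ⁻¹' quotCell c a = cell c a := by
    ext g
    obtain ⟨n, hn, e⟩ := exists_out_eq_mul g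
    rw [← mul_mem_cell_iff (c := c) (a := a) (g := g) hn, ← e]
    rfl
  rw [h]
  exact (isOpen_cell hϖ a).measurableSet

theorem measurePreserving_N₂_translate (r t : F) :
    MeasurePreserving (fun p : F × F => (p.1 + r, p.2 + (t + p.1 * r))) (dx.prod dx)
      (dx.prod dx) :=
  (measurePreserving_add_right dx r).skew_product (μc := dx) (μd := dx)
    (g := fun (x w : F) => w + (t + x * r)) (by fun_prop)
    (Eventually.of_forall fun x => (measurePreserving_add_right dx (t + x * r)).map_eq)

include hdx in
theorem measure_N₂_inter (hϖ : IsNormalizedUniformizer ϖ) (m : ℤ) (r t : F)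
    {k : Matrix.SpecialLinearGroup (Fin 3) F} (hk : k ∈ KSL F c) :
    dx.prod dx {p : F × F | (torusSL (ϖ ^ m) 1)⁻¹ *
      (unip p.1 p.1 p.2 * (unip r r t * torusSL (ϖ ^ m) 1 * k)) ∈ KSL F c} =
    ENNReal.ofReal ((resCard F : ℝ) ^ (-(3 * m) + c)) := by
  have hϖm := norm_uniformizer_zpow hϖ (-m)
  have h1 : {p : F × F | (torusSL (ϖ ^ m) 1)⁻¹ *
      (unip p.1 p.1 p.2 * (unip r r t * torusSL (ϖ ^ m) 1 * k)) ∈ KSL F c} =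
      (fun p : F × F => (p.1 + r, p.2 + (t + p.1 * r))) ⁻¹'
        (fracIdeal F m ×ˢ fracIdeal F (2 * m - c)) := by
    ext ⟨x, y⟩
    simp only [Set.mem_ofPred_eq, Set.mem_preimage, Set.mem_prod]
    have e : (torusSL (ϖ ^ m) 1)⁻¹ * (unip x x y * (unip r r t * torusSL (ϖ ^ m) 1 * k)) =
        unip (((ϖ ^ (-m) : Fˣ) : F) * (x + r)) (((ϖ ^ (-m) : Fˣ) : F) * (x + r))
          (((ϖ ^ (-m) : Fˣ) : F) ^ 2 * (y + (t + x * r))) * k := by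
      rw [torusSL_inv, ← zpow_neg, mul_assoc (unip r r t), ← mul_assoc (unip x x y),
        unip_mul_unip, ← mul_assoc, torusSL_mul_unip, mul_assoc (unip _ _ _),
        ← mul_assoc (torusSL _ 1), torusSL_one_mul, ← zpow_add, neg_add_cancel, zpow_zero]
      congr 1
      rw [show torusSL (1 : Fˣ) 1 = 1 by
        ext i j; fin_cases i <;> fin_cases j <;> simp [torusSL], one_mul]
    have e2 : ∀ X : F, X ∈ fracIdeal F m ↔ ((ϖ ^ (-m) : Fˣ) : F) * X ∈ fracIdeal F 0 := by
      intro X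
      have := preimage_mul_left_fracIdeal hϖ hϖm 0
      rw [← Set.mem_preimage (f := fun X => ((ϖ ^ (-m) : Fˣ) : F) * X), this]
      simp
    have e3 : ∀ X : F, X ∈ fracIdeal F (2 * m - c) ↔
        ((ϖ ^ (-m) : Fˣ) : F) ^ 2 * X ∈ fracIdeal F (-c) := by
      intro X
      have := preimage_mul_left_fracIdeal hϖ (a := ((ϖ ^ (-m) : Fˣ) : F) ^ 2) (k := 2 * m)
        (by rw [norm_pow, hϖm, ← zpow_natCast, ← zpow_mul]; congr 1; push_cast; ring) (-c)
      rw [← Set.mem_preimage (f := fun X => ((ϖ ^ (-m) : Fˣ) : F) ^ 2 * X), this,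
        neg_add_eq_sub]
    rw [e2, e3, ← unip_mem_KSL_iff hϖ, e]
    constructor
    · intro h
      have := KSL_mul_mem hϖ h (KSL_inv_mem hk)
      rwa [mul_inv_cancel_right] at this
    · intro h
      exact KSL_mul_mem hϖ h hk
  rw [h1, (measurePreserving_N₂_translate dx r t).measure_preimage
    ((measurableSet_fracIdeal _).prod (measurableSet_fracIdeal _)).nullMeasurableSet,
    Measure.prod_prod, measure_fracIdeal dx hdx hϖ, measure_fracIdeal dx hdx hϖ,
    ← ENNReal.ofReal_mul (zpow_pos (resCard_pos hϖ) _).le, ← zpow_add₀ (resCard_pos hϖ).ne']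
  congr 2
  ring

include hdx hν in
theorem measure_quotCell (hϖ : IsNormalizedUniformizer ϖ) (m : ℤ) :
    ν (quotCell c (ϖ ^ m)) =
      ENNReal.ofReal ((resCard F : ℝ) ^ (3 * m - c)) * dg (KSL F c) := by
  set h : Matrix.SpecialLinearGroup (Fin 3) F := torusSL (ϖ ^ m) 1 with hh
  have hS : MeasurableSet ((fun g => h⁻¹ * g) ⁻¹' KSL F c) :=
    ((isOpen_KSL hϖ c).preimage (continuous_const_mul _)).measurableSet
  have h1 := hν (((fun g => h⁻¹ * g) ⁻¹' KSL F c).indicator 1) (measurable_one.indicator hS)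
  rw [lintegral_indicator_one hS, measure_preimage_mul] at h1
  have h2 : ∀ x : QuotN₂ F, ∫⁻ p : F × F, ((fun g => h⁻¹ * g) ⁻¹' KSL F c).indicator 1
      (unip p.1 p.1 p.2 * x.out) ∂(dx.prod dx) =
      (quotCell c (ϖ ^ m)).indicator
        (fun _ => ENNReal.ofReal ((resCard F : ℝ) ^ (-(3 * m) + c))) x := by
    intro x
    by_cases hx : x ∈ quotCell c (ϖ ^ m)
    · rw [Set.indicator_of_mem hx]
      obtain ⟨_, ⟨r, t, rfl⟩, k, hk, e⟩ := hx
      have h3 := measure_N₂_inter dx hdx hϖ m r t hk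
      rw [← h3, e]
      have hcont : Continuous fun p : F × F => h⁻¹ * (unip p.1 p.1 p.2 * (unip r r t * h * k)) := by
        refine continuous_const.mul (Continuous.mul ?_ continuous_const)
        refine Continuous.subtype_mk ?_ _
        refine continuous_matrix fun i j => ?_
        fin_cases i <;> fin_cases j <;> simp <;> fun_prop
      have hmeas : MeasurableSet {p : F × F | h⁻¹ * (unip p.1 p.1 p.2 * (unip r r t * h * k)) ∈
          KSL F c} := ((isOpen_KSL hϖ c).preimage hcont).measurableSet
      rw [← lintegral_indicator_one hmeas]
      rfl
    · rw [Set.indicator_of_notMem hx]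
      rw [← lintegral_zero (μ := dx.prod dx)]
      congr 1
      ext p
      refine Set.indicator_of_notMem (fun hp => hx ?_) _
      refine (mul_mem_cell_iff (unip_mem_N₂ p.1 p.2)).1 ?_
      exact ⟨1, one_mem _, _, hp, by rw [one_mul, ← hh, mul_inv_cancel_left]⟩
  simp only [h2] at h1
  rw [lintegral_indicator_const (measurableSet_quotCell hϖ _)] at h1
  rw [h1, ← mul_assoc, ← ENNReal.ofReal_mul (zpow_pos (resCard_pos hϖ) _).le,
    ← zpow_add₀ (resCard_pos hϖ).ne', show 3 * m - (c : ℤ) + (-(3 * m) + c) = 0 by ring, zpow_zero,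
    ENNReal.ofReal_one, one_mul]

end QuotientMeasure

section Series

theorem sum_antidiagonal_eq (u Y : ℂ) (hu : u ≠ 0) (m : ℕ) :
    ∑ p ∈ Finset.HasAntidiagonal.antidiagonal m, (u * Y) ^ p.1 * (u⁻¹ * Y) ^ p.2 =
      Y ^ m * (u ^ m)⁻¹ * ∑ i ∈ Finset.range (m + 1), u ^ (2 * i) := by
  rw [Finset.Nat.sum_antidiagonal_eq_sum_range_succ (fun i j => (u * Y) ^ i * (u⁻¹ * Y) ^ j),
    Finset.mul_sum]
  refine Finset.sum_congr rfl fun i hi => ?_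
  obtain ⟨j, rfl⟩ := Nat.exists_eq_add_of_le (Nat.lt_succ_iff.1 (Finset.mem_range.1 hi))
  rw [Nat.add_sub_cancel_left, mul_pow, mul_pow, inv_pow]
  field_simp
  ring

theorem sum_range_odd (u : ℂ) (m : ℕ) :
    ∑ j ∈ Finset.range (2 * (m + 1) + 1), u ^ j =
      ∑ i ∈ Finset.range (m + 2), u ^ (2 * i) + u * ∑ i ∈ Finset.range (m + 1), u ^ (2 * i) := by
  induction m with
  | zero => simp [Finset.sum_range_succ]; ring
  | succ m ih =>
    rw [show 2 * (m + 1 + 1) + 1 = 2 * (m + 1) + 1 + 1 + 1 by ring, Finset.sum_range_succ,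
      Finset.sum_range_succ, ih, Finset.sum_range_succ _ (m + 1 + 1),
      Finset.sum_range_succ _ (m + 1)]
    ring

/-- The generating series of the values of the Whittaker function on the torus. -/
theorem hasSum_torus_series {u Y : ℂ} (hu : u ≠ 0) (h1 : ‖u * Y‖ < 1) (h2 : ‖u⁻¹ * Y‖ < 1) :
    HasSum (fun m : ℕ => Y ^ m * (u ^ m)⁻¹ * ∑ j ∈ Finset.range (2 * m + 1), u ^ j)
      ((1 + Y) / ((1 - u * Y) * (1 - u⁻¹ * Y))) := by
  have s1 := summable_geometric_of_norm_lt_one h1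
  have s2 := summable_geometric_of_norm_lt_one h2
  have hs := (summable_norm_sum_mul_antidiagonal_of_summable_norm s1.norm s2.norm).of_norm
  have ht := tsum_mul_tsum_eq_tsum_sum_antidiagonal_of_summable_norm s1.norm s2.norm
  rw [tsum_geometric_of_norm_lt_one h1, tsum_geometric_of_norm_lt_one h2, ← mul_inv] at ht
  have hc := hs.hasSum
  rw [← ht] at hc
  simp only [sum_antidiagonal_eq u Y hu] at hc
  set cf : ℕ → ℂ := fun m => Y ^ m * (u ^ m)⁻¹ * ∑ i ∈ Finset.range (m + 1), u ^ (2 * i) with hcf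
  set e : ℕ → ℂ := fun m => Nat.casesOn m 0 fun k => Y * cf k with he
  have hsum_e : HasSum e (Y * ((1 - u * Y) * (1 - u⁻¹ * Y))⁻¹) := by
    have h := (hasSum_nat_add_iff (f := e) 1 (g := Y * ((1 - u * Y) * (1 - u⁻¹ * Y))⁻¹)).1
      (hc.mul_left Y)
    simpa [he] using h
  have h3 := hc.add hsum_e
  rw [← one_add_mul, ← div_eq_mul_inv] at h3
  have key : (fun m : ℕ => Y ^ m * (u ^ m)⁻¹ * ∑ j ∈ Finset.range (2 * m + 1), u ^ j) =
      fun m => cf m + e m := by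
    ext m
    cases m with
    | zero => simp [he, hcf]
    | succ m =>
      simp only [he, hcf]
      rw [sum_range_odd]
      field_simp
      ring
  rw [key]
  exact h3

end Series

section ZetaIntegral

variable {F : Type*} [NontriviallyNormedField F] [IsUltrametricDist F] [LocallyCompactSpace F]
  [MeasurableSpace F] [BorelSpace F] [SecondCountableTopology F]
  [MeasurableSpace (Matrix.SpecialLinearGroup (Fin 3) F)]
  [BorelSpace (Matrix.SpecialLinearGroup (Fin 3) F)] {ϖ : Fˣ} {c : ℕ}
  (dx : Measure F) [dx.IsAddHaarMeasure] (hdx : dx (fracIdeal F 0) = 1)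
  (dg : Measure (Matrix.SpecialLinearGroup (Fin 3) F)) [dg.IsHaarMeasure]
  (ν : Measure (QuotN₂ F)) (hν : IsQuotientMeasure dx dg ν)
  {ψ : AddChar F Circle} {μ₁ μ₂ μ₃ χ : Fˣ →ₜ* ℂˣ} {τ : F} {s : ℂ}

include hdx in
theorem whittaker_one (D : IsNewFormDatum ϖ μ₁ μ₂ μ₃ c) (hψ : IsUnramifiedAddChar ψ) :
    whittaker dx ψ (newForm μ₁ μ₂ μ₃ c) 1 = (resCard F : ℂ) ^ (-c : ℤ) * (μ₁ ϖ : ℂ) ^ (2 * c) *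
        (1 - (μ₁ ϖ : ℂ) ^ 2 * (resCard F : ℂ)⁻¹) := by
  have h := whittaker_eq dx hdx D hψ 0 0 0 K_one_mem
  have h1 : (unip 0 0 0 : Matrix.SpecialLinearGroup (Fin 3) F) = 1 := by
    ext i j; fin_cases i <;> fin_cases j <;> simp [unip]
  have h2 : torusSL (1 : Fˣ) 1 = 1 := by ext i j; fin_cases i <;> fin_cases j <;> simp [torusSL]
  rw [zpow_zero, h1, h2, map_one, mul_one, mul_one] at h
  simpa using h

include hdx in
theorem zetaIntegrand_eq_of_mem (D : IsNewFormDatum ϖ μ₁ μ₂ μ₃ c) (hψ : IsUnramifiedAddChar ψ)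
    (hχ : HasConductor χ 0) (h_two : (2 : F) ≠ 0) (hτ : τ ≠ 0) {m : ℕ} {x : QuotN₂ F}
    (hx : x ∈ quotCell c (ϖ ^ (m : ℤ))) :
    zetaIntegrand τ (whittaker dx ψ (newForm μ₁ μ₂ μ₃ c))
      (extendToG₂ τ χ s (sectionSL χ c s)) x =
    whittaker dx ψ (newForm μ₁ μ₂ μ₃ c) 1 *
      ((((μ₁ ϖ : ℂ) ^ 2) ^ m)⁻¹ * ((resCard F : ℂ) ^ (2 * m))⁻¹ *
        ((χ ϖ : ℂ) * (resCard F : ℂ) ^ (-(3 * s))) ^ m *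
        ∑ j ∈ Finset.range (2 * m + 1), ((μ₁ ϖ : ℂ) ^ 2) ^ j) := by
  obtain ⟨_, ⟨r, t, rfl⟩, k, hk, e⟩ := hx
  rw [zetaIntegrand, extendToG₂_wBeta_jEmb h_two D.unif D.one_le hχ hτ,
    sectionSL_eq_twist D.unif D.one_le hχ (unip_mem_N₂ r t) hk e, twist_zpow D.unif, e, map_mul,
    map_mul, whittaker_eq dx hdx D hψ m r t hk, if_neg (by omega), whittaker_one dx hdx D hψ,
    Int.toNat_natCast]
  ring

include hdx in
theorem zetaIntegrand_eq_zero (D : IsNewFormDatum ϖ μ₁ μ₂ μ₃ c) (hψ : IsUnramifiedAddChar ψ)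
    (hχ : HasConductor χ 0) (h_two : (2 : F) ≠ 0) (hτ : τ ≠ 0) {x : QuotN₂ F}
    (hx : ∀ m : ℕ, x ∉ quotCell c (ϖ ^ (m : ℤ))) :
    zetaIntegrand τ (whittaker dx ψ (newForm μ₁ μ₂ μ₃ c))
      (extendToG₂ τ χ s (sectionSL χ c s)) x = 0 := by
  by_contra h
  rw [zetaIntegrand, extendToG₂_wBeta_jEmb h_two D.unif D.one_le hχ hτ] at h
  obtain ⟨_, ⟨r, t, rfl⟩, a, k, hk, e⟩ :=
    exists_of_sectionSL_ne_zero D.unif D.one_le (right_ne_zero_of_mul h)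
  obtain ⟨m, u, hu, rfl⟩ := exists_unit_mul_zpow D.unif a
  have hk' : torusSL u 1 * k ∈ KSL F c := KSL_mul_mem D.unif
    (torusSL_mem_KSL D.unif D.one_le hu (by simpa using zero_mem_fracIdeal _)) hk
  rw [mul_comm u, ← torusSL_one_mul, ← mul_assoc, mul_assoc] at e
  rcases lt_or_ge m 0 with hm | hm
  · rw [e, map_mul, map_mul, whittaker_eq dx hdx D hψ m r t hk', if_pos hm, zero_mul] at h
    exact h rfl
  · obtain ⟨m, rfl⟩ := Int.eq_ofNat_of_zero_le hm
    exact hx m ⟨_, unip_mem_N₂ r t, _, hk', e⟩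

theorem measureReal_unit_coset (c : ℕ) :
    dx.real {b : F | b - 1 ∈ fracIdeal F c} = dx.real (fracIdeal F c) := by
  have := measure_preimage_add_right dx (-1) (fracIdeal F c)
  simp only [← sub_eq_add_neg] at this
  rw [Measure.real, Measure.real, ← this]
  rfl

include hdx hν in
theorem integrable_zetaIntegrand (D : IsNewFormDatum ϖ μ₁ μ₂ μ₃ c) (hψ : IsUnramifiedAddChar ψ)
    (hχ : HasConductor χ 0) (h_two : (2 : F) ≠ 0) (hτ : τ ≠ 0) {Y : ℂ}
    (hY : Y = (χ ϖ : ℂ) * (resCard F : ℂ) ^ (-(3 * s - 1)))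
    (h1 : ‖(μ₁ ϖ : ℂ) ^ 2 * Y‖ < 1) (h2 : ‖((μ₁ ϖ : ℂ) ^ 2)⁻¹ * Y‖ < 1) :
    Integrable (zetaIntegrand τ (whittaker dx ψ (newForm μ₁ μ₂ μ₃ c))
      (extendToG₂ τ χ s (sectionSL χ c s))) ν ∧
    zeta ν τ (whittaker dx ψ (newForm μ₁ μ₂ μ₃ c)) (extendToG₂ τ χ s (sectionSL χ c s)) =
      (dg.real (KSL F c) : ℂ) * (dx.real {b : F | b - 1 ∈ fracIdeal F c} : ℂ) *
        whittaker dx ψ (newForm μ₁ μ₂ μ₃ c) 1 *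
        ((1 + Y) / ((1 - (μ₁ ϖ : ℂ) ^ 2 * Y) * (1 - ((μ₁ ϖ : ℂ) ^ 2)⁻¹ * Y))) := by
  have hϖ := D.unif
  have hq := resCard_pos hϖ
  have hqC : (resCard F : ℂ) ≠ 0 := by exact_mod_cast hq.ne'
  set f := zetaIntegrand τ (whittaker dx ψ (newForm μ₁ μ₂ μ₃ c))
    (extendToG₂ τ χ s (sectionSL χ c s)) with hf
  set W := whittaker dx ψ (newForm μ₁ μ₂ μ₃ c) 1
  set C : ℂ := (dg.real (KSL F c) : ℂ) * (dx.real {b : F | b - 1 ∈ fracIdeal F c} : ℂ) * W with hC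
  set Q : ℕ → Set (QuotN₂ F) := fun m => quotCell c (ϖ ^ (m : ℤ)) with hQ
  have hQm : ∀ m, MeasurableSet (Q m) := fun m => measurableSet_quotCell hϖ _
  have hQd : Pairwise (Function.onFun Disjoint Q) := by
    intro m m' hmm
    refine Set.disjoint_left.2 fun x hx hx' => hmm ?_
    exact_mod_cast cell_disjoint hϖ D.one_le hx hx'
  obtain ⟨v, hv⟩ : ∃ v : ℕ → ℂ, ∀ m, v m = W *
      ((((μ₁ ϖ : ℂ) ^ 2) ^ m)⁻¹ * ((resCard F : ℂ) ^ (2 * m))⁻¹ *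
        ((χ ϖ : ℂ) * (resCard F : ℂ) ^ (-(3 * s))) ^ m *
        ∑ j ∈ Finset.range (2 * m + 1), ((μ₁ ϖ : ℂ) ^ 2) ^ j) := ⟨_, fun _ => rfl⟩
  have hfQ : ∀ m, Set.EqOn f (fun _ => v m) (Q m) := fun m x hx =>
    (zetaIntegrand_eq_of_mem dx hdx D hψ hχ h_two hτ hx).trans (hv m).symm
  have hν1 : ∀ m, ν (Q m) = ENNReal.ofReal ((resCard F : ℝ) ^ (3 * (m : ℤ) - c)) * dg (KSL F c) :=
    fun m => measure_quotCell dx hdx dg ν hν hϖ m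
  have hνlt : ∀ m, ν (Q m) < ∞ := fun m => by
    rw [hν1]
    exact ENNReal.mul_lt_top ENNReal.ofReal_lt_top (isCompact_KSL hϖ c).measure_lt_top
  have hνr : ∀ m, ν.real (Q m) = (resCard F : ℝ) ^ (3 * (m : ℤ) - c) * dg.real (KSL F c) :=
    fun m => by
      rw [Measure.real, hν1, ENNReal.toReal_mul, ENNReal.toReal_ofReal (zpow_pos hq _).le]
      rfl
  have hfi : ∀ m, IntegrableOn f (Q m) ν := fun m =>
    (integrableOn_congr_fun (hfQ m) (hQm m)).2 (integrableOn_const (hνlt m).ne)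
  have hint : ∀ m, ∫ x in Q m, f x ∂ν = C * (Y ^ m * (((μ₁ ϖ : ℂ) ^ 2) ^ m)⁻¹ *
      ∑ j ∈ Finset.range (2 * m + 1), ((μ₁ ϖ : ℂ) ^ 2) ^ j) := fun m => by
    have hYm : Y ^ m = ((χ ϖ : ℂ) * (resCard F : ℂ) ^ (-(3 * s))) ^ m * (resCard F : ℂ) ^ m := by
      rw [← mul_pow, hY, mul_assoc, show -(3 * s - 1) = -(3 * s) + 1 by ring,
        Complex.cpow_add _ _ hqC, Complex.cpow_one]
    rw [setIntegral_congr_fun (hQm m) (hfQ m), setIntegral_const, hνr, hv, hYm, hC,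
      measureReal_unit_coset, measureReal_fracIdeal dx hdx hϖ, Complex.real_smul]
    push_cast
    rw [sub_eq_add_neg, zpow_add₀ hqC, mul_comm (3 : ℤ), zpow_mul, zpow_natCast,
      show (resCard F : ℂ) ^ (2 * m) = ((resCard F : ℂ) ^ m) ^ 2 by ring]
    have : (resCard F : ℂ) ^ m ≠ 0 := pow_ne_zero _ hqC
    field_simp
  have hintn : ∀ m, ∫ x in Q m, ‖f x‖ ∂ν = ‖∫ x in Q m, f x ∂ν‖ := fun m => by
    rw [setIntegral_congr_fun (hQm m) (hfQ m), setIntegral_const,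
      setIntegral_congr_fun (g := fun _ => ‖v m‖) (hQm m) (fun x hx => by
        simp only [hfQ m hx]), setIntegral_const, norm_smul, Real.norm_of_nonneg measureReal_nonneg,
      smul_eq_mul]
  have hu : (μ₁ ϖ : ℂ) ^ 2 ≠ 0 := pow_ne_zero 2 (Units.ne_zero _)
  have hsum := (hasSum_torus_series hu h1 h2).mul_left C
  have hI : IntegrableOn f (⋃ m, Q m) ν := by
    refine integrableOn_iUnion_of_summable_integral_norm hfi ?_
    simp only [hintn, hint]
    exact hsum.summable.norm
  have hzero : ∀ x ∉ ⋃ m, Q m, f x = 0 := fun x hx =>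
    zetaIntegrand_eq_zero dx hdx D hψ hχ h_two hτ fun m hm => hx (Set.mem_iUnion.2 ⟨m, hm⟩)
  refine ⟨(integrableOn_iff_integrable_of_support_subset fun x hx => ?_).1 hI, ?_⟩
  · by_contra h
    exact hx (hzero x h)
  · have h3 := hasSum_integral_iUnion hQm hQd hI
    simp only [hint] at h3
    rw [zeta, ← setIntegral_eq_integral_of_forall_compl_eq_zero hzero]
    exact h3.unique hsum

end ZetaIntegral

/-- Two meromorphic functions on `ℂ` that agree near a point agree off a closed discrete set. -/
theorem eventuallyEq_codiscrete_of_eventuallyEq_nhds {f g : ℂ → ℂ} (hf : Meromorphic f)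
    (hg : Meromorphic g) {z : ℂ} (h : f =ᶠ[𝓝 z] g) : f =ᶠ[codiscrete ℂ] g := by
  have hfg : MeromorphicOn (f - g) Set.univ := fun x _ => (hf x).sub (hg x)
  have hz : meromorphicOrderAt (f - g) z = ⊤ := by
    rw [meromorphicOrderAt_eq_top_iff]
    filter_upwards [h.filter_mono nhdsWithin_le_nhds] with x hx
    rw [Pi.sub_apply, hx, sub_self]
  have hall : ∀ x, meromorphicOrderAt (f - g) x = ⊤ := by
    intro x
    by_contra hx
    exact hfg.meromorphicOrderAt_ne_top_of_isPreconnected isPreconnected_univ (Set.mem_univ x)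
      (Set.mem_univ z) hx hz
  rw [Filter.EventuallyEq, Filter.Eventually, mem_codiscrete]
  intro x
  rw [disjoint_principal_right, compl_compl]
  filter_upwards [meromorphicOrderAt_eq_top_iff.1 (hall x)] with y hy
  exact sub_eq_zero.1 hy

theorem tendsto_cpow_neg_norm {q : ℕ} (hq : 1 < (q : ℝ)) (a : ℂ) :
    Tendsto (fun x : ℝ => ‖a‖ * (q : ℝ) ^ (-(3 * x - 1))) atTop (𝓝 0) := by
  have h1 : Tendsto (fun x : ℝ => -(3 * x - 1)) atTop atBot :=
    tendsto_neg_atTop_atBot.comp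
      (tendsto_atTop_add_const_right _ (-1) (tendsto_id.const_mul_atTop (by norm_num)))
  have h2 := ((tendsto_rpow_atBot_of_base_gt_one (q : ℝ) hq).comp h1).const_mul ‖a‖
  rwa [mul_zero] at h2

theorem exists_norm_mul_cpow_lt_one {q : ℕ} (hq : 1 < (q : ℝ)) (a : ℂ) :
    ∃ σ : ℝ, ∀ s : ℂ, σ ≤ s.re → ‖a * (q : ℂ) ^ (-(3 * s - 1))‖ < 1 := by
  obtain ⟨σ, hσ⟩ := eventually_atTop.1
    ((tendsto_cpow_neg_norm hq a).eventually (gt_mem_nhds zero_lt_one))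
  refine ⟨σ, fun s hs => ?_⟩
  have h0 : 0 < q := by exact_mod_cast zero_lt_one.trans hq
  rw [norm_mul, Complex.norm_natCast_cpow_of_pos h0]
  simpa using hσ s.re hs

end GinzburgZeta

theorem mainTheorem5 {F : Type*} [NontriviallyNormedField F] [IsUltrametricDist F]
    [LocallyCompactSpace F] [MeasurableSpace F] [BorelSpace F]
    [MeasurableSpace (Matrix.SpecialLinearGroup (Fin 3) F)]
    [BorelSpace (Matrix.SpecialLinearGroup (Fin 3) F)]
    (h_two : (2 : F) ≠ 0)
    (ϖ : Fˣ) (hϖ : GinzburgZeta.IsNormalizedUniformizer ϖ)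
    -- the Haar measure of `F` with `vol(𝔬) = 1`, a Haar measure of `SL₃(F)`, and the quotient measure
    (dx : Measure F) [dx.IsAddHaarMeasure] (hdx : dx (GinzburgZeta.fracIdeal F 0) = 1)
    (dg : Measure (Matrix.SpecialLinearGroup (Fin 3) F)) [dg.IsHaarMeasure]
    (ν : Measure (GinzburgZeta.QuotN₂ F)) (hν : GinzburgZeta.IsQuotientMeasure dx dg ν)
    -- the characters
    (ψ : AddChar F Circle) (hψ : GinzburgZeta.IsUnramifiedAddChar ψ)
    (μ₁ μ₂ μ₃ χ : Fˣ →ₜ* ℂˣ)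
    (hμ₁ : GinzburgZeta.HasConductor μ₁ 0) (hμ₃ : GinzburgZeta.HasConductor μ₃ 0)
    (hμ₁₃ : ∀ a : Fˣ, μ₁ a * μ₃ a = 1)
    (c : ℕ) (hc : 1 ≤ c) (hμ₂ : GinzburgZeta.HasConductor μ₂ c)
    (hχ : GinzburgZeta.HasConductor χ 0)
    -- `ρ = τ²` is the fixed nonzero square
    (τ : F) (hτ : τ ≠ 0) :
    let q : ℂ := (GinzburgZeta.resCard F : ℂ)
    let t₁ : ℂ := (μ₁ ϖ : ℂ)
    let Wc : GL (Fin 3) F → ℂ :=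
      GinzburgZeta.whittaker dx ψ (GinzburgZeta.newForm μ₁ μ₂ μ₃ c)
    let fTilde : ℂ → Matrix (Fin 8) (Fin 8) F → ℂ := fun s =>
      GinzburgZeta.extendToG₂ τ χ s (GinzburgZeta.sectionSL χ c s)
    let Y : ℂ → ℂ := fun s => (χ ϖ : ℂ) * q ^ (-(3 * s - 1))
    let D : ℂ := (dg.real (GinzburgZeta.KSL F c) : ℂ) *
      (dx.real {b : F | b - 1 ∈ GinzburgZeta.fracIdeal F c} : ℂ) * Wc 1
    let R : ℂ → ℂ := fun s => D * ((1 + Y s) / ((1 - t₁ ^ 2 * Y s) * (1 - (t₁ ^ 2)⁻¹ * Y s)))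
    -- absolute convergence and the formula in the domain of convergence
    (∀ s : ℂ, ‖t₁ ^ 2 * Y s‖ < 1 → ‖(t₁ ^ 2)⁻¹ * Y s‖ < 1 →
      Integrable (GinzburgZeta.zetaIntegrand τ Wc (fTilde s)) ν ∧
      GinzburgZeta.zeta ν τ Wc (fTilde s) = R s) ∧
    -- the formula for the meromorphic continuation in `s`
    Meromorphic R ∧
    ∀ Z : ℂ → ℂ, Meromorphic Z →
      (∃ σ : ℝ, ∀ s : ℂ, σ < s.re → Z s = GinzburgZeta.zeta ν τ Wc (fTilde s)) →
      Z =ᶠ[codiscrete ℂ] R := by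
  intro q t₁ Wc fTilde Y D R
  have := GinzburgZeta.secondCountableTopology_of_locallyCompactSpace F
  have hD : GinzburgZeta.IsNewFormDatum ϖ μ₁ μ₂ μ₃ c := ⟨hϖ, hμ₁, hμ₃, hμ₁₃, hc, hμ₂⟩
  have hq := GinzburgZeta.one_lt_resCard hϖ
  have hqC : q ≠ 0 := by
    have := GinzburgZeta.resCard_pos hϖ
    exact Nat.cast_ne_zero.2 (by rintro h; simp [h] at this)
  have hmain : ∀ s : ℂ, ‖t₁ ^ 2 * Y s‖ < 1 → ‖(t₁ ^ 2)⁻¹ * Y s‖ < 1 →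
      Integrable (GinzburgZeta.zetaIntegrand τ Wc (fTilde s)) ν ∧
      GinzburgZeta.zeta ν τ Wc (fTilde s) = R s := fun s h1 h2 =>
    GinzburgZeta.integrable_zetaIntegrand dx hdx dg ν hν hD hψ hχ h_two hτ rfl h1 h2
  have hYd : Differentiable ℂ Y := by
    refine Differentiable.const_mul (Differentiable.const_cpow (by fun_prop) (Or.inl hqC)) _
  have hY : Meromorphic Y := fun x => (hYd.analyticAt x).meromorphicAt
  have hconst : ∀ a : ℂ, Meromorphic fun _ : ℂ => a := fun a x => MeromorphicAt.const a x
  have hR : Meromorphic R := (hconst D).mul (((hconst 1).add hY).div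
    (((hconst 1).sub ((hconst (t₁ ^ 2)).mul hY)).mul
      ((hconst 1).sub ((hconst (t₁ ^ 2)⁻¹).mul hY))))
  refine ⟨hmain, hR, fun Z hZ ⟨σ, hσ⟩ => ?_⟩
  obtain ⟨σ₁, hσ₁⟩ := GinzburgZeta.exists_norm_mul_cpow_lt_one hq (t₁ ^ 2 * χ ϖ)
  obtain ⟨σ₂, hσ₂⟩ := GinzburgZeta.exists_norm_mul_cpow_lt_one hq ((t₁ ^ 2)⁻¹ * χ ϖ)
  set σ' := max σ (max σ₁ σ₂) with hσ'
  refine GinzburgZeta.eventuallyEq_codiscrete_of_eventuallyEq_nhds (z := ((σ' + 1 : ℝ) : ℂ)) hZ hR ?_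
  have hopen : IsOpen {s : ℂ | σ' < s.re} := isOpen_lt continuous_const Complex.continuous_re
  filter_upwards [hopen.mem_nhds (by simp : ((σ' + 1 : ℝ) : ℂ) ∈ {s : ℂ | σ' < s.re})] with s hs
  have hs' : σ' < s.re := hs
  simp only [hσ', max_lt_iff] at hs'
  rw [hσ s hs'.1]
  refine (hmain s ?_ ?_).2
  · have := hσ₁ s hs'.2.1.le
    rwa [mul_assoc] at this
  · have := hσ₂ s hs'.2.2.le
    rwa [mul_assoc] at this
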